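/- **Conventions.** Logarithms are to base 2. A channel $W:\mathcal A\to\mathcal Z$ assigns to every $a\in\mathcal A$ a probability measure on the measurable space $\mathcal Z$; $W^n$ is its memoryless extension. $I(P,W)$ is the mutual information between an input with law $P$ and the output of $W$. *Biregular irreducible functions.* A surjective function $f:\mathcal S\times\mathcal X\to\mathcal N$ between finite sets is biregular irreducible with regularity set $\mathcal M\subset\mathcal N$ if there are integers $d_{\mathcal S},d_{\mathcal X}\ge1$ such that for all $m\in\mathcal M$: $|\{x:f(s,x)=m\}|=d_{\mathcal S}$ for all $s$, $|\{s:f(s,x)=m\}|=d_{\mathcal X}$ for all $x$, and the symmetric stochastic matrix $P_{f,m}(x,x')=|\{s:f(s,x)=f(s,x')=m\}|/(d_{\mathcal S}d_{\mathcal X})$ has second-largest eigenvalue modulus $\lambda_2(f,m)<1$. We say that $(f_n:\mathcal S_n\times\mathcal X_n\to\mathcal N_n)_n$ with regularity sets $\mathcal M_n$ is *good with parameters* $(r,t)$ if $$\frac{\log|\mathcal X_n|}{n}\to r,\qquad \frac{\log|\mathcal M_n|}{\log|\mathcal X_n|}\to 1-t,\qquad \liminf_n\frac{\min_{m\in\mathcal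 M_n}(-\log\lambda_2(f_n,m))}{\log|\mathcal X_n|}\ge t .$$ *Codes.* A memoryless wiretap channel is a pair of channels $(T:\mathcal A\to\mathcal Y,\,U:\mathcal A\to\mathcal Z)$ (to the receiver, to the eavesdropper) with sets $\mathcal A'_n\subset\mathcal A^n$ of permissible inputs. It is *discrete* if $\mathcal A,\mathcal Y,\mathcal Z$ are finite and $\mathcal A'_n=\mathcal A^n$. It is *Gaussian with noise variances $\sigma_T^2,\sigma_U^2>0$ and power constraint $\Gamma\ge0$* if $T,U$ are additive Gaussian noise channels with these variances and $\mathcal A_n'=\{a\in\mathbb R^n:\|a\|^2\le n\Gamma\}$. A blocklength-$n$ error-correcting code $(\phi,\psi)$ with finite message set $\mathcal X$ consists of a stochastic encoder $\phi:\mathcal X\to\mathcal A_n'$ with finitely supported output laws and a measurable decoder $\psi:\mathcal Y^n\to\mathcal X$; $e(\phi,\psi)$ is its maximal error probability. A sequence of such codes achieves a rate $r'$ if $\liminf_n\frac1n\log|\mathcal X_n|\ge r'$ and $e(\phi_n,\psi_n)\to0$, where $\mathcal X_n$ is the message set of $(\phi_n,\psi_n)$. For a seeded wiretap code with encoder $\xi:\mathcal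 S\times\mathcal M\to\mathcal A_n'$ and decoder $\zeta$ (which may declare errors), $e$ is the error probability, maximized over seeds and messages, and $L_{\rm sem}=\max_{P_M}I(M\wedge Z,S)$, where $M\sim P_M$ is independent of the uniformly distributed seed $S$ and $Z$ is generated from $(S,M)$ by $\xi U^n$. An ordinary wiretap code is one whose seed set has one element. A sequence of codes with message sets $\mathcal M_n$ and blocklengths $k_n$ *achieves the rate $R$ with semantic security* if $\liminf_n\frac{\log|\mathcal M_n|}{k_n}\ge R$, its error probabilities tend to $0$ and its leakages $L_{\rm sem}$ tend to $0$. *Modular BRI scheme* $\Pi(f,\phi,\psi)$, where $(\phi,\psi)$ has message set $\mathcal X$: given $(s,m)\in\mathcal S\times\mathcal M$, draw $x$ uniformly from $\{x:f(s,x)=m\}$ and send $x$ with $\phi$; decode $y$ to $f(s,\psi(y))$, declaring an error if this is not in $\mathcal M$. *Ordinary BRI wiretap code* $R_N(f,\phi,\psi)$, of blocklength $(N+1)n$ with message set $\mathcal M^N$, where $\mathcal S$ is embedded in $\mathcal X$ (so $|\mathcal S|\le|\mathcal X|$): draw $s\in\mathcal S$ uniformly; send $s$ with $\phi$ in the first block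 and $m_1,\dots,m_N$ with the encoder of $\Pi(f,\phi,\psi)$ with seed $s$ in the following $N$ blocks. The receiver decodes $\hat s$ from the first block (if $\psi$ yields an element of $\mathcal X\setminus\mathcal S$, $\hat s$ is any fixed function of it) and decodes the other blocks with seed $\hat s$. **Statement.** **(A) Single codes.** For every memoryless wiretap channel $(T,U)$, every blocklength-$n$ error-correcting code $(\phi,\psi)$ with message set $\mathcal X$, every biregular irreducible $f:\mathcal S\times\mathcal X\to\mathcal N$ with regularity set $\mathcal M$ and $\mathcal S$ embedded in $\mathcal X$, and every $N$, $$\frac{\log|\mathcal M|^N}{(N+1)n}=\frac N{N+1}\frac{\log|\mathcal M|}n,\qquad e(R_N(f,\phi,\psi))\le e(\phi,\psi)+N\,e(\Pi(f,\phi,\psi)),\qquad L_{\rm sem}(R_N(f,\phi,\psi))\le N\,L_{\rm sem}(\Pi(f,\phi,\psi)).$$ **(B) Asymptotics.** There is a function $\gamma_d(\delta,a,z)\ge0$ with $\gamma_d(\delta,a,z)\to0$ as $\delta\downarrow0$ for all positive integers $a,z$, such that the following holds. Let $r\ge0$, $0\le t<1$, let $(f_n)$ be good with parameters $(r,t)$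 and $|\mathcal S_n|\le|\mathcal X_n|$ for all $n$. Let $(\phi_n,\psi_n)$ be blocklength-$n$ error-correcting codes for a wiretap channel $(T,U)$ which achieve a rate strictly larger than $r$; for large $n$, $\mathcal X_n$ is then identified with a subset of the message set of $(\phi_n,\psi_n)$, and the code is restricted to the messages in $\mathcal X_n$. Suppose that one of the following holds: 1. $(T,U)$ is discrete and $tr>\max_PI(P,U)$; 2. $(T,U)$ is discrete, there are a distribution $P$ on $\mathcal A$ and $\delta_1>0$ such that for all large $n$ all codewords lie in the set of $(a_1,\dots,a_n)\in\mathcal A^n$ with $\bigl|\tfrac1n|\{i:a_i=a\}|-P(a)\bigr|\le\delta_1$ for all $a$, and $a_i\ne a$ for all $i$ if $P(a)=0$, and $tr>I(P,U)+\gamma_d(\delta_1,|\mathcal A|,|\mathcal Z|)$; 3. $(T,U)$ is Gaussian with noise variances $\sigma_T^2,\sigma_U^2>0$ and power constraint $\Gamma\ge0$, and $tr>\frac12\log(1+\Gamma/\sigma_U^2)$. Put $\varepsilon_n=\max\{e(\Pi(f_n,\phi_n,\psi_n)),L_{\rm sem}(\Pi(f_n,\phi_n,\psi_n))\}$ and call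 a sequence $(N_n)$ of nonnegative integers *admissible* if $N_n\to\infty$ and $N_n\varepsilon_n\to0$. Then: * admissible sequences exist; * there is a $c>0$ such that for every admissible $(N_n)$ the ordinary wiretap codes $R_{N_n}(f_n,\phi_n,\psi_n)$ (with permissible inputs) achieve the rate $(1-t)r$ with semantic security, and $L_{\rm sem}(R_{N_n}(f_n,\phi_n,\psi_n))\le N_n2^{-cn}$ for all large $n$; thus the leakage decreases exponentially in $n$ whenever $N_n$ grows subexponentially in $n$; * if $\varepsilon_n>0$ for all large $n$, then $N_n=\lfloor-\log\varepsilon_n\rfloor$ (taken as $0$ for the finitely many $n$ where this is negative or undefined) is admissible, and for this choice $L_{\rm sem}(R_{N_n}(f_n,\phi_n,\psi_n))$ decreases exponentially in $n$. -/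

import Mathlib

open MeasureTheory ProbabilityTheory Filter Topology
open scoped ENNReal NNReal

namespace Wiretap

universe u v w x

/-! ### Probability preliminaries -/

section Prelim

/-- The product of the distributions `p 0, …, p (k-1)` (see `prodPMF_apply`). -/
noncomputable def prodPMF {α : Type u} : {k : ℕ} → (Fin k → PMF α) → PMF (Fin k → α)
  | 0, _ => PMF.pure Fin.elim0
  | _ + 1, p => (p 0).bind fun a =>
      (prodPMF fun i => p i.succ).map fun b => (Fin.cons a b : Fin (_ + 1) → α)

theorem prodPMF_apply {α : Type u} {k : ℕ} (p : Fin k → PMF α) (a : Fin k → α) :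
    prodPMF p a = ∏ i, p i (a i) := by
  classical
  induction k with
  | zero =>
    have h : a = Fin.elim0 := Subsingleton.elim _ _
    subst h
    simp [prodPMF]
  | succ k ih =>
    rw [prodPMF, PMF.bind_apply, tsum_eq_single (a 0)]
    · rw [PMF.map_apply, tsum_eq_single (Fin.tail a)]
      · rw [ih, Fin.prod_univ_succ]
        simp [Fin.tail]
      · intro b hb
        rw [if_neg]
        rintro h
        apply hb
        rw [h, Fin.tail_cons]
    · intro b hb
      have : (PMF.map (fun c => (Fin.cons b c : Fin (k + 1) → α))
          (prodPMF fun i => p i.succ)) a = 0 := by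
        rw [PMF.map_apply, ENNReal.tsum_eq_zero]
        intro c
        rw [if_neg]
        rintro rfl
        simp at hb
      rw [this, mul_zero]

theorem prodPMF_finite_support {α : Type u} {k : ℕ} (p : Fin k → PMF α)
    (hp : ∀ i, (p i).support.Finite) : (prodPMF p).support.Finite := by
  refine (Set.Finite.pi' hp).subset ?_
  intro a ha i
  rw [PMF.mem_support_iff, prodPMF_apply] at ha
  rw [PMF.mem_support_iff]
  exact Finset.prod_ne_zero_iff.mp ha i (Finset.mem_univ i)

/-- A channel with input alphabet `A` (no structure needed) and measurable output alphabet `Z`. -/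
abbrev Channel (A : Type u) (Z : Type v) [MeasurableSpace Z] := A → ProbabilityMeasure Z

/-- The output distribution `P W = ∑ a, P(a) W(· | a)`. -/
noncomputable def output {A : Type u} {Z : Type v} [MeasurableSpace Z]
    (P : PMF A) (W : Channel A Z) : ProbabilityMeasure Z :=
  ⟨Measure.sum fun a => P a • (W a : Measure Z), ⟨by
    rw [Measure.sum_apply _ MeasurableSet.univ]
    simp [P.tsum_coe]⟩⟩

/-- The blocklength-`n` memoryless extension `W^n`. -/
noncomputable def Channel.pow {A : Type u} {Z : Type v} [MeasurableSpace Z]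
    (W : Channel A Z) (n : ℕ) : Channel (Fin n → A) (Fin n → Z) :=
  fun a => ProbabilityMeasure.pi fun i => W (a i)

/-- The additive Gaussian noise channel with noise variance `σ2`. -/
noncomputable def gaussianChannel (σ2 : ℝ≥0) : Channel ℝ ℝ :=
  fun a => ⟨gaussianReal a σ2, inferInstance⟩

/-- The mutual information, in bits, of `X` and `Z`, where `X` has distribution `P` (on a discrete
set) and `Z` is generated by `X` via `W`: the Kullback-Leibler divergence of the joint distribution
from the product of the marginals. -/
noncomputable def mutualInfo {X : Type u} {Z : Type v} [MeasurableSpace Z]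
    (P : PMF X) (W : Channel X Z) : ℝ≥0∞ :=
  letI : MeasurableSpace X := ⊤
  InformationTheory.klDiv
      (Measure.sum fun x => P x • (Measure.dirac x).prod (W x : Measure Z))
      (P.toMeasure.prod (output P W : Measure Z))
    / ENNReal.ofReal (Real.log 2)

end Prelim

/-! ### Biregular irreducible functions -/

section BRI

/-- The matrix `P_{f,m}(x,x') = |{s : f(s,x) = f(s,x') = m}| / (dS dX)`. -/
noncomputable def stepMatrix {S : Type u} {X : Type v} {K : Type w}
    (f : S → X → K) (dS dX : ℕ) (m : K) : Matrix X X ℝ :=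
  Matrix.of fun x x' => (Set.ncard {s | f s x = m ∧ f s x' = m} : ℝ) / ((dS : ℝ) * (dX : ℝ))

theorem stepMatrix_isHermitian {S : Type u} {X : Type v} {K : Type w}
    (f : S → X → K) (dS dX : ℕ) (m : K) : (stepMatrix f dS dX m).IsHermitian := by
  ext x x'
  simp only [stepMatrix, Matrix.conjTranspose_apply, Matrix.of_apply, star_trivial]
  simp only [and_comm]

open Classical in
/-- The second-largest eigenvalue modulus of a symmetric real matrix: with the eigenvalues
`μ₁ ≥ μ₂ ≥ …` counted with multiplicity, the maximum of `|μᵢ|` over `i ≥ 2`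
(and `0` for a `1 × 1` matrix). -/
noncomputable def secondEigenvalueModulus {X : Type v} [Fintype X] {A : Matrix X X ℝ}
    (hA : A.IsHermitian) : ℝ :=
  ⨆ i : {i : Fin (Fintype.card X) // 0 < (i : ℕ)}, |hA.eigenvalues₀ i.1|

/-- A biregular irreducible function `f : S × X → K` with its regularity set. -/
structure BRI (S : Type u) (X : Type v) (K : Type w) [Fintype X] where
  toFun : S → X → K
  surjective : ∀ k, ∃ s x, toFun s x = k
  regSet : Finset K
  dS : ℕ
  dX : ℕ
  dS_pos : 0 < dS
  dX_pos : 0 < dX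
  S_regular : ∀ m ∈ regSet, ∀ s, Set.ncard {x | toFun s x = m} = dS
  X_regular : ∀ m ∈ regSet, ∀ x, Set.ncard {s | toFun s x = m} = dX
  irreducible : ∀ m ∈ regSet,
    secondEigenvalueModulus (stepMatrix_isHermitian toFun dS dX m) < 1

variable {S : Type u} {X : Type v} {K : Type w} [Fintype X]

/-- `λ₂(f, m)`. -/
noncomputable def BRI.lambda2 (f : BRI S X K) (m : K) : ℝ :=
  secondEigenvalueModulus (stepMatrix_isHermitian f.toFun f.dS f.dX m)

/-- The regularity set as a type: the message set of the codes built from `f`. -/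
abbrev BRI.Msg (f : BRI S X K) : Type w := {m : K // m ∈ f.regSet}

open Classical in
theorem BRI.fiber_nonempty (f : BRI S X K) (s : S) (m : f.Msg) :
    (Finset.univ.filter fun x => f.toFun s x = m.1).Nonempty := by
  have h := f.S_regular m.1 m.2 s
  have h2 : ({x | f.toFun s x = m.1} : Set X).Nonempty := by
    apply Set.nonempty_of_ncard_ne_zero
    rw [h]
    exact f.dS_pos.ne'
  obtain ⟨y, hy⟩ := h2
  exact ⟨y, by simpa using hy⟩

open Classical in
/-- The randomized inverse `f_s⁻¹(· | m)`: the uniform distribution on `{x : f(s,x) = m}`. -/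
noncomputable def BRI.randInv (f : BRI S X K) (s : S) (m : f.Msg) : PMF X :=
  PMF.uniformOfFinset (Finset.univ.filter fun x => f.toFun s x = m.1) (f.fiber_nonempty s m)

/-- `-log₂ x` for `x ≥ 0`, with `-log₂ 0 = +∞`. -/
noncomputable def negLog2 (x : ℝ) : EReal := if x = 0 then ⊤ else ((-Real.logb 2 x : ℝ) : EReal)

/-- The asymptotic conditions on a sequence of biregular irreducible functions `f n`, with
regularity sets `M n`: `log|X n| / n → r`, `log|M n| / log|X n| → 1 - t`, and
`liminf (min_m -log λ₂(f n, m)) / log|X n| ≥ t`. -/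
def IsGoodSequence {S : ℕ → Type u} {X : ℕ → Type v} {K : ℕ → Type w} [∀ n, Fintype (X n)]
    (f : ∀ n, BRI (S n) (X n) (K n)) (r t : ℝ) : Prop :=
  Tendsto (fun n : ℕ => Real.logb 2 (Fintype.card (X n)) / (n : ℝ)) atTop (𝓝 r) ∧
  Tendsto (fun n : ℕ => Real.logb 2 ((f n).regSet.card) / Real.logb 2 (Fintype.card (X n)))
    atTop (𝓝 (1 - t)) ∧
  (t : EReal) ≤ liminf (fun n : ℕ => (⨅ m ∈ (f n).regSet, negLog2 ((f n).lambda2 m)) /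
    ((Real.logb 2 (Fintype.card (X n)) : ℝ) : EReal)) atTop

end BRI

/-! ### Codes -/

section Codes

/-- An error-correcting code with message set `X`, channel input alphabet `A` and output
alphabet `Y`: a stochastic encoder and a deterministic decoder. -/
structure ErrCode (X : Type u) (A : Type v) (Y : Type w) [MeasurableSpace Y] where
  enc : X → PMF A
  finite_support : ∀ m, (enc m).support.Finite
  dec : Y → X
  measurable_dec : ∀ m, MeasurableSet {y | dec y = m}

/-- The maximal error probability `e(φ, ψ)` over the channel `T`. -/
noncomputable def ErrCode.err {X : Type u} {A : Type v} {Y : Type w} [MeasurableSpace Y]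
    (C : ErrCode X A Y) (T : Channel A Y) : ℝ≥0∞ :=
  ⨆ m, (output (C.enc m) T : Measure Y) {y | C.dec y ≠ m}

/-- The code obtained by using only the messages in `X`, identified with elements of the
message set `X'` by `ι`; the decoder is followed by `ρ`, to be a left inverse of `ι`. -/
def ErrCode.restrict {X X' : Type*} {A : Type v} {Y : Type w} [MeasurableSpace Y] [Finite X']
    (C : ErrCode X' A Y) (ι : X → X') (ρ : X' → X) : ErrCode X A Y where
  enc m := C.enc (ι m)
  finite_support m := C.finite_support (ι m)
  dec y := ρ (C.dec y)
  measurable_dec m := by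
    have h : {y | ρ (C.dec y) = m} = ⋃ k ∈ {k : X' | ρ k = m}, {y | C.dec y = k} := by
      ext y; simp
    rw [h]
    exact MeasurableSet.biUnion (Set.to_countable _) fun k _ => C.measurable_dec k

/-- A seeded wiretap code with seed set `S` and message set `M`. The decoder output `none` is a
declared error. An ordinary wiretap code is one with `S = Unit`. -/
structure SeededCode (S : Type u) (M : Type v) (A : Type w) (Y : Type x) [MeasurableSpace Y] where
  enc : S → M → PMF A
  finite_support : ∀ s m, (enc s m).support.Finite
  dec : S → Y → Option M
  measurable_dec : ∀ s m, MeasurableSet {y | dec s y = some m}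

/-- The maximal error probability `e(ξ, ζ)` over the channel `T`. -/
noncomputable def SeededCode.err {S : Type*} {M : Type*} {A : Type*} {Y : Type*}
    [MeasurableSpace Y] (C : SeededCode S M A Y) (T : Channel A Y) : ℝ≥0∞ :=
  ⨆ (s : S) (m : M), (output (C.enc s m) T : Measure Y) {y | C.dec s y ≠ some m}

/-- The semantic security information leakage `max_{P_M} I(M ∧ Z,S)`, where the seed `S` is uniform
and independent of `M`, and `Z` is generated by `S` and `M` through the encoder and `U`. -/
noncomputable def SeededCode.leak {S : Type*} {M : Type*} {A : Type*} {Y : Type*}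
    {Z : Type*} [MeasurableSpace Y] [MeasurableSpace Z] [Fintype S] [Nonempty S]
    (C : SeededCode S M A Y) (U : Channel A Z) : ℝ≥0∞ :=
  letI : MeasurableSpace S := ⊤
  ⨆ P : PMF M, mutualInfo P fun m => output (PMF.uniformOfFintype S) fun s =>
    (output (C.enc s m) U).prod (⟨Measure.dirac s, inferInstance⟩ : ProbabilityMeasure S)

/-- All channel inputs produced by the encoder lie in `B`. -/
def ErrCode.InputsIn {X : Type*} {A : Type*} {Y : Type*} [MeasurableSpace Y]
    (C : ErrCode X A Y) (B : Set A) : Prop := ∀ m, (C.enc m).support ⊆ B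

/-- All channel inputs produced by the encoder lie in `B`. -/
def SeededCode.InputsIn {S : Type*} {M : Type*} {A : Type*} {Y : Type*}
    [MeasurableSpace Y] (C : SeededCode S M A Y) (B : Set A) : Prop :=
  ∀ s m, (C.enc s m).support ⊆ B

/-- The rate `log₂|M| / n` of a code with message set `M` and blocklength `n`. -/
noncomputable def rate (M : Type*) [Fintype M] (n : ℕ) : ℝ :=
  Real.logb 2 (Fintype.card M) / (n : ℝ)

/-- The modular BRI scheme `Π(f, φ, ψ)`: the encoder is `f_s⁻¹ φ`, and `y` is decoded to
`f(s, ψ(y))` (a declared error if this is outside the regularity set). -/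
noncomputable def modular {S : Type*} {X : Type*} {K : Type*} {A : Type*} {Y : Type*}
    [Fintype X] [MeasurableSpace Y] (f : BRI S X K) (C : ErrCode X A Y) :
    SeededCode S f.Msg A Y where
  enc s m := (f.randInv s m).bind C.enc
  finite_support s m := by
    rw [PMF.support_bind]
    exact Set.Finite.biUnion (Set.toFinite _) fun k _ => C.finite_support k
  dec s y := open Classical in
    if h : f.toFun s (C.dec y) ∈ f.regSet then some ⟨f.toFun s (C.dec y), h⟩ else none
  measurable_dec s m := by
    classical
    have h : {y | (if h : f.toFun s (C.dec y) ∈ f.regSet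
        then some (⟨f.toFun s (C.dec y), h⟩ : f.Msg) else none) = some m}
        = ⋃ k ∈ {k : X | f.toFun s k = m.1}, {y | C.dec y = k} := by
      ext y
      simp only [Set.mem_ofPred_eq, Set.mem_iUnion, exists_prop, exists_eq_right']
      constructor
      · intro h
        split_ifs at h with h1
        exact congrArg Subtype.val (Option.some.inj h)
      · intro h
        have h1 : f.toFun s (C.dec y) ∈ f.regSet := h ▸ m.2
        rw [dif_pos h1]
        exact congrArg some (Subtype.ext h)
    rw [h]
    exact MeasurableSet.biUnion (Set.to_countable _) fun k _ => C.measurable_dec k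

/-- Concatenation of `k` blocks of length `n`. -/
def joinBlocks {A : Type u} {k n : ℕ} (b : Fin k → Fin n → A) : Fin (k * n) → A :=
  fun i => b (finProdFinEquiv.symm i).1 (finProdFinEquiv.symm i).2

/-- The `j`-th of `k` consecutive blocks of length `n`. -/
def block {A : Type u} {k n : ℕ} (j : Fin k) (a : Fin (k * n) → A) : Fin n → A :=
  fun i => a (finProdFinEquiv (j, i))

theorem measurable_block {Y : Type u} [MeasurableSpace Y] {k n : ℕ} (j : Fin k) :
    Measurable (block j : (Fin (k * n) → Y) → Fin n → Y) :=
  measurable_pi_lambda _ fun _ => measurable_pi_apply _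

open Classical in
/-- A sequence of decoded symbols, `none` if one of them is a declared error. -/
noncomputable def collect {M : Type u} {k : ℕ} (a : Fin k → Option M) : Option (Fin k → M) :=
  if h : ∀ j, (a j).isSome then some fun j => (a j).get (h j) else none

theorem collect_eq_some {M : Type u} {k : ℕ} (a : Fin k → Option M) (m : Fin k → M) :
    collect a = some m ↔ ∀ j, a j = some (m j) := by
  classical
  unfold collect
  constructor
  · intro h
    split_ifs at h with h1
    intro j
    rw [← Option.some.inj h]
    simp
  · intro h
    have h1 : ∀ j, (a j).isSome := fun j => by simp [h j]
    rw [dif_pos h1]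
    congr 1
    funext j
    simp [h j]

/-- The ordinary BRI wiretap code `R_N(f, φ, ψ)` of blocklength `(N+1) n`. The sender draws a
uniform seed `s`, sends `s` with the error-correcting code in block `0`, and sends `m j` with the
modular BRI scheme with seed `s` in block `j + 1`. The receiver decodes `ŝ` from block `0` and uses
it for decoding the other blocks. The map `σ` embeds `S` in the message set `X` of the
error-correcting code, and `τ` is to be a left inverse of `σ`. -/
noncomputable def seedReuse {S : Type*} {X : Type*} {K : Type*} {A : Type*} {Y : Type*}
    [Fintype S] [Nonempty S] [Fintype X] [MeasurableSpace Y] {n : ℕ}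
    (f : BRI S X K) (C : ErrCode X (Fin n → A) (Fin n → Y)) (σ : S → X) (τ : X → S) (N : ℕ) :
    SeededCode Unit (Fin N → f.Msg) (Fin ((N + 1) * n) → A) (Fin ((N + 1) * n) → Y) where
  enc _ m := (PMF.uniformOfFintype S).bind fun s =>
    (prodPMF (Fin.cons (C.enc (σ s)) fun j => (modular f C).enc s (m j) :
      Fin (N + 1) → PMF (Fin n → A))).map joinBlocks
  finite_support _ m := by
    rw [PMF.support_bind]
    refine Set.Finite.biUnion (Set.toFinite _) fun s _ => ?_
    rw [PMF.support_map]
    refine Set.Finite.image _ (prodPMF_finite_support _ fun j => ?_)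
    refine Fin.cases ?_ (fun j => ?_) j
    · exact C.finite_support _
    · exact (modular f C).finite_support s (m j)
  dec _ y := collect fun j : Fin N =>
    (modular f C).dec (τ (C.dec (block 0 y))) (block j.succ y)
  measurable_dec _ m := by
    have h : {y : Fin ((N + 1) * n) → Y | collect (fun j : Fin N =>
        (modular f C).dec (τ (C.dec (block 0 y))) (block j.succ y)) = some m}
        = ⋃ k : X, (block 0 ⁻¹' {y | C.dec y = k}) ∩
            ⋂ j : Fin N, block j.succ ⁻¹' {y | (modular f C).dec (τ k) y = some (m j)} := by
      ext y
      simp [collect_eq_some]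
    rw [h]
    exact MeasurableSet.iUnion fun k =>
      (measurable_block 0 (C.measurable_dec k)).inter
        (MeasurableSet.iInter fun j =>
          measurable_block j.succ ((modular f C).measurable_dec (τ k) (m j)))

end Codes

/-! ### Memoryless wiretap channels and asymptotics -/

section Asymptotics

/-- A memoryless wiretap channel: the channel `T` to the intended receiver, the channel `U` to the
eavesdropper, and the sets of permissible inputs. -/
structure WiretapChannel (A : Type u) (Y : Type v) (Z : Type w)
    [MeasurableSpace Y] [MeasurableSpace Z] where
  T : Channel A Y
  U : Channel A Z
  permissible : ∀ n : ℕ, Set (Fin n → A)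

/-- A wiretap channel without input constraints. -/
def unconstrained {A : Type u} {Y : Type v} {Z : Type w} [MeasurableSpace Y] [MeasurableSpace Z]
    (T : Channel A Y) (U : Channel A Z) : WiretapChannel A Y Z where
  T := T
  U := U
  permissible _ := Set.univ

/-- The Gaussian wiretap channel with noise variances `vT`, `vU` and input power constraint `Γ`. -/
noncomputable def gaussianWiretap (vT vU : ℝ≥0) (Γ : ℝ) : WiretapChannel ℝ ℝ ℝ where
  T := gaussianChannel vT
  U := gaussianChannel vU
  permissible n := {a | ∑ i, (a i) ^ 2 ≤ (n : ℝ) * Γ}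

/-- The `δ`-typical set of `P`. -/
def typicalSet {A : Type u} (P : PMF A) (δ : ℝ) (n : ℕ) : Set (Fin n → A) :=
  {a | ∀ b : A, |(Set.ncard {i | a i = b} : ℝ) / (n : ℝ) - (P b).toReal| ≤ δ ∧
    (P b = 0 → ∀ i, a i ≠ b)}

variable {A : Type u} {Y : Type v} {Z : Type w} [MeasurableSpace Y] [MeasurableSpace Z]

/-- The blocklength-`n` error-correcting codes `C n` achieve the rate `r` over `ch`. -/
def WiretapChannel.CodesAchieve (ch : WiretapChannel A Y Z) {X : ℕ → Type*}
    [∀ n, Fintype (X n)] (C : ∀ n, ErrCode (X n) (Fin n → A) (Fin n → Y)) (r : ℝ) : Prop :=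
  (∀ n, (C n).InputsIn (ch.permissible n)) ∧
  (r : EReal) ≤ liminf (fun n => ((rate (X n) n : ℝ) : EReal)) atTop ∧
  Tendsto (fun n => (C n).err (ch.T.pow n)) atTop (𝓝 0)

/-- The seeded wiretap codes `C n` of blocklengths `len n` achieve the rate `r` over `ch` with
semantic security. -/
def WiretapChannel.AchievesSemSec (ch : WiretapChannel A Y Z) (len : ℕ → ℕ)
    {S : ℕ → Type*} {M : ℕ → Type*} [∀ n, Fintype (S n)] [∀ n, Nonempty (S n)]
    [∀ n, Fintype (M n)]
    (C : ∀ n, SeededCode (S n) (M n) (Fin (len n) → A) (Fin (len n) → Y)) (r : ℝ) : Prop :=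
  (∀ n, (C n).InputsIn (ch.permissible (len n))) ∧
  (r : EReal) ≤ liminf (fun n => ((rate (M n) (len n) : ℝ) : EReal)) atTop ∧
  Tendsto (fun n => (C n).err (ch.T.pow (len n))) atTop (𝓝 0) ∧
  Tendsto (fun n => (C n).leak (ch.U.pow (len n))) atTop (𝓝 0)

variable {S : ℕ → Type*} {X : ℕ → Type*} {K : ℕ → Type*}
  [∀ n, Fintype (S n)] [∀ n, Nonempty (S n)] [∀ n, Fintype (X n)]

/-- `max {e(Π(f n, φ n, ψ n)), L_sem(Π(f n, φ n, ψ n))}`. -/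
noncomputable def WiretapChannel.schemeMax (ch : WiretapChannel A Y Z)
    (f : ∀ n, BRI (S n) (X n) (K n)) (C : ∀ n, ErrCode (X n) (Fin n → A) (Fin n → Y))
    (n : ℕ) : ℝ≥0∞ :=
  max ((modular (f n) (C n)).err (ch.T.pow n)) ((modular (f n) (C n)).leak (ch.U.pow n))

/-- The numbers of seed reuses `N n` satisfy `N n → ∞` and
`N n * max {e(Π(f n, φ n, ψ n)), L_sem(Π(f n, φ n, ψ n))} → 0`. -/
def WiretapChannel.Admissible (ch : WiretapChannel A Y Z)
    (f : ∀ n, BRI (S n) (X n) (K n)) (C : ∀ n, ErrCode (X n) (Fin n → A) (Fin n → Y))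
    (N : ℕ → ℕ) : Prop :=
  Tendsto N atTop atTop ∧
  Tendsto (fun n => (N n : ℝ≥0∞) * ch.schemeMax f C n) atTop (𝓝 0)

/-- `⌊-log₂ max {e(Π(f n, φ n, ψ n)), L_sem(Π(f n, φ n, ψ n))}⌋`. -/
noncomputable def WiretapChannel.logChoice (ch : WiretapChannel A Y Z)
    (f : ∀ n, BRI (S n) (X n) (K n)) (C : ∀ n, ErrCode (X n) (Fin n → A) (Fin n → Y))
    (n : ℕ) : ℕ :=
  ⌊-Real.logb 2 (ch.schemeMax f C n).toReal⌋₊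

/-- Seed reuse achieves the semantic security rate `R` for the modular BRI schemes
`Π(f n, φ n, ψ n)`:
* admissible sequences `(N n)` exist;
* for every admissible `(N n)`, the codes `R_{N n}(f n, φ n, ψ n)` achieve the rate `R` with semantic
  security, with leakage at most `N n * 2^(-c n)` eventually, `c > 0` independent of `(N n)`;
* the logarithmic choice of `N n`, if defined, is admissible, and then the leakage of the
  `R_{N n}(f n, φ n, ψ n)` decreases exponentially in `n`. -/
def WiretapChannel.SeedReuseAchieves (ch : WiretapChannel A Y Z)
    (f : ∀ n, BRI (S n) (X n) (K n)) (C : ∀ n, ErrCode (X n) (Fin n → A) (Fin n → Y))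
    (σ : ∀ n, S n → X n) (τ : ∀ n, X n → S n) (R : ℝ) : Prop :=
  (∃ N : ℕ → ℕ, ch.Admissible f C N) ∧
  (∃ c : ℝ, 0 < c ∧ ∀ N : ℕ → ℕ, ch.Admissible f C N →
    ch.AchievesSemSec (fun n => (N n + 1) * n)
      (fun n => seedReuse (f n) (C n) (σ n) (τ n) (N n)) R ∧
    ∀ᶠ n : ℕ in atTop,
      (seedReuse (f n) (C n) (σ n) (τ n) (N n)).leak (ch.U.pow ((N n + 1) * n)) ≤
        (N n : ℝ≥0∞) * ENNReal.ofReal ((2 : ℝ) ^ (-(c * (n : ℝ))))) ∧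
  ((∀ᶠ n in atTop, 0 < ch.schemeMax f C n) →
    ch.Admissible f C (ch.logChoice f C) ∧
    ∃ c : ℝ, 0 < c ∧ ∀ᶠ n : ℕ in atTop,
      (seedReuse (f n) (C n) (σ n) (τ n) (ch.logChoice f C n)).leak
        (ch.U.pow ((ch.logChoice f C n + 1) * n)) ≤
        ENNReal.ofReal ((2 : ℝ) ^ (-(c * (n : ℝ)))))

end Asymptotics

end Wiretap

open Wiretap

namespace Wiretap

open InformationTheory Set

/-! ### Mixtures of probability measures -/

section Mixtures

variable {A B Z Z' : Type*} [MeasurableSpace Z] [MeasurableSpace Z']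

/-! Mutual information is at most the average divergence of the channel outputs from any reference
distribution (`mutualInfo_mul_log_le`), so an upper bound on a leakage only requires a well-chosen
reference.

Single codes. The error bound is a union bound over the blocks. For the leakage
(`seedReuse_leak_le`), the reference is a mixture over the seeds s of product distributions: block 0
has the true output law for s, and block j has the output law for seed s averaged over the marginal
law of the j-th message. Joint convexity of the divergence discards the seed, the divergence of
products is at most the sum over the blocks, and block 0 contributes zero. The divergence left in
block j, averaged over seeds and messages, is bounded by the leakage of the modular scheme.

Asymptotics. Everything follows once the leakage of the modular scheme decreases exponentially
(`WiretapChannel.seedReuseAchieves_of_leak`). This is privacy amplification (`BRI.sum_klDiv_le`).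
Given s and m, the output density is the average, over the fiber of x with f(s,x) = m, of the
densities belonging to x. Averaged over s, this is the mean over all x, and its second moment
exceeds the squared mean by at most `lambda2` times the mean square; the latter is seen by expanding
in an eigenbasis of the step matrix. Densities bounded by κ therefore give a divergence of order
`lambda2` times κ. Densities above the threshold are split off: if their mass is at most ε, they
cost about ε log|X|, which is harmless for exponentially small ε.

For a memoryless channel, densities are taken with respect to a product reference, and a Chernoff
bound (`pow_tail_le`) shows that they rarely exceed a threshold with exponent slightly above R,
where R (in nats) governs the exponential moments of the information density. Since `lambda2` is
about 2^(-trn), the condition R < tr log 2 suffices (`exists_modular_leak_le`). The three cases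
differ in the reference: an output law within ε of capacity from every letter, the output law of P
slightly mixed with that of the uniform input, or the centered Gaussian law of variance σ² + Γ. -/

theorem coe_output (P : PMF A) (W : Channel A Z) :
    (output P W : Measure Z) = Measure.sum fun a => P a • (W a : Measure Z) := rfl

theorem lintegral_output (P : PMF A) (W : Channel A Z) (f : Z → ℝ≥0∞) :
    ∫⁻ z, f z ∂(output P W : Measure Z) = ∑' a, P a * ∫⁻ z, f z ∂(W a : Measure Z) := by
  rw [coe_output, lintegral_sum_measure]
  simp

theorem output_apply (P : PMF A) (W : Channel A Z) {s : Set Z} (hs : MeasurableSet s) :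
    (output P W : Measure Z) s = ∑' a, P a * (W a : Measure Z) s := by
  rw [coe_output, Measure.sum_apply _ hs]
  simp

theorem tsum_bind_mul (P : PMF A) (q : A → PMF B) (F : B → ℝ≥0∞) :
    ∑' b, P.bind q b * F b = ∑' a, P a * ∑' b, q a b * F b := by
  simp_rw [PMF.bind_apply, ← ENNReal.tsum_mul_right, ← ENNReal.tsum_mul_left]
  rw [ENNReal.tsum_comm]
  simp_rw [mul_assoc]

theorem tsum_pure_mul (a : A) (F : A → ℝ≥0∞) : ∑' b, PMF.pure a b * F b = F a := by
  rw [tsum_eq_single a]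
  · simp
  · intro b hb
    simp [hb]

theorem tsum_map_mul (P : PMF A) (g : A → B) (F : B → ℝ≥0∞) :
    ∑' b, P.map g b * F b = ∑' a, P a * F (g a) := by
  rw [PMF.map, tsum_bind_mul]
  simp_rw [Function.comp_apply, tsum_pure_mul]

theorem output_bind (P : PMF A) (q : A → PMF B) (W : Channel B Z) :
    output (P.bind q) W = output P fun a => output (q a) W := by
  refine Subtype.ext (Measure.ext fun s hs => ?_)
  change (output (P.bind q) W : Measure Z) s = (output P (fun a => output (q a) W) : Measure Z) s
  rw [output_apply _ _ hs, output_apply _ _ hs, tsum_bind_mul]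
  simp_rw [output_apply _ _ hs]

theorem map_output (P : PMF A) (W : Channel A Z) {g : Z → Z'} (hg : Measurable g) :
    (output P W : Measure Z).map g =
      output P (fun a => (W a).map hg.aemeasurable) := by
  refine Measure.ext fun s hs => ?_
  rw [Measure.map_apply hg hs, output_apply _ _ (hg hs), output_apply _ _ hs]
  refine tsum_congr fun a => ?_
  congr 1
  exact (Measure.map_apply hg hs).symm

theorem output_absolutelyContinuous (P : PMF A) (W : Channel A Z) {a : A} (ha : P a ≠ 0) :
    (W a : Measure Z) ≪ (output P W : Measure Z) := by
  refine Measure.AbsolutelyContinuous.mk fun s hs h => ?_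
  rw [output_apply _ _ hs, ENNReal.tsum_eq_zero] at h
  exact (mul_eq_zero.mp (h a)).resolve_left ha

/-- The joint distribution of an index `i` with distribution `p` and an output of `κ i`. -/
noncomputable def joint {ι : Type*} [MeasurableSpace ι] (p : PMF ι) (κ : Channel ι Z) :
    ProbabilityMeasure (ι × Z) :=
  output p fun i => ProbabilityMeasure.prod ⟨Measure.dirac i, inferInstance⟩ (κ i)

variable {ι : Type*} [MeasurableSpace ι]

theorem coe_joint (p : PMF ι) (κ : Channel ι Z) :
    (joint p κ : Measure (ι × Z)) =
      Measure.sum fun i => p i • (Measure.dirac i).prod (κ i : Measure Z) := rfl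

theorem lintegral_joint (p : PMF ι) (κ : Channel ι Z) {f : ι × Z → ℝ≥0∞} (hf : Measurable f) :
    ∫⁻ x, f x ∂(joint p κ : Measure (ι × Z)) =
      ∑' i, p i * ∫⁻ z, f (i, z) ∂(κ i : Measure Z) := by
  rw [joint, lintegral_output]
  refine tsum_congr fun i => ?_
  congr 1
  change ∫⁻ x, f x ∂((Measure.dirac i).prod (κ i : Measure Z)) = _
  rw [lintegral_prod _ hf.aemeasurable, lintegral_dirac']
  exact hf.lintegral_prod_right'

theorem joint_apply (p : PMF ι) (κ : Channel ι Z) {s : Set (ι × Z)} (hs : MeasurableSet s) :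
    (joint p κ : Measure (ι × Z)) s =
      ∑' i, p i * (κ i : Measure Z) (Prod.mk i ⁻¹' s) := by
  rw [← lintegral_indicator_one hs, lintegral_joint _ _ (measurable_one.indicator hs)]
  refine tsum_congr fun i => ?_
  congr 1
  rw [← lintegral_indicator_one (measurable_prodMk_left hs)]
  rfl

theorem map_snd_joint (p : PMF ι) (κ : Channel ι Z) :
    (joint p κ : Measure (ι × Z)).map Prod.snd = output p κ := by
  refine Measure.ext fun s hs => ?_
  rw [Measure.map_apply measurable_snd hs, joint_apply _ _ (measurable_snd hs),
    output_apply _ _ hs]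
  rfl

theorem joint_absolutelyContinuous (p : PMF ι) {κ η : Channel ι Z}
    (h : ∀ i, p i ≠ 0 → (κ i : Measure Z) ≪ (η i : Measure Z)) :
    (joint p κ : Measure (ι × Z)) ≪ (joint p η : Measure (ι × Z)) := by
  refine Measure.AbsolutelyContinuous.mk fun s hs hz => ?_
  rw [joint_apply _ _ hs, ENNReal.tsum_eq_zero] at hz ⊢
  intro i
  by_cases hi : p i = 0
  · simp [hi]
  · rw [h i hi ((mul_eq_zero.mp (hz i)).resolve_left hi), mul_zero]

variable [DiscreteMeasurableSpace ι]

theorem toMeasure_prod_eq_joint [Countable ι] (p : PMF ι) (R : ProbabilityMeasure Z) :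
    p.toMeasure.prod (R : Measure Z) = joint p fun _ => R := by
  refine Measure.ext fun s hs => ?_
  rw [joint_apply _ _ hs, Measure.prod_apply hs, lintegral_countable']
  refine tsum_congr fun i => ?_
  rw [PMF.toMeasure_apply_singleton _ _ (measurableSet_singleton i), mul_comm]

end Mixtures

/-! ### Kullback-Leibler divergence of mixtures and products -/

section Divergence

variable {Z Z' ι : Type*} [MeasurableSpace Z] [MeasurableSpace Z']

/-- The divergence of two joint distributions with the same first marginal. -/
theorem klDiv_joint [Countable ι] [MeasurableSpace ι] [DiscreteMeasurableSpace ι] (p : PMF ι)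
    {κ η : Channel ι Z} (h : ∀ i, p i ≠ 0 → (κ i : Measure Z) ≪ (η i : Measure Z)) :
    klDiv (joint p κ : Measure (ι × Z)) (joint p η : Measure (ι × Z)) =
      ∑' i, p i * klDiv (κ i : Measure Z) (η i : Measure Z) := by
  -- The densities of the individual components form one measurable density because the index set is
  -- countable. Absolute continuity may fail at indices of mass zero, which do not contribute.
  set f : ι × Z → ℝ≥0∞ := fun x => (κ x.1 : Measure Z).rnDeriv (η x.1 : Measure Z) x.2 with hf
  have hfm : Measurable f :=
    measurable_from_prod_countable_right fun i =>
      Measure.measurable_rnDeriv (κ i : Measure Z) (η i : Measure Z)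
  have hd : (joint p κ : Measure (ι × Z)) = (joint p η : Measure (ι × Z)).withDensity f := by
    refine Measure.ext fun s hs => ?_
    rw [withDensity_apply _ hs, ← lintegral_indicator hs,
      lintegral_joint _ _ (hfm.indicator hs), joint_apply _ _ hs]
    refine tsum_congr fun i => ?_
    by_cases hi : p i = 0
    · simp [hi]
    congr 1
    conv_lhs => rw [← Measure.withDensity_rnDeriv_eq _ _ (h i hi)]
    rw [withDensity_apply _ (measurable_prodMk_left hs),
      ← lintegral_indicator (measurable_prodMk_left hs)]
    rfl
  have hae : (joint p κ : Measure (ι × Z)).rnDeriv (joint p η : Measure (ι × Z))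
      =ᵐ[(joint p η : Measure (ι × Z))] f := by
    rw [hd]
    exact Measure.rnDeriv_withDensity _ hfm
  rw [klDiv_eq_lintegral_klFun_of_ac (joint_absolutelyContinuous p h)]
  have : ∫⁻ x, ENNReal.ofReal (klFun
      ((joint p κ : Measure (ι × Z)).rnDeriv (joint p η : Measure (ι × Z)) x).toReal)
        ∂(joint p η : Measure (ι × Z)) =
      ∫⁻ x, ENNReal.ofReal (klFun (f x).toReal) ∂(joint p η : Measure (ι × Z)) := by
    refine lintegral_congr_ae ?_
    filter_upwards [hae] with x hx
    rw [hx]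
  rw [this, lintegral_joint _ _ (by fun_prop)]
  refine tsum_congr fun i => ?_
  by_cases hi : p i = 0
  · simp [hi]
  rw [klDiv_eq_lintegral_klFun_of_ac (h i hi)]

/-- Without absolute continuity at some index of positive mass, the right-hand side is infinite. -/
theorem klDiv_joint_le [Countable ι] [MeasurableSpace ι] [DiscreteMeasurableSpace ι] (p : PMF ι)
    (κ η : Channel ι Z) :
    klDiv (joint p κ : Measure (ι × Z)) (joint p η : Measure (ι × Z)) ≤
      ∑' i, p i * klDiv (κ i : Measure Z) (η i : Measure Z) := by
  by_cases h : ∀ i, p i ≠ 0 → (κ i : Measure Z) ≪ (η i : Measure Z)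
  · exact (klDiv_joint p h).le
  · push Not at h
    obtain ⟨i, hi, hn⟩ := h
    refine le_top.trans (le_trans ?_ (ENNReal.le_tsum i))
    rw [klDiv_of_not_ac hn, ENNReal.mul_top hi]

/-- Joint convexity of the Kullback-Leibler divergence. -/
theorem klDiv_output_le [Countable ι] (p : PMF ι) (κ η : Channel ι Z) :
    klDiv (output p κ : Measure Z) (output p η : Measure Z) ≤
      ∑' i, p i * klDiv (κ i : Measure Z) (η i : Measure Z) := by
  -- The divergence of mixtures becomes computable after adjoining the index; forgetting the index
  -- again is data processing.
  let _ : MeasurableSpace ι := ⊤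
  rw [← map_snd_joint, ← map_snd_joint]
  exact (klDiv_map_le _ _ measurable_snd).trans (klDiv_joint_le p κ η)

/-- Among all reference output distributions, the true output distribution minimizes the divergence
of the joint distribution from the product distribution. -/
theorem klDiv_joint_output_le [Countable ι] [MeasurableSpace ι] [DiscreteMeasurableSpace ι]
    (p : PMF ι) (κ : Channel ι Z) (R : ProbabilityMeasure Z) :
    klDiv (joint p κ : Measure (ι × Z)) (p.toMeasure.prod (output p κ : Measure Z)) ≤
      klDiv (joint p κ : Measure (ι × Z)) (p.toMeasure.prod (R : Measure Z)) := by
  have : Nonempty ι := p.support_nonempty.to_subtype.map Subtype.val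
  -- The chain rule splits off the first coordinate, so the output is moved there. Disintegrating
  -- over the output gives D(J ‖ R × p) = D(pκ ‖ R) + D(J ‖ pκ × p), where pκ is the output
  -- distribution, and the first summand is dropped.
  set J : Measure (Z × ι) := (joint p κ : Measure (ι × Z)).map Prod.swap with hJ
  have : IsProbabilityMeasure J := Measure.isProbabilityMeasure_map (by fun_prop)
  have hfst : J.fst = output p κ := by
    rw [hJ, Measure.fst, Measure.map_map measurable_fst measurable_swap, ← map_snd_joint]
    rfl
  have hdis : (output p κ : Measure Z) ⊗ₘ J.condKernel = J := by
    rw [← hfst]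
    exact J.disintegrate J.condKernel
  have key : ∀ R : ProbabilityMeasure Z,
      klDiv (joint p κ : Measure (ι × Z)) (p.toMeasure.prod (R : Measure Z)) =
        klDiv J ((R : Measure Z) ⊗ₘ Kernel.const Z p.toMeasure) := by
    intro R
    rw [Measure.compProd_const]
    refine le_antisymm ?_ ?_
    · have h := klDiv_map_le J ((R : Measure Z).prod p.toMeasure) measurable_swap
      rw [Measure.prod_swap, hJ, Measure.map_map measurable_swap measurable_swap] at h
      simpa [Prod.swap_swap_eq] using h
    · have h := klDiv_map_le (joint p κ : Measure (ι × Z)) (p.toMeasure.prod (R : Measure Z))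
        measurable_swap
      rwa [Measure.prod_swap] at h
  rw [key, key, ← hdis, klDiv_compProd_eq_add _ (R : Measure Z)]
  exact le_add_self

/-- The chain rule gives a second summand with the common first factor `μ`. After a swap, both
measures arise by applying the same constant kernel, which leaves the divergence unchanged; the swap
itself is invertible, so data processing is used in both directions. -/
theorem klDiv_prod (μ ν : Measure Z) (μ' ν' : Measure Z') [IsProbabilityMeasure μ]
    [IsProbabilityMeasure ν] [IsProbabilityMeasure μ'] [IsProbabilityMeasure ν'] :
    klDiv (μ.prod μ') (ν.prod ν') = klDiv μ ν + klDiv μ' ν' := by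
  rw [← Measure.compProd_const, ← Measure.compProd_const, klDiv_compProd_eq_add]
  congr 1
  rw [Measure.compProd_const, Measure.compProd_const]
  have key : ∀ a b : Measure Z', [IsProbabilityMeasure a] → [IsProbabilityMeasure b] →
      klDiv (μ.prod a) (μ.prod b) ≤ klDiv (a.prod μ) (b.prod μ) ∧
      klDiv (a.prod μ) (b.prod μ) ≤ klDiv (μ.prod a) (μ.prod b) := by
    intro a b _ _
    constructor
    · simpa [Measure.prod_swap] using klDiv_map_le (a.prod μ) (b.prod μ) measurable_swap
    · simpa [Measure.prod_swap] using klDiv_map_le (μ.prod a) (μ.prod b) measurable_swap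
  rw [le_antisymm (key μ' ν').1 (key μ' ν').2, ← Measure.compProd_const, ← Measure.compProd_const,
    klDiv_compProd_left]

theorem klDiv_pi_le {k : ℕ} (μ ν : Fin k → Measure Z) [∀ j, IsProbabilityMeasure (μ j)]
    [∀ j, IsProbabilityMeasure (ν j)] :
    klDiv (Measure.pi μ) (Measure.pi ν) ≤ ∑ j, klDiv (μ j) (ν j) := by
  induction k with
  | zero =>
    have : Measure.pi μ = Measure.pi ν := by
      rw [Measure.pi_of_empty, Measure.pi_of_empty]
    simp [this]
  | succ k ih =>
    rw [Fin.sum_univ_succ]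
    have h1 := (measurePreserving_piFinSuccAbove μ 0).symm
    have h2 := (measurePreserving_piFinSuccAbove ν 0).symm
    rw [← h1.map_eq, ← h2.map_eq]
    refine (klDiv_map_le _ _ (MeasurableEquiv.measurable _)).trans ?_
    rw [klDiv_prod]
    gcongr
    exact ih (fun j => μ j.succ) (fun j => ν j.succ)

/-- If `ν'` is bounded by `c ν`, then replacing `ν'` by `ν` increases the divergence by at most
`log c`. -/
theorem klDiv_le_add_log (μ ν ν' : Measure Z) [IsProbabilityMeasure μ] [IsProbabilityMeasure ν]
    [IsProbabilityMeasure ν'] {c : ℝ} (hc : 1 ≤ c) (h : ν' ≤ ENNReal.ofReal c • ν) :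
    klDiv μ ν ≤ klDiv μ ν' + ENNReal.ofReal (Real.log c) := by
  by_cases hμ : μ ≪ ν'
  swap
  · simp [klDiv_of_not_ac hμ]
  have hν : ν' ≪ ν := (Measure.absolutelyContinuous_of_le h).trans
    (Measure.smul_absolutelyContinuous)
  rw [klDiv_eq_lintegral_klFun_of_ac hμ, klDiv_eq_lintegral_klFun_of_ac (hμ.trans hν)]
  set f := ν'.rnDeriv ν
  set g := μ.rnDeriv ν'
  have hfm : Measurable f := Measure.measurable_rnDeriv _ _
  have hgm : Measurable g := Measure.measurable_rnDeriv _ _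
  have hfg : μ.rnDeriv ν =ᵐ[ν] fun x => g x * f x := (Measure.rnDeriv_mul_rnDeriv hμ).symm
  have hfc : ∀ᵐ x ∂ν, f x ≤ ENNReal.ofReal c := by
    refine ae_le_of_forall_setLIntegral_le_of_sigmaFinite hfm fun s hs _ => ?_
    rw [Measure.setLIntegral_rnDeriv hν, setLIntegral_const]
    exact h s
  have hgf : ∀ᵐ x ∂ν, f x ≠ 0 → g x ≠ ∞ := by
    have h1 : ∀ᵐ x ∂ν', g x < ∞ := Measure.rnDeriv_lt_top _ _
    rw [← Measure.withDensity_rnDeriv_eq _ _ hν, ae_withDensity_iff hfm] at h1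
    filter_upwards [h1] with x hx h0 using (hx h0).ne
  have hν' : ∫⁻ x, ENNReal.ofReal (klFun (g x).toReal) ∂ν' =
      ∫⁻ x, f x * ENNReal.ofReal (klFun (g x).toReal) ∂ν := by
    conv_lhs => rw [← Measure.withDensity_rnDeriv_eq _ _ hν]
    rw [lintegral_withDensity_eq_lintegral_mul _ hfm (by fun_prop)]
    rfl
  -- With ν' = fν and μ = gν', direct computation gives klFun(gf) + f = f klFun(g) + gf log f + 1,
  -- and log f ≤ log c. Arranging the terms as sums of nonnegative functions lets the inequality be
  -- integrated without subtraction; the integrals of f and of 1 agree and cancel.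
  have hpt : ∀ᵐ x ∂ν, ENNReal.ofReal (klFun (μ.rnDeriv ν x).toReal) + f x ≤
      f x * ENNReal.ofReal (klFun (g x).toReal) + (ENNReal.ofReal (Real.log c) * (μ.rnDeriv ν x)
        + 1) := by
    filter_upwards [hfg, hfc, hgf] with x h1 h2 h3
    rw [h1]
    have hft : f x ≠ ∞ := (h2.trans_lt ENNReal.ofReal_lt_top).ne
    by_cases h0 : f x = 0
    · simp [h0, klFun_zero]
    have hgt := h3 h0
    have hf0 : 0 < (f x).toReal := ENNReal.toReal_pos h0 hft
    have hfc' : (f x).toReal ≤ c := ENNReal.toReal_le_of_le_ofReal (by linarith) h2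
    rw [← ENNReal.ofReal_toReal hft, ← ENNReal.ofReal_toReal hgt]
    generalize (f x).toReal = a at *
    have hb : 0 ≤ (g x).toReal := ENNReal.toReal_nonneg
    generalize (g x).toReal = b at *
    have hlog : 0 ≤ Real.log c := Real.log_nonneg hc
    rw [← ENNReal.ofReal_mul hb, ENNReal.toReal_ofReal (mul_nonneg hb hf0.le),
      ENNReal.toReal_ofReal hb, ← ENNReal.ofReal_add (klFun_nonneg (by positivity)) hf0.le,
      ← ENNReal.ofReal_mul hf0.le, ← ENNReal.ofReal_mul hlog, ← ENNReal.ofReal_one,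
      ← ENNReal.ofReal_add (by positivity) zero_le_one,
      ← ENNReal.ofReal_add (mul_nonneg hf0.le (klFun_nonneg hb)) (by positivity)]
    refine ENNReal.ofReal_le_ofReal ?_
    rw [klFun, klFun]
    rcases hb.eq_or_lt with rfl | hb
    · simp
      linarith
    · rw [Real.log_mul hb.ne' hf0.ne']
      have := mul_le_mul_of_nonneg_left (Real.log_le_log hf0 hfc') (mul_pos hb hf0).le
      nlinarith
  have hint := lintegral_mono_ae hpt
  rw [lintegral_add_right _ hfm, lintegral_add_left (by fun_prop), lintegral_add_right _ (by fun_prop),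
    lintegral_const_mul _ (Measure.measurable_rnDeriv _ _), Measure.lintegral_rnDeriv hν,
    Measure.lintegral_rnDeriv (hμ.trans hν), measure_univ, measure_univ, mul_one, ← hν',
    lintegral_one, measure_univ, ← add_assoc] at hint
  exact (ENNReal.add_le_add_iff_right ENNReal.one_ne_top).mp hint

end Divergence

/-! ### Mutual information -/

section MutualInfo

variable {Z X : Type*} [MeasurableSpace Z]

theorem ofReal_log_two_ne_zero : ENNReal.ofReal (Real.log 2) ≠ 0 := by
  simp [Real.log_pos]

theorem mutualInfo_mul_log [Countable X] (P : PMF X) (W : Channel X Z) :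
    mutualInfo P W * ENNReal.ofReal (Real.log 2) =
      ∑' x, P x * klDiv (W x : Measure Z) (output P W : Measure Z) := by
  let _ : MeasurableSpace X := ⊤
  rw [mutualInfo, ENNReal.div_mul_cancel ofReal_log_two_ne_zero ENNReal.ofReal_ne_top,
    toMeasure_prod_eq_joint, ← klDiv_joint P fun x hx => output_absolutelyContinuous P W hx,
    coe_joint P W]

theorem mutualInfo_mul_log_le_joint [Countable X] [MeasurableSpace X] [DiscreteMeasurableSpace X]
    (P : PMF X) (W : Channel X Z) (R : ProbabilityMeasure Z) :
    mutualInfo P W * ENNReal.ofReal (Real.log 2) ≤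
      klDiv (joint P W : Measure (X × Z)) (joint P (fun _ => R) : Measure (X × Z)) := by
  rw [mutualInfo_mul_log, ← klDiv_joint P fun x hx => output_absolutelyContinuous P W hx,
    ← toMeasure_prod_eq_joint, ← toMeasure_prod_eq_joint]
  exact klDiv_joint_output_le P W R

theorem mutualInfo_mul_log_le [Countable X] (P : PMF X) (W : Channel X Z)
    (R : ProbabilityMeasure Z) :
    mutualInfo P W * ENNReal.ofReal (Real.log 2) ≤
      ∑' x, P x * klDiv (W x : Measure Z) (R : Measure Z) := by
  let _ : MeasurableSpace X := ⊤
  exact (mutualInfo_mul_log_le_joint P W R).trans (klDiv_joint_le _ _ _)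

end MutualInfo

end Wiretap

namespace Wiretap

open InformationTheory Set

/-! ### Blocks of product channels -/

section Blocks

variable {A Z : Type*} [MeasurableSpace Z]

theorem tsum_prodPMF_mul_prod {k : ℕ} (p : Fin k → PMF A) (F : Fin k → A → ℝ≥0∞) :
    ∑' b, prodPMF p b * ∏ j, F j (b j) = ∏ j, ∑' a, p j a * F j a := by
  induction k with
  | zero =>
    rw [prodPMF, tsum_pure_mul]
    simp
  | succ k ih =>
    rw [prodPMF, tsum_bind_mul, Fin.prod_univ_succ, ← ENNReal.tsum_mul_right]
    refine tsum_congr fun a => ?_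
    rw [tsum_map_mul, mul_assoc]
    congr 1
    rw [← ih (fun i => p i.succ) (fun i => F i.succ), ← ENNReal.tsum_mul_left]
    refine tsum_congr fun b => ?_
    rw [Fin.prod_univ_succ]
    simp only [Fin.cons_zero, Fin.cons_succ]
    ring

theorem output_map {B : Type*} (p : PMF A) (g : A → B) (W : Channel B Z) :
    output (p.map g) W = output p fun a => W (g a) := by
  refine Subtype.ext (Measure.ext fun s hs => ?_)
  change (output (p.map g) W : Measure Z) s = (output p (fun a => W (g a)) : Measure Z) s
  rw [output_apply _ _ hs, output_apply _ _ hs, tsum_map_mul]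

theorem output_prodPMF {k : ℕ} (p : Fin k → PMF A) (κ : Fin k → Channel A Z) :
    (output (prodPMF p) (fun b => ProbabilityMeasure.pi fun j => κ j (b j)) :
      Measure (Fin k → Z)) = Measure.pi fun j => (output (p j) (κ j) : Measure Z) := by
  symm
  refine Measure.pi_eq fun s hs => ?_
  rw [output_apply _ _ (MeasurableSet.univ_pi hs)]
  simp_rw [output_apply _ _ (hs _)]
  rw [← tsum_prodPMF_mul_prod]
  refine tsum_congr fun b => ?_
  rw [ProbabilityMeasure.toMeasure_pi, Measure.pi_pi]

theorem measurable_joinBlocks {k n : ℕ} :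
    Measurable (joinBlocks : (Fin k → Fin n → Z) → Fin (k * n) → Z) :=
  measurable_pi_lambda _ fun _ => (measurable_pi_apply _).comp (measurable_pi_apply _)

theorem block_joinBlocks {k n : ℕ} (b : Fin k → Fin n → A) (j : Fin k) :
    block j (joinBlocks b) = b j := by
  funext i
  simp [block, joinBlocks]

theorem pow_joinBlocks (W : Channel A Z) {k n : ℕ} (b : Fin k → Fin n → A) :
    (W.pow (k * n) (joinBlocks b) : Measure (Fin (k * n) → Z)) =
      (Measure.pi fun j => (W.pow n (b j) : Measure (Fin n → Z))).map joinBlocks := by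
  refine Measure.pi_eq fun s hs => ?_
  rw [Measure.map_apply measurable_joinBlocks (MeasurableSet.univ_pi hs)]
  have : joinBlocks ⁻¹' (univ.pi s) =
      univ.pi fun j : Fin k => univ.pi fun i : Fin n => s (finProdFinEquiv (j, i)) := by
    ext c
    simp only [mem_preimage, mem_univ_pi]
    constructor
    · intro h j i
      have := h (finProdFinEquiv (j, i))
      simpa [joinBlocks] using this
    · intro h i
      have := h (finProdFinEquiv.symm i).1 (finProdFinEquiv.symm i).2
      rwa [Prod.mk.eta, Equiv.apply_symm_apply] at this
  rw [this, Measure.pi_pi, ← finProdFinEquiv.prod_comp, Fintype.prod_prod_type]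
  refine Finset.prod_congr rfl fun j _ => ?_
  rw [Channel.pow, ProbabilityMeasure.toMeasure_pi, Measure.pi_pi]
  simp [joinBlocks]

theorem output_joinBlocks (W : Channel A Z) {k n : ℕ} (p : Fin k → PMF (Fin n → A)) :
    (output ((prodPMF p).map joinBlocks) (W.pow (k * n)) : Measure (Fin (k * n) → Z)) =
      (Measure.pi fun j => (output (p j) (W.pow n) : Measure (Fin n → Z))).map joinBlocks := by
  rw [output_map, ← output_prodPMF p fun _ => W.pow n, map_output _ _ measurable_joinBlocks]
  congr 2
  funext b
  exact Subtype.ext (pow_joinBlocks W b)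

end Blocks

/-! ### Leakage of seeded codes -/

section Leakage

variable {S M A Y Z : Type*} [MeasurableSpace Y] [MeasurableSpace Z]

/-- By joint convexity, since a common Dirac component adds nothing to the divergence. -/
theorem klDiv_prod_dirac_output_le [Countable S] (p : PMF S) (V R : Channel S Z) [MeasurableSpace S] :
    klDiv (output p (fun s => (V s).prod (diracProba s)) : Measure (Z × S))
      (output p (fun s => (R s).prod (diracProba s)) : Measure (Z × S)) ≤
      ∑' s, p s * klDiv (V s : Measure Z) (R s : Measure Z) := by
  refine (klDiv_output_le p _ _).trans (ENNReal.tsum_le_tsum fun s => ?_)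
  gcongr
  refine (klDiv_prod (V s : Measure Z) (R s : Measure Z) (Measure.dirac s)
    (Measure.dirac s)).trans_le ?_
  rw [klDiv_self, add_zero]

theorem output_prod_dirac (p : PMF S) (V : Channel S Z) [MeasurableSpace S]
    [DiscreteMeasurableSpace S] :
    (output p (fun s => (V s).prod (diracProba s)) : Measure (Z × S)).map Prod.swap = joint p V := by
  rw [map_output _ _ measurable_swap, joint]
  congr 2
  funext s
  refine Subtype.ext ?_
  exact Measure.prod_swap

/-- The divergences given the seed, averaged over seeds and messages, are bounded by the leakage. -/
theorem SeededCode.tsum_klDiv_le_leak [Fintype S] [Nonempty S] [Countable M] (C : SeededCode S M A Y) (U : Channel A Z)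
    (P : PMF M) :
    ∑' m, P m * ∑' s, PMF.uniformOfFintype S s * klDiv (output (C.enc s m) U : Measure Z)
        (output P (fun m => output (C.enc s m) U) : Measure Z) ≤
      C.leak U * ENNReal.ofReal (Real.log 2) := by
  let _ : MeasurableSpace S := ⊤
  have h1 : mutualInfo P (fun m => output (PMF.uniformOfFintype S) fun s =>
      (output (C.enc s m) U).prod (diracProba s)) ≤
      C.leak U := by
    exact le_iSup (fun P : PMF M => mutualInfo P (fun m => output (PMF.uniformOfFintype S) fun s =>
      (output (C.enc s m) U).prod (diracProba s))) P
  refine le_trans ?_ (mul_le_mul_left h1 _)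
  rw [mutualInfo_mul_log]
  refine ENNReal.tsum_le_tsum fun m => ?_
  by_cases hm : P m = 0
  · simp [hm]
  gcongr
  rw [← klDiv_joint (PMF.uniformOfFintype S) (κ := fun s => output (C.enc s m) U)
    (η := fun s => output P fun m => output (C.enc s m) U) fun s _ =>
      output_absolutelyContinuous P (fun m => output (C.enc s m) U) hm]
  -- Message and seed are independent, so averaging the law of (Z, S) over the message keeps the
  -- uniform seed and averages the output for each seed separately.
  have hR : (output P (fun m => output (PMF.uniformOfFintype S) fun s =>
      (output (C.enc s m) U).prod (diracProba s)) :
        Measure (Z × S)) = output (PMF.uniformOfFintype S) (fun s =>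
      (output P fun m => output (C.enc s m) U).prod
        (diracProba s)) := by
    refine Measure.ext fun s hs => ?_
    rw [output_apply _ _ hs, output_apply _ _ hs]
    simp_rw [output_apply _ _ hs, ← ENNReal.tsum_mul_left]
    rw [ENNReal.tsum_comm]
    refine tsum_congr fun x => ?_
    have hd : ∀ R : ProbabilityMeasure Z, ((R.prod (diracProba x) : ProbabilityMeasure (Z × S)) :
        Measure (Z × S)) s = (R : Measure Z) ((fun z => (z, x)) ⁻¹' s) := fun R => by
      change ((R : Measure Z).prod (Measure.dirac x)) s = _
      rw [Measure.prod_dirac, Measure.map_apply (by fun_prop) hs]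
    simp_rw [hd]
    rw [output_apply _ _ (measurable_prodMk_right hs), ← ENNReal.tsum_mul_left]
    refine tsum_congr fun m => ?_
    ring
  rw [hR, ← output_prod_dirac, ← output_prod_dirac]
  exact klDiv_map_le _ _ measurable_swap

/-- This is how every leakage is bounded from above: the reference output law is free, and may
depend on the seed and on the message distribution. -/
theorem SeededCode.leak_mul_log_le [Fintype S] [Nonempty S] [Countable M] (C : SeededCode S M A Y) (U : Channel A Z)
    (b : ℝ≥0∞) (R : PMF M → S → ProbabilityMeasure Z)
    (h : ∀ P : PMF M, ∑' m, P m * ∑' s, PMF.uniformOfFintype S s *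
      klDiv (output (C.enc s m) U : Measure Z) (R P s : Measure Z) ≤ b) :
    C.leak U * ENNReal.ofReal (Real.log 2) ≤ b := by
  let _ : MeasurableSpace S := ⊤
  rw [SeededCode.leak, ENNReal.iSup_mul]
  refine iSup_le fun P => ?_
  refine (mutualInfo_mul_log_le P _ (output (PMF.uniformOfFintype S) fun s =>
    (R P s).prod (diracProba s))).trans ?_
  refine le_trans (ENNReal.tsum_le_tsum fun m => ?_) (h P)
  gcongr
  exact klDiv_prod_dirac_output_le _ _ _

end Leakage

/-! ### Seed reuse -/

section SeedReuse

variable {A Y Z S X K : Type*} [MeasurableSpace Y] [MeasurableSpace Z] [Fintype S] [Nonempty S]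
  [Fintype X] {n : ℕ}

theorem rate_fun (M : Type*) [Fintype M] (N : ℕ) :
    rate (Fin N → M) ((N + 1) * n) = (N : ℝ) / ((N : ℝ) + 1) * rate M n := by
  simp only [rate, Fintype.card_fun, Fintype.card_fin, Nat.cast_pow, Real.logb_pow, Nat.cast_mul,
    Nat.cast_add, Nat.cast_one]
  rw [mul_div_mul_comm]

/-- If block 0 is decoded correctly then the decoded seed is the true one, because `τ` inverts `σ`;
the remaining blocks then fail only if the modular scheme with the right seed fails. Given the seed
the blocks are independent, but the union bound needs only their marginals. -/
theorem seedReuse_err_le (T : Channel A Y) (N : ℕ) (f : BRI S X K)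
    (C : ErrCode X (Fin n → A) (Fin n → Y)) (σ : S → X) (τ : X → S)
    (hτ : Function.LeftInverse τ σ) :
    (seedReuse f C σ τ N).err (T.pow ((N + 1) * n)) ≤
      C.err (T.pow n) + (N : ℝ≥0∞) * (modular f C).err (T.pow n) := by
  refine iSup_le fun _ => iSup_le fun m => ?_
  have hE : MeasurableSet {y | (seedReuse f C σ τ N).dec () y ≠ some m} :=
    ((seedReuse f C σ τ N).measurable_dec () m).compl
  change (output ((PMF.uniformOfFintype S).bind fun s =>
    (prodPMF (Fin.cons (C.enc (σ s)) fun j => (modular f C).enc s (m j) :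
      Fin (N + 1) → PMF (Fin n → A))).map joinBlocks) (T.pow ((N + 1) * n)) : Measure _)
      {y | (seedReuse f C σ τ N).dec () y ≠ some m} ≤ _
  rw [output_bind, output_apply _ _ hE]
  set b := C.err (T.pow n) + (N : ℝ≥0∞) * (modular f C).err (T.pow n) with hb
  calc _ ≤ ∑' s : S, PMF.uniformOfFintype S s * b := ?_
    _ = b := by rw [ENNReal.tsum_mul_right, PMF.tsum_coe, one_mul]
  refine ENNReal.tsum_le_tsum fun s => ?_
  gcongr
  rw [output_joinBlocks, Measure.map_apply measurable_joinBlocks hE]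
  set p : Fin (N + 1) → PMF (Fin n → A) :=
    Fin.cons (C.enc (σ s)) fun j => (modular f C).enc s (m j) with hp
  set π : Measure (Fin (N + 1) → Fin n → Y) :=
    Measure.pi fun j => (output (p j) (T.pow n) : Measure (Fin n → Y)) with hπ
  have hmarg : ∀ j {B : Set (Fin n → Y)}, MeasurableSet B →
      π (Function.eval j ⁻¹' B) = (output (p j) (T.pow n) : Measure (Fin n → Y)) B := by
    intro j B hB
    exact (measurePreserving_eval (fun j => (output (p j) (T.pow n) : Measure (Fin n → Y)))
      j).measure_preimage hB.nullMeasurableSet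
  have hsub : joinBlocks ⁻¹' {y | (seedReuse f C σ τ N).dec () y ≠ some m} ⊆
      Function.eval 0 ⁻¹' {y | C.dec y ≠ σ s} ∪
        ⋃ j : Fin N, Function.eval j.succ ⁻¹' {y | (modular f C).dec s y ≠ some (m j)} := by
    intro c hc
    by_contra hn
    simp only [mem_union, mem_preimage, mem_iUnion, mem_ofPred_eq, not_or, not_exists, not_not,
      Function.eval] at hn
    refine hc ?_
    change collect _ = _
    rw [collect_eq_some]
    intro j
    simp only [block_joinBlocks]
    rw [hn.1, hτ s, hn.2 j]
  refine (measure_mono hsub).trans ((measure_union_le _ _).trans (add_le_add ?_ ?_))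
  · rw [hmarg 0 (B := {y | C.dec y ≠ σ s}) (C.measurable_dec _).compl]
    exact le_iSup (fun x => (output (C.enc x) (T.pow n) : Measure (Fin n → Y)) {y | C.dec y ≠ x})
      (σ s)
  · refine (measure_iUnion_fintype_le _ _).trans ?_
    refine (Finset.sum_le_card_nsmul _ _ ((modular f C).err (T.pow n)) fun j _ => ?_).trans ?_
    · rw [hmarg j.succ (B := {y | (modular f C).dec s y ≠ some (m j)})
        ((modular f C).measurable_dec s (m j)).compl]
      exact le_iSup₂ (f := fun s m => (output ((modular f C).enc s m) (T.pow n) :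
        Measure (Fin n → Y)) {y | (modular f C).dec s y ≠ some m}) s (m j)
    · simp

theorem seedReuse_leak_le (U : Channel A Z) (N : ℕ) (f : BRI S X K)
    (C : ErrCode X (Fin n → A) (Fin n → Y)) (σ : S → X) (τ : X → S) :
    (seedReuse f C σ τ N).leak (U.pow ((N + 1) * n)) ≤
      (N : ℝ≥0∞) * (modular f C).leak (U.pow n) := by
  let V : S → f.Msg → ProbabilityMeasure (Fin n → Z) := fun s m =>
    output ((modular f C).enc s m) (U.pow n)
  let V₀ : S → ProbabilityMeasure (Fin n → Z) := fun s => output (C.enc (σ s)) (U.pow n)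
  -- The reference keeps the dependence on the seed, including the true law of block 0, and replaces
  -- only the messages by independent ones with the same marginals.
  let R : PMF (Fin N → f.Msg) → S → ProbabilityMeasure (Fin (N + 1) → Fin n → Z) := fun P s =>
    ProbabilityMeasure.pi (Fin.cons (V₀ s) fun j => output (P.map fun m => m j) (V s))
  suffices h : (seedReuse f C σ τ N).leak (U.pow ((N + 1) * n)) * ENNReal.ofReal (Real.log 2) ≤
      (N : ℝ≥0∞) * (modular f C).leak (U.pow n) * ENNReal.ofReal (Real.log 2) from
    (ENNReal.mul_le_mul_iff_left ofReal_log_two_ne_zero ENNReal.ofReal_ne_top).mp h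
  refine SeededCode.leak_mul_log_le _ _ _
    (fun P _ => output (PMF.uniformOfFintype S) fun s =>
      (R P s).map measurable_joinBlocks.aemeasurable) fun P => ?_
  have hterm : ∀ m : Fin N → f.Msg,
      (∑' a : Unit, PMF.uniformOfFintype Unit a *
        klDiv (output ((seedReuse f C σ τ N).enc a m) (U.pow ((N + 1) * n)) :
          Measure (Fin ((N + 1) * n) → Z))
        (output (PMF.uniformOfFintype S) (fun s =>
          (R P s).map measurable_joinBlocks.aemeasurable) : Measure (Fin ((N + 1) * n) → Z))) ≤
      ∑ j : Fin N, ∑' s : S, PMF.uniformOfFintype S s *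
        klDiv (V s (m j) : Measure (Fin n → Z))
          (output (P.map fun m => m j) (V s) : Measure (Fin n → Z)) := by
    intro m
    rw [tsum_fintype, Finset.univ_unique, Finset.sum_singleton]
    have hu : PMF.uniformOfFintype Unit default = 1 := by simp
    rw [hu, one_mul]
    change klDiv (output ((PMF.uniformOfFintype S).bind fun s =>
      (prodPMF (Fin.cons (C.enc (σ s)) fun j => (modular f C).enc s (m j) :
        Fin (N + 1) → PMF (Fin n → A))).map joinBlocks) (U.pow ((N + 1) * n)) :
        Measure (Fin ((N + 1) * n) → Z)) _ ≤ _
    rw [output_bind]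
    refine (klDiv_output_le _ _ _).trans ?_
    rw [← Summable.tsum_finsetSum fun _ _ => ENNReal.summable]
    refine ENNReal.tsum_le_tsum fun s => ?_
    rw [← Finset.mul_sum]
    gcongr
    rw [output_joinBlocks, ProbabilityMeasure.toMeasure_map]
    refine (klDiv_map_le _ _ measurable_joinBlocks).trans ?_
    simp only [R, ProbabilityMeasure.toMeasure_pi]
    refine (klDiv_pi_le _ _).trans ?_
    rw [Fin.sum_univ_succ]
    simp only [Fin.cons_zero, Fin.cons_succ]
    -- Block 0 has the same law in the code and in the reference, so transmitting the seed costs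
    -- nothing; only `N` summands remain.
    rw [klDiv_self, zero_add]
  calc _ ≤ ∑' m, P m * ∑ j : Fin N, ∑' s : S, PMF.uniformOfFintype S s *
        klDiv (V s (m j) : Measure (Fin n → Z))
          (output (P.map fun m => m j) (V s) : Measure (Fin n → Z)) :=
        ENNReal.tsum_le_tsum fun m => mul_le_mul_right (hterm m) _
    _ = ∑ j : Fin N, ∑' m, P.map (fun m => m j) m * ∑' s : S, PMF.uniformOfFintype S s *
        klDiv (V s m : Measure (Fin n → Z))
          (output (P.map fun m => m j) (V s) : Measure (Fin n → Z)) := by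
        simp_rw [tsum_map_mul, Finset.mul_sum]
        rw [Summable.tsum_finsetSum fun _ _ => ENNReal.summable]
    _ ≤ ∑ j : Fin N, (modular f C).leak (U.pow n) * ENNReal.ofReal (Real.log 2) :=
        Finset.sum_le_sum fun j _ =>
          (modular f C).tsum_klDiv_le_leak (U.pow n) (P.map fun m => m j)
    _ = _ := by simp [mul_assoc]

end SeedReuse

end Wiretap

namespace Wiretap

/-! ### The spectral gap of biregular irreducible functions -/

section Spectral

variable {X : Type*} [Fintype X]

open Classical in
theorem abs_eigenvalues_le_secondEigenvalueModulus {A : Matrix X X ℝ} (hA : A.IsHermitian) (i : X)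
    (hi : i ≠ (Fintype.equivOfCardEq (Fintype.card_fin (Fintype.card X)))
      (⟨0, Fintype.card_pos_iff.mpr ⟨i⟩⟩ : Fin (Fintype.card X))) :
    |hA.eigenvalues i| ≤ secondEigenvalueModulus hA := by
  set e : Fin (Fintype.card X) ≃ X := Fintype.equivOfCardEq (Fintype.card_fin _)
  have h0 : 0 < ((e.symm i : Fin (Fintype.card X)) : ℕ) := by
    by_contra h
    apply hi
    rw [← e.apply_symm_apply i]
    congr 1
    exact Fin.ext (by simpa using h)
  exact le_ciSup (f := fun i : {i : Fin (Fintype.card X) // 0 < (i : ℕ)} =>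
    |hA.eigenvalues₀ i.1|) (Set.finite_range _).bddAbove ⟨e.symm i, h0⟩

theorem secondEigenvalueModulus_nonneg {A : Matrix X X ℝ} (hA : A.IsHermitian) :
    0 ≤ secondEigenvalueModulus hA :=
  Real.iSup_nonneg fun _ => abs_nonneg _

/-- The quadratic form of a symmetric stochastic matrix whose second-largest eigenvalue modulus
`λ` is less than `1` is at most `(∑ v)² / |X| + λ ∑ v²`. -/
theorem sum_mul_mul_le_of_stochastic [Nonempty X] {A : Matrix X X ℝ} (hA : A.IsHermitian)
    (hsum : ∀ x, ∑ x', A x x' = 1) (hlt : secondEigenvalueModulus hA < 1) (v : X → ℝ) :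
    ∑ x, ∑ x', A x x' * (v x * v x') ≤
      (∑ x, v x) ^ 2 / Fintype.card X + secondEigenvalueModulus hA * ∑ x, v x ^ 2 := by
  classical
  set l := secondEigenvalueModulus hA with hl
  set b := hA.eigenvectorBasis with hb
  -- This index carries the entry of `eigenvalues₀` that the second-largest modulus leaves out. That
  -- its eigenvalue is 1 is derived below from the row sums.
  set i₀ : X := (Fintype.equivOfCardEq (Fintype.card_fin (Fintype.card X)))
      (⟨0, Fintype.card_pos⟩ : Fin (Fintype.card X)) with hi₀
  have hle : ∀ i, i ≠ i₀ → |hA.eigenvalues i| ≤ l := fun i hi =>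
    abs_eigenvalues_le_secondEigenvalueModulus hA i hi
  have hinner : ∀ u w : EuclideanSpace ℝ X, inner ℝ u w = ∑ x, u x * w x := by
    intro u w
    simp [PiLp.inner_apply, mul_comm]
  have heig : ∀ i x, ∑ x', A x x' * b i x' = hA.eigenvalues i * b i x := by
    intro i x
    have := congrFun (hA.mulVec_eigenvectorBasis i) x
    simpa [Matrix.mulVec, dotProduct] using this
  have hsymm : ∀ x x', A x x' = A x' x := fun x x' => by
    have := hA.apply x' x
    simpa using this
  -- the action of `A` in the eigenbasis
  have hcoef : ∀ (w : EuclideanSpace ℝ X) i,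
      ∑ x, b i x * ∑ x', A x x' * w x' = hA.eigenvalues i * inner ℝ (b i) w := by
    intro w i
    calc ∑ x, b i x * ∑ x', A x x' * w x' = ∑ x', (∑ x, A x' x * b i x) * w x' := by
          simp_rw [Finset.mul_sum, Finset.sum_mul]
          rw [Finset.sum_comm]
          refine Finset.sum_congr rfl fun x' _ => Finset.sum_congr rfl fun x _ => ?_
          rw [hsymm x' x]
          ring
      _ = _ := by
          simp_rw [heig, hinner, Finset.mul_sum, mul_assoc]
  -- The all-ones vector is fixed by `A`, so by symmetry of `A` it is orthogonal to every
  -- eigenvector with eigenvalue different from 1.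
  have hone : ∀ i, i ≠ i₀ → inner ℝ (b i) (WithLp.toLp 2 fun _ : X => (1 : ℝ)) = 0 := by
    intro i hi
    have h := hcoef (WithLp.toLp 2 fun _ : X => (1 : ℝ)) i
    have h2 : ∑ x, b i x * ∑ x', A x x' * (WithLp.toLp 2 fun _ : X => (1 : ℝ)) x' =
        inner ℝ (b i) (WithLp.toLp 2 fun _ : X => (1 : ℝ)) := by
      rw [hinner]
      refine Finset.sum_congr rfl fun x _ => ?_
      simp [hsum]
    rw [h2] at h
    have h3 : hA.eigenvalues i < 1 := (le_abs_self _).trans_lt ((hle i hi).trans_lt hlt)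
    have h4 : (1 - hA.eigenvalues i) *
        inner ℝ (b i) (WithLp.toLp 2 fun _ : X => (1 : ℝ)) = 0 := by linarith
    exact (mul_eq_zero.mp h4).resolve_left (by linarith)
  set w : EuclideanSpace ℝ X := WithLp.toLp 2 v with hw
  set one : EuclideanSpace ℝ X := WithLp.toLp 2 fun _ : X => (1 : ℝ) with hone'
  have hpars : ∀ u u' : EuclideanSpace ℝ X,
      inner ℝ u u' = ∑ i, inner ℝ (b i) u * inner ℝ (b i) u' := by
    intro u u'
    rw [← b.sum_inner_mul_inner u u']
    refine Finset.sum_congr rfl fun i _ => ?_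
    rw [real_inner_comm]
  have hquad : ∑ x, ∑ x', A x x' * (v x * v x') =
      ∑ i, hA.eigenvalues i * inner ℝ (b i) w ^ 2 := by
    have h1 := hpars w (WithLp.toLp 2 fun x => ∑ x', A x x' * v x')
    rw [hinner] at h1
    calc _ = ∑ x, w x * (WithLp.toLp 2 fun x => ∑ x', A x x' * v x') x := by
          refine Finset.sum_congr rfl fun x _ => ?_
          simp only [hw, Finset.mul_sum]
          exact Finset.sum_congr rfl fun x' _ => by ring
      _ = _ := by
          rw [h1]
          refine Finset.sum_congr rfl fun i _ => ?_
          have : inner ℝ (b i) (WithLp.toLp 2 fun x => ∑ x', A x x' * v x') =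
              hA.eigenvalues i * inner ℝ (b i) w := (hinner _ _).trans (hcoef w i)
          rw [this]
          ring
  have hcard : inner ℝ one one = (Fintype.card X : ℝ) := by
    rw [hinner]
    simp [hone']
  have hsingle : ∀ u, inner ℝ one u = inner ℝ (b i₀) one * inner ℝ (b i₀) u := by
    intro u
    rw [hpars, Finset.sum_eq_single i₀]
    · intro i _ hi
      rw [hone i hi, zero_mul]
    · simp
  have hc0 : (0 : ℝ) < Fintype.card X := Nat.cast_pos.mpr Fintype.card_pos
  -- The all-ones vector is nonzero and only its coefficient at `i₀` can be nonzero, so its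
  -- eigenvalue 1 is the one at `i₀`.
  have hi₀1 : hA.eigenvalues i₀ = 1 := by
    have h := hcoef one i₀
    have h2 : ∑ x, b i₀ x * ∑ x', A x x' * one x' = inner ℝ (b i₀) one := by
      rw [hinner]
      refine Finset.sum_congr rfl fun x _ => ?_
      simp [hsum, hone']
    rw [h2] at h
    have h3 : inner ℝ (b i₀) one ≠ 0 := by
      intro h3
      rw [hsingle, h3, zero_mul] at hcard
      exact hc0.ne hcard
    field_simp at h
    exact h.symm
  have hproj : inner ℝ (b i₀) w ^ 2 = (∑ x, v x) ^ 2 / Fintype.card X := by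
    have h1 := hsingle w
    have h2 := hsingle one
    rw [hcard] at h2
    have h3 : inner ℝ one w = ∑ x, v x := by simp [hinner, hone', hw]
    rw [← h3, h1, eq_div_iff hc0.ne', h2]
    ring
  have hnorm : ∑ x, v x ^ 2 = ∑ i, inner ℝ (b i) w ^ 2 := by
    have h1 := hpars w w
    rw [hinner] at h1
    simp only [hw] at h1 ⊢
    simp_rw [sq]
    exact h1
  rw [hquad, ← hproj, hnorm, ← Finset.add_sum_erase _ _ (Finset.mem_univ i₀), hi₀1, one_mul,
    Finset.mul_sum]
  gcongr
  refine (Finset.sum_le_sum fun i hi => ?_).trans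
    (Finset.sum_le_sum_of_subset_of_nonneg (Finset.erase_subset i₀ Finset.univ) fun i _ _ =>
      mul_nonneg (secondEigenvalueModulus_nonneg hA) (sq_nonneg _))
  exact mul_le_mul_of_nonneg_right
    ((le_abs_self _).trans (hle i (Finset.ne_of_mem_erase hi))) (sq_nonneg _)

end Spectral

/-! ### Double counting and second moments over the fibers -/

section BRI

variable {S X K : Type*} [Fintype X]

theorem ncard_setOf_eq_sum {α : Type*} [Fintype α] (p : α → Prop) [DecidablePred p] :
    (Set.ncard {a | p a} : ℝ) = ∑ a, if p a then 1 else 0 := by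
  rw [Finset.sum_boole, Set.ncard_eq_toFinset_card', Set.toFinset_ofPred]

theorem BRI.lambda2_nonneg (f : BRI S X K) (m : K) : 0 ≤ f.lambda2 m :=
  secondEigenvalueModulus_nonneg _

/-- Both sides count the pairs (s,x) with f(s,x) = m. -/
theorem BRI.card_mul_dS [Fintype S] (f : BRI S X K) (m : f.Msg) :
    (Fintype.card S : ℝ) * f.dS = Fintype.card X * f.dX := by
  classical
  have h1 : ∑ s, ∑ x, (if f.toFun s x = m.1 then (1 : ℝ) else 0) = Fintype.card S * f.dS := by
    simp_rw [← ncard_setOf_eq_sum, f.S_regular m.1 m.2]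
    simp
  have h2 : ∑ x, ∑ s, (if f.toFun s x = m.1 then (1 : ℝ) else 0) = Fintype.card X * f.dX := by
    simp_rw [← ncard_setOf_eq_sum, f.X_regular m.1 m.2]
    simp
  rw [← h1, ← h2, Finset.sum_comm]

/-- For fixed x there are dX seeds s with f(s,x) = m, and each of them has dS continuations x'. -/
theorem BRI.sum_stepMatrix [Fintype S] (f : BRI S X K) (m : f.Msg) (x : X) :
    ∑ x', stepMatrix f.toFun f.dS f.dX m.1 x x' = 1 := by
  classical
  have hS : (f.dS : ℝ) ≠ 0 := Nat.cast_ne_zero.mpr f.dS_pos.ne'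
  have hX : (f.dX : ℝ) ≠ 0 := Nat.cast_ne_zero.mpr f.dX_pos.ne'
  simp only [stepMatrix, Matrix.of_apply]
  rw [← Finset.sum_div, div_eq_one_iff_eq (mul_ne_zero hS hX)]
  simp_rw [ncard_setOf_eq_sum, ite_and]
  rw [Finset.sum_comm]
  have : ∀ s, ∑ x', (if f.toFun s x = m.1 then (if f.toFun s x' = m.1 then (1 : ℝ) else 0) else 0) =
      (if f.toFun s x = m.1 then 1 else 0) * f.dS := by
    intro s
    split_ifs
    · rw [← ncard_setOf_eq_sum, f.S_regular m.1 m.2, one_mul]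
    · simp
  simp_rw [this]
  rw [← Finset.sum_mul, ← ncard_setOf_eq_sum, f.X_regular m.1 m.2, mul_comm]

open Classical in
/-- The average of `v` over the fiber `{x : f(s,x) = m}`. -/
noncomputable def BRI.avg (f : BRI S X K) (m : f.Msg) (s : S) (v : X → ℝ) : ℝ :=
  (∑ x, if f.toFun s x = m.1 then v x else 0) / f.dS

/-- Averaging over the seed. -/
theorem BRI.sum_avg [Fintype S] [Nonempty S] (f : BRI S X K) (m : f.Msg) (v : X → ℝ) :
    (∑ s, f.avg m s v) / Fintype.card S = (∑ x, v x) / Fintype.card X := by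
  classical
  have hS : (f.dS : ℝ) ≠ 0 := Nat.cast_ne_zero.mpr f.dS_pos.ne'
  have hX : (f.dX : ℝ) ≠ 0 := Nat.cast_ne_zero.mpr f.dX_pos.ne'
  have hcS : (Fintype.card S : ℝ) ≠ 0 := Nat.cast_ne_zero.mpr Fintype.card_ne_zero
  have hc := f.card_mul_dS m
  have hcX : (Fintype.card X : ℝ) ≠ 0 := by
    intro h
    rw [h, zero_mul] at hc
    exact mul_ne_zero hcS hS hc
  have h1 : ∑ s, ∑ x, (if f.toFun s x = m.1 then v x else 0) = f.dX * ∑ x, v x := by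
    rw [Finset.sum_comm, Finset.mul_sum]
    refine Finset.sum_congr rfl fun x _ => ?_
    rw [← f.X_regular m.1 m.2 x, ncard_setOf_eq_sum, Finset.sum_mul]
    simp
  simp only [avg]
  rw [← Finset.sum_div, h1, div_div, div_eq_div_iff (by positivity) hcX]
  linear_combination (-∑ x, v x) * hc

/-- The second moment of the averages over the fibers. -/
theorem BRI.sum_avg_sq_le [Fintype S] [Nonempty S] (f : BRI S X K) (m : f.Msg) (v : X → ℝ) :
    (∑ s, f.avg m s v ^ 2) / Fintype.card S ≤
      ((∑ x, v x) / Fintype.card X) ^ 2 +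
        f.lambda2 m.1 * ((∑ x, v x ^ 2) / Fintype.card X) := by
  classical
  have hS : (0 : ℝ) < f.dS := Nat.cast_pos.mpr f.dS_pos
  have hX : (0 : ℝ) < f.dX := Nat.cast_pos.mpr f.dX_pos
  have hcS : (0 : ℝ) < Fintype.card S := Nat.cast_pos.mpr Fintype.card_pos
  have hc := f.card_mul_dS m
  have hcX : (0 : ℝ) < Fintype.card X := by
    have : 0 < (Fintype.card X : ℝ) * f.dX := hc ▸ mul_pos hcS hS
    exact pos_of_mul_pos_left this hX.le
  have : Nonempty X := Fintype.card_pos_iff.mp (Nat.cast_pos.mp hcX)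
  have hq := sum_mul_mul_le_of_stochastic (stepMatrix_isHermitian f.toFun f.dS f.dX m.1)
    (f.sum_stepMatrix m) (f.irreducible m.1 m.2) v
  -- Expanding the squares and summing over s counts, for each pair (x,x'), the seeds mapping both
  -- to m. This is the step matrix times dS dX, and the two averages divide by dS².
  have h1 : ∑ s, f.avg m s v ^ 2 =
      f.dX / f.dS * ∑ x, ∑ x', stepMatrix f.toFun f.dS f.dX m.1 x x' * (v x * v x') := by
    simp only [avg, stepMatrix, Matrix.of_apply, ncard_setOf_eq_sum]
    simp_rw [div_pow, sq, Finset.sum_mul_sum, ← Finset.sum_div, div_mul_eq_mul_div, ← Finset.sum_div,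
      Finset.sum_mul]
    rw [Finset.sum_comm]
    have : ∀ x, ∑ s, ∑ x', ((if f.toFun s x = m.1 then v x else 0) *
        if f.toFun s x' = m.1 then v x' else 0) =
        ∑ x', ∑ s, (if f.toFun s x = m.1 ∧ f.toFun s x' = m.1 then (1 : ℝ) else 0) *
          (v x * v x') := by
      intro x
      rw [Finset.sum_comm]
      refine Finset.sum_congr rfl fun x' _ => Finset.sum_congr rfl fun s _ => ?_
      split_ifs <;> simp_all
    simp_rw [this]
    field_simp
  rw [h1]
  have h2 : (f.dX : ℝ) / f.dS / Fintype.card S = 1 / Fintype.card X := by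
    rw [div_div, div_eq_div_iff (by positivity) hcX.ne']
    linear_combination (-1 : ℝ) * hc
  rw [mul_div_right_comm, h2]
  refine (mul_le_mul_of_nonneg_left hq (by positivity)).trans_eq ?_
  rw [BRI.lambda2]
  field_simp

end BRI

end Wiretap

namespace Wiretap

open InformationTheory

/-! ### Privacy amplification -/

section PrivacyAmplification

/-- Near 1 the function `klFun` is quadratic, which suits second moments; the unbounded part t
enters only linearly, with a logarithmic factor. In the application, g is the truncated density and
t the rest. -/
theorem klFun_add_le {g t B : ℝ} (hg : 0 ≤ g) (ht : 0 ≤ t) (hB : g + t ≤ B) (hB1 : 1 ≤ B) :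
    klFun (g + t) ≤ (g - 1) ^ 2 + t * Real.log B := by
  rw [klFun]
  have hlogB := Real.log_nonneg hB1
  rcases (add_nonneg hg ht).eq_or_lt with h0 | hpos
  · rw [← h0]
    have h1 : g = 0 := by linarith
    have h2 : t = 0 := by linarith
    simp [h1, h2]
  have h1 : t * Real.log (g + t) ≤ t * Real.log B :=
    mul_le_mul_of_nonneg_left (Real.log_le_log hpos hB) ht
  -- Write log(g + t) = log g + log(1 + t/g) and bound both logarithms by log u ≤ u - 1.
  have h2 : g * Real.log (g + t) ≤ g * (g - 1) + t := by
    rcases hg.eq_or_lt with rfl | hg'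
    · simpa using ht
    have h3 : Real.log (g + t) = Real.log g + Real.log (1 + t / g) := by
      rw [← Real.log_mul hg'.ne' (by positivity)]
      congr 1
      field_simp
    have h4 := Real.log_le_sub_one_of_pos hg'
    have h5 := Real.log_le_sub_one_of_pos (show 0 < 1 + t / g by positivity)
    have h6 : g * (t / g) = t := by field_simp
    rw [h3]
    nlinarith
  nlinarith

variable {S X K Ω : Type*} [Fintype X] [MeasurableSpace Ω]

theorem BRI.avg_add (f : BRI S X K) (m : f.Msg) (s : S) (v w : X → ℝ) :
    f.avg m s (fun x => v x + w x) = f.avg m s v + f.avg m s w := by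
  classical
  rw [avg, avg, avg, ← add_div, ← Finset.sum_add_distrib]
  congr 1
  refine Finset.sum_congr rfl fun x _ => ?_
  split_ifs <;> simp

theorem BRI.avg_nonneg (f : BRI S X K) (m : f.Msg) (s : S) {v : X → ℝ} (hv : ∀ x, 0 ≤ v x) :
    0 ≤ f.avg m s v := by
  classical
  refine div_nonneg (Finset.sum_nonneg fun x _ => ?_) (Nat.cast_nonneg _)
  split_ifs
  exacts [hv x, le_rfl]

/-- This may lose a factor |X| compared with the mean over all x, which is affordable because the
bound is used only inside a logarithm. -/
theorem BRI.avg_le_sum (f : BRI S X K) (m : f.Msg) (s : S) {v : X → ℝ} (hv : ∀ x, 0 ≤ v x) :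
    f.avg m s v ≤ ∑ x, v x := by
  classical
  have h1 : (1 : ℝ) ≤ f.dS := Nat.one_le_cast.mpr f.dS_pos
  refine (div_le_self (Finset.sum_nonneg fun x _ => ?_) h1).trans
    (Finset.sum_le_sum fun x _ => ?_)
  · split_ifs
    exacts [hv x, le_rfl]
  · split_ifs
    exacts [le_rfl, hv x]

theorem BRI.measurable_avg (f : BRI S X K) (m : f.Msg) (s : S) {v : X → Ω → ℝ}
    (hv : ∀ x, Measurable (v x)) : Measurable fun ω => f.avg m s fun x => v x ω := by
  classical
  refine Measurable.div_const (Finset.measurable_sum _ fun x _ => ?_) _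
  split_ifs
  exacts [hv x, measurable_const]

theorem BRI.card_pos [Fintype S] [Nonempty S] (f : BRI S X K) (m : f.Msg) : (0 : ℝ) < Fintype.card X := by
  have h : 0 < (Fintype.card X : ℝ) * f.dX := by
    rw [← f.card_mul_dS m]
    exact mul_pos (Nat.cast_pos.mpr Fintype.card_pos) (Nat.cast_pos.mpr f.dS_pos)
  exact pos_of_mul_pos_left h (Nat.cast_nonneg _)

/-- Given the seed and the message, the output distribution is close to `ν`, on average over the
seed. The density of the output given `x` is split into a bounded part `g x` and a part `t x` of
small mass. -/
theorem BRI.sum_klDiv_le [Fintype S] [Nonempty S] (f : BRI S X K) (m : f.Msg) (ν : Measure Ω) [IsProbabilityMeasure ν]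
    {g t : X → Ω → ℝ} (hgm : ∀ x, Measurable (g x)) (htm : ∀ x, Measurable (t x))
    (hg : ∀ x ω, 0 ≤ g x ω) (ht : ∀ x ω, 0 ≤ t x ω) {κ b ε : ℝ} (hκ : ∀ x ω, g x ω ≤ κ)
    (hb : ∀ ω, (∑ x, (g x ω + t x ω)) / Fintype.card X ≤ b) (hb1 : 1 ≤ b) (hε : 0 ≤ ε)
    (hone : ∀ x, ∫⁻ ω, ENNReal.ofReal (g x ω + t x ω) ∂ν = 1)
    (htail : ∀ x, ∫⁻ ω, ENNReal.ofReal (t x ω) ∂ν ≤ ENNReal.ofReal ε)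
    (V : S → ProbabilityMeasure Ω) (hV : ∀ s, (V s : Measure Ω) =
      ν.withDensity fun ω => ENNReal.ofReal (f.avg m s fun x => g x ω + t x ω)) :
    ∑' s, PMF.uniformOfFintype S s * klDiv (V s : Measure Ω) ν ≤
      ENNReal.ofReal (b - 1 + f.lambda2 m.1 * κ + ε * (2 + Real.log (Fintype.card X * b))) := by
  have hcX : (0 : ℝ) < Fintype.card X := f.card_pos m
  have hcS : (0 : ℝ) < Fintype.card S := Nat.cast_pos.mpr Fintype.card_pos
  have hcX1 : (1 : ℝ) ≤ Fintype.card X := by exact_mod_cast hcX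
  have : Nonempty X := Fintype.card_pos_iff.mp (Nat.cast_pos.mp hcX)
  have hl0 := f.lambda2_nonneg m.1
  set l := f.lambda2 m.1
  -- A pointwise bound on the output density given seed and message, from the bound b on the mean
  -- over all x.
  set B : ℝ := Fintype.card X * b with hB
  have hB1 : 1 ≤ B := one_le_mul_of_one_le_of_one_le hcX1 hb1
  have hlogB := Real.log_nonneg hB1
  obtain ⟨ω₀⟩ : Nonempty Ω := nonempty_of_isProbabilityMeasure ν
  have hκ0 : 0 ≤ κ := (hg (Classical.arbitrary X) ω₀).trans (hκ _ _)
  set G : S → Ω → ℝ := fun s ω => f.avg m s fun x => g x ω with hG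
  set T : S → Ω → ℝ := fun s ω => f.avg m s fun x => t x ω with hT
  have hGm : ∀ s, Measurable (G s) := fun s => f.measurable_avg m s hgm
  have hTm : ∀ s, Measurable (T s) := fun s => f.measurable_avg m s htm
  have hG0 : ∀ s ω, 0 ≤ G s ω := fun s ω => f.avg_nonneg m s fun x => hg x ω
  have hT0 : ∀ s ω, 0 ≤ T s ω := fun s ω => f.avg_nonneg m s fun x => ht x ω
  have hGT : ∀ s ω, f.avg m s (fun x => g x ω + t x ω) = G s ω + T s ω := fun s ω =>
    f.avg_add m s _ _
  have hGTB : ∀ s ω, G s ω + T s ω ≤ B := by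
    intro s ω
    rw [← hGT]
    refine (f.avg_le_sum m s fun x => add_nonneg (hg x ω) (ht x ω)).trans ?_
    rw [hB, mul_comm, ← div_le_iff₀ hcX]
    exact hb ω
  have hkl : ∀ s, klDiv (V s : Measure Ω) ν ≤
      ∫⁻ ω, ENNReal.ofReal ((G s ω - 1) ^ 2 + T s ω * Real.log B) ∂ν := by
    intro s
    have hm : Measurable fun ω => ENNReal.ofReal (f.avg m s fun x => g x ω + t x ω) :=
      (f.measurable_avg m s fun x => (hgm x).add (htm x)).ennreal_ofReal
    have hac : (V s : Measure Ω) ≪ ν := by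
      rw [hV s]
      exact withDensity_absolutelyContinuous _ _
    rw [klDiv_eq_lintegral_klFun_of_ac hac]
    refine lintegral_mono_ae ?_
    have := Measure.rnDeriv_withDensity ν hm
    rw [← hV s] at this
    filter_upwards [this] with ω hω
    rw [hω, hGT, ENNReal.toReal_ofReal (add_nonneg (hG0 s ω) (hT0 s ω))]
    exact ENNReal.ofReal_le_ofReal (klFun_add_le (hG0 s ω) (hT0 s ω) (hGTB s ω) hB1)
  set F : Ω → ℝ := fun ω => (∑ s, ((G s ω - 1) ^ 2 + T s ω * Real.log B)) / Fintype.card S with hF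
  have hF0 : ∀ s ω, 0 ≤ (G s ω - 1) ^ 2 + T s ω * Real.log B := fun s ω =>
    add_nonneg (sq_nonneg _) (mul_nonneg (hT0 s ω) hlogB)
  have hFm : ∀ s, Measurable fun ω => (G s ω - 1) ^ 2 + T s ω * Real.log B := fun s =>
    (((hGm s).sub_const 1).pow_const 2).add ((hTm s).mul_const _)
  have hsum : ∑' s, PMF.uniformOfFintype S s * klDiv (V s : Measure Ω) ν ≤
      ∫⁻ ω, ENNReal.ofReal (F ω) ∂ν := by
    have : ∀ ω, ENNReal.ofReal (F ω) = (Fintype.card S : ℝ≥0∞)⁻¹ *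
        ∑ s, ENNReal.ofReal ((G s ω - 1) ^ 2 + T s ω * Real.log B) := by
      intro ω
      rw [hF, ENNReal.ofReal_div_of_pos hcS, ENNReal.ofReal_natCast, ENNReal.div_eq_inv_mul,
        ENNReal.ofReal_sum_of_nonneg fun s _ => hF0 s ω]
    simp_rw [this]
    rw [lintegral_const_mul _ (Finset.measurable_sum _ fun s _ => (hFm s).ennreal_ofReal),
      lintegral_finsetSum _ fun s _ => (hFm s).ennreal_ofReal, tsum_fintype, Finset.mul_sum]
    refine Finset.sum_le_sum fun s _ => ?_
    rw [PMF.uniformOfFintype_apply]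
    gcongr
    exact hkl s
  set h : Ω → ℝ := fun ω => (∑ x, (g x ω + t x ω)) / Fintype.card X with hh
  set τ : Ω → ℝ := fun ω => (∑ x, t x ω) / Fintype.card X with hτ
  -- With γ and τ the means of g and t over x, the moment bounds give F ≤ γ² - 2γ + 1 + lκγ + τ log
  -- B, where γ² ≤ bγ. Adding 2h = 2γ + 2τ makes both sides nonnegative, so that they can be
  -- integrated in `ℝ≥0∞`; since h has integral 1, the 2 is subtracted at the end.
  have hpt : ∀ ω, F ω + 2 * h ω ≤ (b + l * κ) * h ω + (1 + (2 + Real.log B) * τ ω) := by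
    intro ω
    set γ : ℝ := (∑ x, g x ω) / Fintype.card X with hγ
    have hhγ : h ω = γ + τ ω := by
      simp only [hh, hτ, hγ]
      rw [← add_div, Finset.sum_add_distrib]
    have hγ0 : 0 ≤ γ := div_nonneg (Finset.sum_nonneg fun x _ => hg x ω) hcX.le
    have hτ0 : 0 ≤ τ ω := div_nonneg (Finset.sum_nonneg fun x _ => ht x ω) hcX.le
    have hFe : F ω = (∑ s, G s ω ^ 2) / Fintype.card S - 2 * ((∑ s, G s ω) / Fintype.card S) + 1 +
        Real.log B * ((∑ s, T s ω) / Fintype.card S) := by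
      simp only [hF, sub_sq, Finset.sum_add_distrib, Finset.sum_sub_distrib, Finset.sum_const,
        Finset.card_univ, nsmul_eq_mul, ← Finset.sum_mul, ← Finset.mul_sum, mul_one, one_pow]
      field_simp
    have e1 : (∑ s, G s ω) / Fintype.card S = γ := f.sum_avg m fun x => g x ω
    have e2 : (∑ s, T s ω) / Fintype.card S = τ ω := f.sum_avg m fun x => t x ω
    have e3 : (∑ s, G s ω ^ 2) / Fintype.card S ≤ γ ^ 2 + l * ((∑ x, g x ω ^ 2) / Fintype.card X) :=
      f.sum_avg_sq_le m fun x => g x ω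
    have e4 : (∑ x, g x ω ^ 2) / Fintype.card X ≤ κ * γ := by
      rw [hγ, ← mul_div_assoc, Finset.mul_sum]
      gcongr with x
      rw [sq]
      exact mul_le_mul_of_nonneg_right (hκ x ω) (hg x ω)
    have e5 : γ ≤ b := by
      have := hb ω
      change h ω ≤ b at this
      linarith
    have e6 : l * ((∑ x, g x ω ^ 2) / Fintype.card X) ≤ l * (κ * γ) :=
      mul_le_mul_of_nonneg_left e4 hl0
    have e7 : γ * γ ≤ b * γ := mul_le_mul_of_nonneg_right e5 hγ0
    have e8 : 0 ≤ (b + l * κ) * τ ω := mul_nonneg (by positivity) hτ0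
    rw [hFe, e1, e2, hhγ]
    linarith
  have hFpos : ∀ ω, 0 ≤ F ω := fun ω =>
    div_nonneg (Finset.sum_nonneg fun s _ => hF0 s ω) hcS.le
  have hhpos : ∀ ω, 0 ≤ h ω := fun ω =>
    div_nonneg (Finset.sum_nonneg fun x _ => add_nonneg (hg x ω) (ht x ω)) hcX.le
  have hτpos : ∀ ω, 0 ≤ τ ω := fun ω =>
    div_nonneg (Finset.sum_nonneg fun x _ => ht x ω) hcX.le
  have hhm : Measurable h :=
    (Finset.measurable_sum _ fun x _ => (hgm x).add (htm x)).div_const _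
  have hτm : Measurable τ := (Finset.measurable_sum _ fun x _ => htm x).div_const _
  have hmean : ∀ (v : X → Ω → ℝ), (∀ x ω, 0 ≤ v x ω) → (∀ x, Measurable (v x)) →
      ∫⁻ ω, ENNReal.ofReal ((∑ x, v x ω) / Fintype.card X) ∂ν =
        (Fintype.card X : ℝ≥0∞)⁻¹ * ∑ x, ∫⁻ ω, ENNReal.ofReal (v x ω) ∂ν := by
    intro v hv hvm
    rw [← lintegral_finsetSum _ fun x _ => (hvm x).ennreal_ofReal,
      ← lintegral_const_mul _ (Finset.measurable_sum _ fun x _ => (hvm x).ennreal_ofReal)]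
    refine lintegral_congr fun ω => ?_
    rw [ENNReal.ofReal_div_of_pos hcX, ENNReal.ofReal_natCast, ENNReal.div_eq_inv_mul,
      ENNReal.ofReal_sum_of_nonneg fun x _ => hv x ω]
  have hcX0 : (Fintype.card X : ℝ≥0∞) ≠ 0 := by simp
  have hh1 : ∫⁻ ω, ENNReal.ofReal (h ω) ∂ν = 1 := by
    rw [hmean (fun x ω => g x ω + t x ω) (fun x ω => add_nonneg (hg x ω) (ht x ω))
      fun x => (hgm x).add (htm x)]
    simp_rw [hone]
    rw [Finset.sum_const, Finset.card_univ, nsmul_eq_mul, mul_one,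
      ENNReal.inv_mul_cancel hcX0 (ENNReal.natCast_ne_top _)]
  have hτε : ∫⁻ ω, ENNReal.ofReal (τ ω) ∂ν ≤ ENNReal.ofReal ε := by
    rw [hmean t ht htm]
    calc _ ≤ (Fintype.card X : ℝ≥0∞)⁻¹ * ∑ _x : X, ENNReal.ofReal ε := by
          gcongr with x
          exact htail x
      _ = ENNReal.ofReal ε := by
          rw [Finset.sum_const, Finset.card_univ, nsmul_eq_mul, ← mul_assoc,
            ENNReal.inv_mul_cancel hcX0 (ENNReal.natCast_ne_top _), one_mul]
  have hfin : ∫⁻ ω, ENNReal.ofReal (F ω) ∂ν + ENNReal.ofReal 2 ≤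
      ENNReal.ofReal (b + l * κ + (1 + (2 + Real.log B) * ε)) := by
    calc _ = ∫⁻ ω, ENNReal.ofReal (F ω) ∂ν + ENNReal.ofReal 2 * ∫⁻ ω, ENNReal.ofReal (h ω) ∂ν := by
          rw [hh1, mul_one]
      _ = ∫⁻ ω, ENNReal.ofReal (F ω + 2 * h ω) ∂ν := by
          rw [← lintegral_const_mul _ hhm.ennreal_ofReal,
            ← lintegral_add_right _ (hhm.ennreal_ofReal.const_mul _)]
          refine lintegral_congr fun ω => ?_
          rw [ENNReal.ofReal_add (hFpos ω) (mul_nonneg zero_le_two (hhpos ω)),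
            ENNReal.ofReal_mul zero_le_two]
      _ ≤ ∫⁻ ω, ENNReal.ofReal ((b + l * κ) * h ω + (1 + (2 + Real.log B) * τ ω)) ∂ν :=
          lintegral_mono fun ω => ENNReal.ofReal_le_ofReal (hpt ω)
      _ = ENNReal.ofReal (b + l * κ) * ∫⁻ ω, ENNReal.ofReal (h ω) ∂ν +
          (1 + ENNReal.ofReal (2 + Real.log B) * ∫⁻ ω, ENNReal.ofReal (τ ω) ∂ν) := by
          rw [← lintegral_const_mul _ hhm.ennreal_ofReal,
            ← lintegral_const_mul _ hτm.ennreal_ofReal]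
          conv_rhs => rw [← measure_univ (μ := ν), ← lintegral_one]
          rw [← lintegral_add_left measurable_const,
            ← lintegral_add_left (hhm.ennreal_ofReal.const_mul _)]
          refine lintegral_congr fun ω => ?_
          have := hhpos ω
          have := hτpos ω
          rw [ENNReal.ofReal_add (by positivity) (by positivity), ENNReal.ofReal_mul (by positivity),
            ENNReal.ofReal_add zero_le_one (by positivity), ENNReal.ofReal_mul (by positivity),
            ENNReal.ofReal_one]
      _ ≤ ENNReal.ofReal (b + l * κ) * 1 +
          (1 + ENNReal.ofReal (2 + Real.log B) * ENNReal.ofReal ε) := by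
          rw [hh1]
          gcongr
      _ = _ := by
          rw [mul_one, ENNReal.ofReal_add (p := b + l * κ) (by positivity) (by positivity),
            ENNReal.ofReal_add zero_le_one (by positivity), ENNReal.ofReal_mul (by positivity),
            ENNReal.ofReal_one]
  refine hsum.trans ((ENNReal.le_sub_of_add_le_right ENNReal.ofReal_ne_top hfin).trans_eq ?_)
  rw [← ENNReal.ofReal_sub _ zero_le_two]
  congr 1
  ring

end PrivacyAmplification

end Wiretap

namespace Wiretap

open InformationTheory

/-! ### Leakage of the modular scheme over a channel with densities -/

section Density

variable {A Z : Type*} [MeasurableSpace Z]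

theorem lintegral_ofReal_finsetSum_mul (μ : Measure Z) (F : Finset A) {c : A → ℝ} {h : A → Z → ℝ}
    (hc : ∀ a, 0 ≤ c a) (hh : ∀ a z, 0 ≤ h a z) (hm : ∀ a, Measurable (h a)) :
    ∫⁻ z, ENNReal.ofReal (∑ a ∈ F, c a * h a z) ∂μ =
      ∑ a ∈ F, ENNReal.ofReal (c a) * ∫⁻ z, ENNReal.ofReal (h a z) ∂μ := by
  simp_rw [← lintegral_const_mul _ (hm _).ennreal_ofReal]
  rw [← lintegral_finsetSum _ fun a _ => (hm a).ennreal_ofReal.const_mul _]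
  refine lintegral_congr fun z => ?_
  rw [ENNReal.ofReal_sum_of_nonneg fun a _ => mul_nonneg (hc a) (hh a z)]
  exact Finset.sum_congr rfl fun a _ => ENNReal.ofReal_mul (hc a)

theorem PMF_tsum_eq_sum (p : PMF A) {F : Finset A} (hF : p.support ⊆ F) (G : A → ℝ≥0∞) :
    ∑' a, p a * G a = ∑ a ∈ F, ENNReal.ofReal (p a).toReal * G a := by
  rw [tsum_eq_sum (s := F)]
  · exact Finset.sum_congr rfl fun a _ => by rw [ENNReal.ofReal_toReal (p.apply_ne_top a)]
  · intro a ha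
    have : p a = 0 := by
      by_contra h
      exact ha (hF ((PMF.mem_support_iff p a).mpr h))
    rw [this, zero_mul]

theorem PMF_sum_toReal (p : PMF A) {F : Finset A} (hF : p.support ⊆ F) :
    ∑ a ∈ F, (p a).toReal = 1 := by
  have h := PMF_tsum_eq_sum p hF fun _ => 1
  simp only [mul_one, p.tsum_coe] at h
  rw [← ENNReal.ofReal_sum_of_nonneg fun a _ => ENNReal.toReal_nonneg, eq_comm,
    ENNReal.ofReal_eq_one] at h
  exact h

theorem output_eq_withDensity (p : PMF A) {F : Finset A} (hF : p.support ⊆ F) (W : Channel A Z)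
    (Q : Measure Z) {L : A → Z → ℝ} (hL0 : ∀ a z, 0 ≤ L a z) (hLm : ∀ a, Measurable (L a))
    (hW : ∀ a ∈ F, (W a : Measure Z) = Q.withDensity fun z => ENNReal.ofReal (L a z)) :
    (output p W : Measure Z) =
      Q.withDensity fun z => ENNReal.ofReal (∑ a ∈ F, (p a).toReal * L a z) := by
  refine Measure.ext fun s hs => ?_
  rw [output_apply _ _ hs, withDensity_apply _ hs, lintegral_ofReal_finsetSum_mul _ _
    (fun _ => ENNReal.toReal_nonneg) hL0 hLm, PMF_tsum_eq_sum p hF]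
  refine Finset.sum_congr rfl fun a ha => ?_
  rw [hW a ha, withDensity_apply _ hs]

variable {S X K Y : Type*} [Fintype X] [MeasurableSpace Y]

open Classical in
theorem BRI.randInv_toReal (f : BRI S X K) (s : S) (m : f.Msg) (x : X) :
    (f.randInv s m x).toReal = if f.toFun s x = m.1 then (f.dS : ℝ)⁻¹ else 0 := by
  rw [randInv, PMF.uniformOfFinset_apply]
  have hc : (Finset.univ.filter fun x => f.toFun s x = m.1).card = f.dS := by
    rw [← f.S_regular m.1 m.2 s, Set.ncard_eq_toFinset_card']
    congr 1
    ext x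
    simp
  rw [hc]
  simp only [Finset.mem_filter, Finset.mem_univ, true_and]
  split_ifs <;> simp

theorem BRI.sum_randInv_mul (f : BRI S X K) (s : S) (m : f.Msg) (v : X → ℝ) :
    ∑ x, (f.randInv s m x).toReal * v x = f.avg m s v := by
  classical
  rw [avg, Finset.sum_div]
  refine Finset.sum_congr rfl fun x _ => ?_
  rw [f.randInv_toReal]
  split_ifs <;> simp [div_eq_inv_mul]

/-- The leakage of the modular scheme over a channel with densities `L a`, in terms of a threshold
`k` which the densities exceed with probability at most `ε`. -/
theorem modular_leak_le [Fintype S] [Nonempty S] [Nonempty X] (f : BRI S X K) (C : ErrCode X A Y) (W : Channel A Z)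
    (Q : Measure Z) [IsProbabilityMeasure Q] {L : A → Z → ℝ} (hL0 : ∀ a z, 0 ≤ L a z)
    (hLm : ∀ a, Measurable (L a))
    (hW : ∀ x, ∀ a ∈ (C.enc x).support,
      (W a : Measure Z) = Q.withDensity fun z => ENNReal.ofReal (L a z))
    {k ε η l : ℝ} (hk : 0 ≤ k) (hε : 0 ≤ ε) (hη0 : 0 < η) (hη1 : η < 1)
    (htail : ∀ x, ∀ a ∈ (C.enc x).support, (W a : Measure Z) {z | k < L a z} ≤ ENNReal.ofReal ε)
    (hl : ∀ m ∈ f.regSet, f.lambda2 m ≤ l) :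
    (modular f C).leak W * ENNReal.ofReal (Real.log 2) ≤
      ENNReal.ofReal ((1 - η)⁻¹ - 1 + l * (k / η) +
        ε * (2 + Real.log (Fintype.card X * (1 - η)⁻¹))) := by
  classical
  have hcX : (0 : ℝ) < Fintype.card X := Nat.cast_pos.mpr Fintype.card_pos
  have hη' : 0 < 1 - η := by linarith
  set F : X → Finset A := fun x => (C.finite_support x).toFinset with hFdef
  have hF : ∀ x, (C.enc x).support ⊆ F x := fun x => by simp [hFdef]
  have hF' : ∀ x, ∀ a ∈ F x, a ∈ (C.enc x).support := fun x a ha => by simpa [hFdef] using ha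
  set p : X → A → ℝ := fun x a => (C.enc x a).toReal with hp
  have hp0 : ∀ x a, 0 ≤ p x a := fun x a => ENNReal.toReal_nonneg
  have hp1 : ∀ x, ∑ a ∈ F x, p x a = 1 := fun x => PMF_sum_toReal _ (hF x)
  -- The density is cut at the threshold for each channel input separately, before averaging over
  -- the stochastic encoder: the tail hypothesis concerns single inputs.
  set Lu : A → Z → ℝ := fun a => {z | k < L a z}ᶜ.indicator (L a) with hLu
  set Lv : A → Z → ℝ := fun a => {z | k < L a z}.indicator (L a) with hLv
  have hms : ∀ a, MeasurableSet {z | k < L a z} := fun a => measurableSet_lt measurable_const (hLm a)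
  have hLum : ∀ a, Measurable (Lu a) := fun a => (hLm a).indicator (hms a).compl
  have hLvm : ∀ a, Measurable (Lv a) := fun a => (hLm a).indicator (hms a)
  have hLu0 : ∀ a z, 0 ≤ Lu a z := fun a z => Set.indicator_nonneg (fun z _ => hL0 a z) z
  have hLv0 : ∀ a z, 0 ≤ Lv a z := fun a z => Set.indicator_nonneg (fun z _ => hL0 a z) z
  have hLuk : ∀ a z, Lu a z ≤ k := by
    intro a z
    refine Set.indicator_le' (fun z hz => ?_) (fun _ _ => hk) z
    simpa using hz
  have hLuv : ∀ a z, Lu a z + Lv a z = L a z := fun a z => by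
    have := congrFun (Set.indicator_compl_add_self {z | k < L a z} (L a)) z
    exact this
  set u : X → Z → ℝ := fun x z => ∑ a ∈ F x, p x a * Lu a z with hu
  set v : X → Z → ℝ := fun x z => ∑ a ∈ F x, p x a * Lv a z with hv
  set w : X → Z → ℝ := fun x z => ∑ a ∈ F x, p x a * L a z with hw
  have hu0 : ∀ x z, 0 ≤ u x z := fun x z =>
    Finset.sum_nonneg fun a _ => mul_nonneg (hp0 x a) (hLu0 a z)
  have hv0 : ∀ x z, 0 ≤ v x z := fun x z =>
    Finset.sum_nonneg fun a _ => mul_nonneg (hp0 x a) (hLv0 a z)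
  have hw0 : ∀ x z, 0 ≤ w x z := fun x z =>
    Finset.sum_nonneg fun a _ => mul_nonneg (hp0 x a) (hL0 a z)
  have hum : ∀ x, Measurable (u x) := fun x =>
    Finset.measurable_sum _ fun a _ => (hLum a).const_mul _
  have hvm : ∀ x, Measurable (v x) := fun x =>
    Finset.measurable_sum _ fun a _ => (hLvm a).const_mul _
  have hwm : ∀ x, Measurable (w x) := fun x =>
    Finset.measurable_sum _ fun a _ => (hLm a).const_mul _
  have huv : ∀ x z, u x z + v x z = w x z := fun x z => by
    simp only [hu, hv, hw, ← Finset.sum_add_distrib, ← mul_add, hLuv]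
  have huk : ∀ x z, u x z ≤ k := fun x z => by
    calc u x z ≤ ∑ a ∈ F x, p x a * k :=
          Finset.sum_le_sum fun a _ => mul_le_mul_of_nonneg_left (hLuk a z) (hp0 x a)
      _ = k := by rw [← Finset.sum_mul, hp1, one_mul]
  have hWx : ∀ x, (output (C.enc x) W : Measure Z) =
      Q.withDensity fun z => ENNReal.ofReal (w x z) := fun x =>
    output_eq_withDensity _ (hF x) W Q hL0 hLm fun a ha => hW x a (hF' x a ha)
  have hw1 : ∀ x, ∫⁻ z, ENNReal.ofReal (w x z) ∂Q = 1 := by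
    intro x
    have := measure_univ (μ := (output (C.enc x) W : Measure Z))
    rwa [hWx, withDensity_apply _ MeasurableSet.univ, Measure.restrict_univ] at this
  -- The reference is (1 - η) times the mean output over all x plus η times `Q`. The first part
  -- bounds the mean density relative to the reference by (1 - η)⁻¹; the second keeps q ≥ η, so the
  -- truncated densities become at most k/η.
  set q : Z → ℝ := fun z => (1 - η) * ((∑ x, w x z) / Fintype.card X) + η with hq
  have hwbar0 : ∀ z, 0 ≤ (∑ x, w x z) / Fintype.card X := fun z =>
    div_nonneg (Finset.sum_nonneg fun x _ => hw0 x z) hcX.le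
  have hqη : ∀ z, η ≤ q z := fun z => by
    have := mul_nonneg hη'.le (hwbar0 z)
    simp only [hq]
    linarith
  have hq0 : ∀ z, 0 < q z := fun z => hη0.trans_le (hqη z)
  have hqm : Measurable q :=
    (((Finset.measurable_sum _ fun x _ => hwm x).div_const _).const_mul _).add_const _
  set ν : Measure Z := Q.withDensity fun z => ENNReal.ofReal (q z) with hν
  have hνprob : IsProbabilityMeasure ν := by
    refine ⟨?_⟩
    rw [hν, withDensity_apply _ MeasurableSet.univ, Measure.restrict_univ]
    have h1 : ∀ z, ENNReal.ofReal (q z) =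
        ENNReal.ofReal (∑ x, ((1 - η) / Fintype.card X) * w x z) + ENNReal.ofReal η := by
      intro z
      rw [← ENNReal.ofReal_add (Finset.sum_nonneg fun x _ => mul_nonneg (by positivity) (hw0 x z))
        hη0.le, ← Finset.mul_sum]
      congr 1
      simp only [hq]
      ring
    simp_rw [h1]
    rw [lintegral_add_right _ measurable_const, lintegral_ofReal_finsetSum_mul Q Finset.univ
      (fun _ => by positivity) hw0 hwm]
    simp_rw [hw1]
    rw [lintegral_const, measure_univ, mul_one, mul_one, Finset.sum_const, Finset.card_univ,
      nsmul_eq_mul, ← ENNReal.ofReal_natCast, ← ENNReal.ofReal_mul hcX.le,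
      ← ENNReal.ofReal_add (by positivity) hη0.le, mul_div_cancel₀ _ hcX.ne', sub_add_cancel,
      ENNReal.ofReal_one]
  have hνint : ∀ {h : Z → ℝ}, Measurable h →
      ∫⁻ z, ENNReal.ofReal (h z / q z) ∂ν = ∫⁻ z, ENNReal.ofReal (h z) ∂Q := by
    intro h hm
    have hm' : Measurable fun z => ENNReal.ofReal (h z / q z) := (hm.div hqm).ennreal_ofReal
    rw [hν, lintegral_withDensity_eq_lintegral_mul _ hqm.ennreal_ofReal hm']
    refine lintegral_congr fun z => ?_
    rw [Pi.mul_apply, ← ENNReal.ofReal_mul (hq0 z).le, mul_div_cancel₀ _ (hq0 z).ne']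
  refine SeededCode.leak_mul_log_le _ _ _ (fun _ _ => ⟨ν, hνprob⟩) fun P => ?_
  refine (ENNReal.tsum_le_tsum fun m => mul_le_mul_right ?_ (P m)).trans_eq
    (by rw [ENNReal.tsum_mul_right, P.tsum_coe, one_mul])
  refine (f.sum_klDiv_le m ν (g := fun x z => u x z / q z) (t := fun x z => v x z / q z)
    (κ := k / η) (b := (1 - η)⁻¹) (ε := ε)
    (fun x => (hum x).div hqm) (fun x => (hvm x).div hqm) (fun x z => div_nonneg (hu0 x z) (hq0 z).le)
    (fun x z => div_nonneg (hv0 x z) (hq0 z).le)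
    (fun x z => div_le_div₀ hk (huk x z) hη0 (hqη z)) ?_ ?_ hε ?_ ?_
    (fun s => output ((modular f C).enc s m) W) ?_).trans ?_
  · intro z
    simp_rw [← add_div, huv]
    rw [← Finset.sum_div, div_right_comm, div_le_iff₀ (hq0 z), inv_mul_eq_div, le_div_iff₀ hη']
    simp only [hq]
    linarith
  · exact (one_le_inv₀ hη').mpr (by linarith)
  · intro x
    simp_rw [← add_div, huv]
    rw [hνint (hwm x), hw1]
  · intro x
    rw [hνint (hvm x), lintegral_ofReal_finsetSum_mul Q (F x) (hp0 x) hLv0 hLvm]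
    calc _ ≤ ∑ a ∈ F x, ENNReal.ofReal (p x a) * ENNReal.ofReal ε := by
          refine Finset.sum_le_sum fun a ha => ?_
          gcongr
          have h1 := htail x a (hF' x a ha)
          rw [hW x a (hF' x a ha), withDensity_apply _ (hms a), ← lintegral_indicator (hms a)] at h1
          refine le_trans (lintegral_mono fun z => ?_) h1
          simp only [hLv, Set.indicator]
          split_ifs <;> simp
      _ = ENNReal.ofReal ε := by
          rw [← Finset.sum_mul, ← ENNReal.ofReal_sum_of_nonneg fun a _ => hp0 x a, hp1,
            ENNReal.ofReal_one, one_mul]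
  · intro s
    change (output ((f.randInv s m).bind C.enc) W : Measure Z) = _
    have hm' : Measurable fun z =>
        ENNReal.ofReal (f.avg m s fun x => u x z / q z + v x z / q z) :=
      (f.measurable_avg m s (v := fun x z => u x z / q z + v x z / q z)
        fun x => ((hum x).div hqm).add ((hvm x).div hqm)).ennreal_ofReal
    rw [output_bind, output_eq_withDensity _ (F := Finset.univ) (by simp) _ Q hw0 hwm
      (fun x _ => hWx x), hν, ← withDensity_mul _ hqm.ennreal_ofReal hm']
    congr 1
    funext z
    rw [Pi.mul_apply, ← ENNReal.ofReal_mul (hq0 z).le, f.sum_randInv_mul]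
    congr 1
    simp only [← add_div, huv, BRI.avg]
    rw [← mul_div_assoc, Finset.mul_sum]
    congr 1
    refine Finset.sum_congr rfl fun x _ => ?_
    split_ifs
    · rw [mul_div_cancel₀ _ (hq0 z).ne']
    · simp
  · refine ENNReal.ofReal_le_ofReal ?_
    have := hl m.1 m.2
    gcongr

end Density

/-! ### Memoryless extensions -/

section Memoryless

variable {A Z : Type*} [MeasurableSpace Z]

theorem lintegral_pi_prod {n : ℕ} (μ : Fin n → Measure Z) [∀ i, SigmaFinite (μ i)]
    {h : Fin n → Z → ℝ≥0∞} (hm : ∀ i, Measurable (h i)) :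
    ∫⁻ z, ∏ i, h i (z i) ∂(Measure.pi μ) = ∏ i, ∫⁻ z, h i z ∂(μ i) := by
  induction n with
  | zero => simp
  | succ n ih =>
    have h1 := (measurePreserving_piFinSuccAbove μ 0).symm
    rw [← h1.lintegral_comp_emb (MeasurableEquiv.measurableEmbedding _)]
    simp_rw [Fin.prod_univ_succ]
    rw [← ih (fun i => μ i.succ) fun i => hm i.succ]
    exact lintegral_prod_mul (μ := μ 0) (ν := Measure.pi fun i : Fin n => μ i.succ)
      (f := h 0) (g := fun z => ∏ i : Fin n, h i.succ (z i)) (hm 0).aemeasurable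
      (Finset.measurable_prod _ fun i _ =>
        (hm i.succ).comp (measurable_pi_apply i)).aemeasurable

theorem pow_eq_withDensity (U : Channel A Z) (Q : Measure Z) [IsProbabilityMeasure Q]
    {L : A → Z → ℝ} (hL0 : ∀ a z, 0 ≤ L a z) (hLm : ∀ a, Measurable (L a))
    (hU : ∀ a, (U a : Measure Z) = Q.withDensity fun z => ENNReal.ofReal (L a z)) {n : ℕ}
    (a : Fin n → A) :
    (U.pow n a : Measure (Fin n → Z)) = (Measure.pi fun _ => Q).withDensity
      fun z => ENNReal.ofReal (∏ i, L (a i) (z i)) := by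
  rw [Channel.pow, ProbabilityMeasure.toMeasure_pi]
  refine Measure.pi_eq fun s hs => ?_
  have h1 : ∀ z : Fin n → Z, ENNReal.ofReal (∏ i, L (a i) (z i)) =
      ∏ i, ENNReal.ofReal (L (a i) (z i)) := fun z =>
    ENNReal.ofReal_prod_of_nonneg fun i _ => hL0 _ _
  simp_rw [h1]
  rw [withDensity_apply _ (MeasurableSet.univ_pi hs), Measure.restrict_pi_pi,
    lintegral_pi_prod (fun i => Q.restrict (s i)) (h := fun i z => ENNReal.ofReal (L (a i) z))
      fun i => (hLm _).ennreal_ofReal]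
  refine Finset.prod_congr rfl fun i _ => ?_
  rw [hU, withDensity_apply _ (hs i)]

/-- Chernoff bound for the density of a memoryless extension. -/
theorem pow_tail_le (U : Channel A Z) {L : A → Z → ℝ} (hL0 : ∀ a z, 0 ≤ L a z)
    (hLm : ∀ a, Measurable (L a)) {n : ℕ} (a : Fin n → A) {α k : ℝ} (hα : 0 < α) (hk : 0 < k) :
    (U.pow n a : Measure (Fin n → Z)) {z | k < ∏ i, L (a i) (z i)} ≤
      ENNReal.ofReal (k ^ (-α)) *
        ∏ i, ∫⁻ z, ENNReal.ofReal (L (a i) z ^ α) ∂(U (a i) : Measure Z) := by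
  have hpm : ∀ i, Measurable fun z => ENNReal.ofReal (L (a i) z ^ α) := fun i =>
    ((hLm _).pow_const α).ennreal_ofReal
  have hpm' : Measurable fun z : Fin n → Z => ∏ i, ENNReal.ofReal (L (a i) (z i) ^ α) :=
    Finset.measurable_prod _ fun i _ => (hpm i).comp (measurable_pi_apply i)
  have hLm' : Measurable fun z : Fin n → Z => ∏ i, L (a i) (z i) :=
    Finset.measurable_prod _ fun i _ => (hLm (a i)).comp (measurable_pi_apply i)
  rw [← lintegral_pi_prod (fun i => (U (a i) : Measure Z)) hpm, Channel.pow,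
    ProbabilityMeasure.toMeasure_pi, ← lintegral_const_mul _ hpm', ← lintegral_indicator_one (measurableSet_lt measurable_const hLm')]
  refine lintegral_mono fun z => ?_
  rw [Set.indicator_apply]
  split_ifs with hz
  swap
  · exact zero_le
  rw [← ENNReal.ofReal_prod_of_nonneg fun i _ => Real.rpow_nonneg (hL0 _ _) _,
    Real.finsetProd_rpow _ _ fun i _ => hL0 _ _, ← ENNReal.ofReal_mul (Real.rpow_nonneg hk.le _),
    Pi.one_apply, ENNReal.one_le_ofReal, Real.rpow_neg hk.le, inv_mul_eq_div,
    one_le_div (Real.rpow_pos_of_pos hk _)]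
  exact Real.rpow_le_rpow hk.le (le_of_lt hz) hα.le

end Memoryless

end Wiretap

namespace Wiretap

/-! ### Exponential decay of the leakage -/

section Exponent

variable {S : ℕ → Type*} {X : ℕ → Type*} {K : ℕ → Type*} [∀ n, Fintype (X n)]

/-- By the limits defining a good sequence, -log₂ λ₂ is eventually at least (t - x)(r - x)n for
every small x > 0, uniformly in m. -/
theorem IsGoodSequence.eventually_lambda2_le {f : ∀ n, BRI (S n) (X n) (K n)} {r t : ℝ}
    (hf : IsGoodSequence f r t) (hr : 0 < r) (ht : 0 < t) {δ : ℝ} (hδ : 0 < δ) :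
    ∀ᶠ n : ℕ in atTop, ∀ m ∈ (f n).regSet,
      (f n).lambda2 m ≤ Real.exp (-(n * (t * r * Real.log 2 - δ))) := by
  obtain ⟨h1, -, h3⟩ := hf
  have hlog2 : 0 < Real.log 2 := Real.log_pos one_lt_two
  -- The last term ensures (t - x)(r - x) log 2 ≥ t r log 2 - δ; the others keep both factors
  -- positive.
  set x : ℝ := min (min (t / 2) (r / 2)) (δ / ((t + r) * Real.log 2)) with hx
  have hx0 : 0 < x := by positivity
  have hxt : x < t := (min_le_left _ _).trans_lt ((min_le_left _ _).trans_lt (by linarith))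
  have hxr : x < r := (min_le_left _ _).trans_lt ((min_le_right _ _).trans_lt (by linarith))
  have hxδ : x * ((t + r) * Real.log 2) ≤ δ := by
    rw [← le_div_iff₀ (by positivity)]
    exact min_le_right _ _
  have hlim : ((t - x : ℝ) : EReal) < liminf (fun n : ℕ =>
      (⨅ m ∈ (f n).regSet, negLog2 ((f n).lambda2 m)) /
        ((Real.logb 2 (Fintype.card (X n)) : ℝ) : EReal)) atTop :=
    lt_of_lt_of_le (EReal.coe_lt_coe_iff.mpr (by linarith)) h3
  filter_upwards [eventually_lt_of_lt_liminf hlim,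
    h1.eventually (lt_mem_nhds (show r - x < r by linarith)), eventually_gt_atTop 0]
    with n hn1 hn2 hn m hm
  have hn0 : (0 : ℝ) < n := Nat.cast_pos.mpr hn
  rw [lt_div_iff₀ hn0] at hn2
  have hrx : 0 < r - x := by linarith
  have htx : 0 < t - x := by linarith
  have hX : 0 < Real.logb 2 (Fintype.card (X n)) := (by positivity : 0 < (r - x) * n).trans hn2
  have hl0 := (f n).lambda2_nonneg m
  -- For λ₂ = 0 the value of `negLog2` is infinite, so this case is separate; the claim is trivial
  -- there.
  rcases hl0.eq_or_lt with h0 | hpos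
  · rw [← h0]
    exact (Real.exp_pos _).le
  have hm1 : ((t - x : ℝ) : EReal) < negLog2 ((f n).lambda2 m) /
      ((Real.logb 2 (Fintype.card (X n)) : ℝ) : EReal) :=
    hn1.trans_le (EReal.div_le_div_right_of_nonneg (by exact_mod_cast hX.le) (iInf₂_le m hm))
  rw [negLog2, if_neg hpos.ne', ← EReal.coe_div, EReal.coe_lt_coe_iff, lt_div_iff₀ hX,
    lt_neg, ← Real.log_div_log, div_lt_iff₀ hlog2] at hm1
  rw [← Real.exp_log hpos]
  refine Real.exp_le_exp.mpr (hm1.le.trans ?_)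
  have e1 : (t - x) * ((r - x) * n) ≤ (t - x) * Real.logb 2 (Fintype.card (X n)) :=
    mul_le_mul_of_nonneg_left hn2.le htx.le
  have e2 : (t - x) * ((r - x) * n) * Real.log 2 ≤
      (t - x) * Real.logb 2 (Fintype.card (X n)) * Real.log 2 :=
    mul_le_mul_of_nonneg_right e1 hlog2.le
  have e3 : 0 ≤ x * x * n * Real.log 2 := by positivity
  have e4 := mul_le_mul_of_nonneg_right hxδ hn0.le
  nlinarith

theorem IsGoodSequence.eventually_log_card_le {f : ∀ n, BRI (S n) (X n) (K n)} {r t : ℝ}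
    (hf : IsGoodSequence f r t) :
    ∀ᶠ n : ℕ in atTop, Real.log (Fintype.card (X n)) ≤ n * ((r + 1) * Real.log 2) := by
  have hlog2 : 0 < Real.log 2 := Real.log_pos one_lt_two
  filter_upwards [hf.1.eventually (gt_mem_nhds (show r < r + 1 by linarith)),
    eventually_gt_atTop 0] with n hn hn0
  rw [div_lt_iff₀ (Nat.cast_pos.mpr hn0), Real.logb, div_lt_iff₀ hlog2] at hn
  linarith

variable {A Y Z : Type*} [MeasurableSpace Y] [MeasurableSpace Z]
  [∀ n, Fintype (S n)] [∀ n, Nonempty (S n)] [∀ n, Nonempty (X n)]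

/-- The leakage of the modular schemes decreases exponentially if the exponential moments of the
information density, with respect to a reference output distribution `Q`, are those of an
information rate below `t r`. -/
theorem exists_modular_leak_le {f : ∀ n, BRI (S n) (X n) (K n)} {r t : ℝ}
    (hf : IsGoodSequence f r t) (hr : 0 < r) (ht : 0 < t)
    (C : ∀ n, ErrCode (X n) (Fin n → A) (Fin n → Y)) (U : Channel A Z)
    (Q : Measure Z) [IsProbabilityMeasure Q] {L : A → Z → ℝ} (hL0 : ∀ a z, 0 ≤ L a z)
    (hLm : ∀ a, Measurable (L a))
    (hU : ∀ a, (U a : Measure Z) = Q.withDensity fun z => ENNReal.ofReal (L a z))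
    (B : ∀ n, Set (Fin n → A)) (hB : ∀ᶠ n in atTop, (C n).InputsIn (B n)) {R : ℝ}
    (hR : R < t * r * Real.log 2)
    (hmom : ∀ δ > 0, ∃ α > 0, ∀ n : ℕ, ∀ a ∈ B n,
      ∏ i, ∫⁻ z, ENNReal.ofReal (L (a i) z ^ α) ∂(U (a i) : Measure Z) ≤
        ENNReal.ofReal (Real.exp (n * (α * (R + δ))))) :
    ∃ c : ℝ, 0 < c ∧ ∀ᶠ n : ℕ in atTop, (modular (f n) (C n)).leak (U.pow n) ≤
      ENNReal.ofReal ((2 : ℝ) ^ (-(c * (n : ℝ)))) := by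
  have hlog2 : 0 < Real.log 2 := Real.log_pos one_lt_two
  -- The gap is divided by 8 to leave room for the losses in the eigenvalue bound, the moments, the
  -- threshold and the mixing weight.
  set δ : ℝ := (t * r * Real.log 2 - R) / 8 with hδ
  have hδ0 : 0 < δ := by linarith
  obtain ⟨α, hα, hmom⟩ := hmom δ hδ0
  set β : ℝ := min δ (α * δ) with hβ
  have hβ0 : 0 < β := by positivity
  set D : ℝ := (r + 1) * Real.log 2 with hD
  -- Half of the exponent β is sacrificed to absorb the linear factor coming from log|X| and the
  -- constants.
  have hlim : Tendsto (fun n : ℕ => (7 + D * n) * Real.exp (-(β / 2 * n))) atTop (𝓝 0) := by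
    have h1 : Tendsto (fun x : ℝ => x * Real.exp (-(β / 2 * x))) atTop (𝓝 0) := by
      have h := ((Real.tendsto_pow_mul_exp_neg_atTop_nhds_zero 1).comp
        (tendsto_id.const_mul_atTop (half_pos hβ0))).const_mul (β / 2)⁻¹
      rw [mul_zero] at h
      refine h.congr fun x => ?_
      simp only [Function.comp_apply, id, pow_one]
      field_simp
    have h2 : Tendsto (fun x : ℝ => Real.exp (-(β / 2 * x))) atTop (𝓝 0) :=
      Real.tendsto_exp_neg_atTop_nhds_zero.comp (tendsto_id.const_mul_atTop (half_pos hβ0))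
    have h3 := ((h2.const_mul 7).add (h1.const_mul D)).comp tendsto_natCast_atTop_atTop
    simp only [mul_zero, add_zero] at h3
    refine h3.congr fun n => ?_
    simp only [Function.comp_apply]
    ring
  have hη : Tendsto (fun n : ℕ => Real.exp (-(δ * n))) atTop (𝓝 0) :=
    (Real.tendsto_exp_neg_atTop_nhds_zero.comp (tendsto_id.const_mul_atTop hδ0)).comp
      tendsto_natCast_atTop_atTop
  refine ⟨β / 2 / Real.log 2, by positivity, ?_⟩
  filter_upwards [hB, hf.eventually_lambda2_le hr ht hδ0, hf.eventually_log_card_le,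
    hlim.eventually (gt_mem_nhds hlog2), hη.eventually (gt_mem_nhds one_half_pos)]
    with n hin hl hX hfin hη2
  -- The threshold k has exponent R + 2δ while the moments have exponent α(R + δ), so the Chernoff
  -- bound gives ε = exp(-αδn). The mixing weight η also decays, so that (1 - η)⁻¹ - 1 is
  -- exponentially small.
  set η := Real.exp (-(δ * n)) with hηdef
  set k := Real.exp (n * (R + 2 * δ)) with hk
  set ε := Real.exp (-(α * δ * n)) with hε
  set l := Real.exp (-(n * (t * r * Real.log 2 - δ))) with hl'
  have hη0 : 0 < η := Real.exp_pos _
  have hcX : (0 : ℝ) < Fintype.card (X n) := Nat.cast_pos.mpr Fintype.card_pos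
  have htail : ∀ x, ∀ a ∈ ((C n).enc x).support,
      (U.pow n a : Measure (Fin n → Z)) {z | k < ∏ i, L (a i) (z i)} ≤ ENNReal.ofReal ε := by
    intro x a ha
    refine (pow_tail_le U hL0 hLm a hα (Real.exp_pos _)).trans ?_
    refine (mul_le_mul_right (hmom n a (hin x ha)) _).trans_eq ?_
    rw [← ENNReal.ofReal_mul (Real.rpow_nonneg (Real.exp_pos _).le _), ← Real.exp_mul,
      ← Real.exp_add, hε]
    congr 2
    ring
  have hmain := modular_leak_le (f n) (C n) (U.pow n) (Measure.pi fun _ : Fin n => Q)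
    (L := fun a z => ∏ i, L (a i) (z i)) (fun a z => Finset.prod_nonneg fun i _ => hL0 _ _)
    (fun a => Finset.measurable_prod _ fun i _ => (hLm (a i)).comp (measurable_pi_apply i))
    (fun x a _ => pow_eq_withDensity U Q hL0 hLm hU a) (Real.exp_pos _).le (Real.exp_pos _).le
    hη0 (by linarith) htail hl
  have hη1 : (1 - η)⁻¹ ≤ 2 := by
    rw [inv_le_comm₀ (by linarith) two_pos]
    linarith
  have hη3 : (1 - η)⁻¹ - 1 ≤ 2 * η := by
    have h : (1 - η)⁻¹ - 1 = (1 - η)⁻¹ * η := by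
      have : 1 - η ≠ 0 := by linarith
      field_simp
      ring
    rw [h]
    exact mul_le_mul_of_nonneg_right hη1 hη0.le
  -- The exponents add up to -(R + 8δ) + δ + R + 2δ + δ = -4δ.
  have hlk : l * (k / η) ≤ η := by
    rw [hl', hk, hηdef, ← Real.exp_sub, ← Real.exp_add]
    refine Real.exp_le_exp.mpr ?_
    have : R = t * r * Real.log 2 - 8 * δ := by
      rw [hδ]
      ring
    rw [this]
    have : 0 ≤ δ * n := by positivity
    nlinarith
  have hlogX : Real.log (Fintype.card (X n) * (1 - η)⁻¹) ≤ D * n + 1 := by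
    have h1 : 0 < (1 - η)⁻¹ := inv_pos.mpr (by linarith)
    rw [Real.log_mul hcX.ne' h1.ne']
    have h2 := Real.log_le_sub_one_of_pos h1
    linarith
  have hηβ : η ≤ Real.exp (-(β * n)) :=
    Real.exp_le_exp.mpr (neg_le_neg (mul_le_mul_of_nonneg_right (min_le_left _ _)
      (Nat.cast_nonneg _)))
  have hεβ : ε ≤ Real.exp (-(β * n)) :=
    Real.exp_le_exp.mpr (neg_le_neg (mul_le_mul_of_nonneg_right (min_le_right _ _)
      (Nat.cast_nonneg _)))
  have hD0 : 0 ≤ D * n := by positivity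
  have htot : (1 - η)⁻¹ - 1 + l * (k / η) + ε * (2 + Real.log (Fintype.card (X n) * (1 - η)⁻¹)) ≤
      Real.exp (-(β / 2 * n)) * Real.log 2 := by
    have h1 : ε * (2 + Real.log (Fintype.card (X n) * (1 - η)⁻¹)) ≤ ε * (3 + D * n) :=
      mul_le_mul_of_nonneg_left (by linarith) (Real.exp_pos _).le
    have h2 : ε * (3 + D * n) ≤ Real.exp (-(β * n)) * (3 + D * n) :=
      mul_le_mul_of_nonneg_right hεβ (by linarith)
    have h3 : Real.exp (-(β * n)) = Real.exp (-(β / 2 * n)) * Real.exp (-(β / 2 * n)) := by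
      rw [← Real.exp_add]
      congr 1
      ring
    have h4 : Real.exp (-(β * n)) * (7 + D * n) ≤ Real.exp (-(β / 2 * n)) * Real.log 2 := by
      rw [h3, mul_assoc]
      refine mul_le_mul_of_nonneg_left ?_ (Real.exp_pos _).le
      linarith
    have h5 : 0 < Real.exp (-(β * n)) := Real.exp_pos _
    nlinarith
  have hfinal := hmain.trans (ENNReal.ofReal_le_ofReal htot)
  rw [ENNReal.ofReal_mul (Real.exp_pos _).le] at hfinal
  have h2c : (2 : ℝ) ^ (-(β / 2 / Real.log 2 * n)) = Real.exp (-(β / 2 * n)) := by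
    rw [Real.rpow_def_of_pos two_pos]
    congr 1
    field_simp
  rw [h2c]
  exact (ENNReal.mul_le_mul_iff_left ofReal_log_two_ne_zero ENNReal.ofReal_ne_top).mp hfinal

end Exponent

end Wiretap

namespace Wiretap

/-! ### Seed reuse for modular schemes with exponentially small leakage -/

section ModularError

variable {S X K A Y : Type*} [Fintype X] [MeasurableSpace Y]

/-- If the error-correcting code decodes the randomly chosen x correctly, then f(s,x) = m is
recovered. -/
theorem modular_err_le (f : BRI S X K) (C : ErrCode X A Y) (T : Channel A Y) :
    (modular f C).err T ≤ C.err T := by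
  refine iSup₂_le fun s m => ?_
  have hE : MeasurableSet {y | (modular f C).dec s y ≠ some m} :=
    ((modular f C).measurable_dec s m).compl
  change (output ((f.randInv s m).bind C.enc) T : Measure Y)
    {y | (modular f C).dec s y ≠ some m} ≤ _
  rw [output_bind, output_apply _ _ hE]
  refine (ENNReal.tsum_le_tsum (g := fun x => f.randInv s m x * C.err T) fun x => ?_).trans_eq
    (by rw [ENNReal.tsum_mul_right, PMF.tsum_coe, one_mul])
  by_cases hx : f.randInv s m x = 0
  · simp [hx]
  gcongr
  have hfx : f.toFun s x = m.1 := by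
    have h := (PMF.mem_support_uniformOfFinset_iff (f.fiber_nonempty s m) x).mp
      ((PMF.mem_support_iff _ _).mpr hx)
    simpa using h
  refine (measure_mono fun y hy => ?_).trans
    (le_iSup (fun x => (output (C.enc x) T : Measure Y) {y | C.dec y ≠ x}) x)
  intro hd
  refine hy ?_
  have h1 : f.toFun s (C.dec y) = m.1 := by rw [hd, hfx]
  have h2 : f.toFun s (C.dec y) ∈ f.regSet := h1 ▸ m.2
  simp only [modular, dif_pos h2]
  exact congrArg some (Subtype.ext h1)

theorem ErrCode.restrict_err_le {X X' A Y : Type*} [MeasurableSpace Y] [Finite X'] (C : ErrCode X' A Y) {ι : X → X'}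
    {ρ : X' → X} (h : Function.LeftInverse ρ ι) (T : Channel A Y) :
    (C.restrict ι ρ).err T ≤ C.err T := by
  refine iSup_le fun x => (measure_mono fun y hy => ?_).trans
    (le_iSup (fun x => (output (C.enc x) T : Measure Y) {y | C.dec y ≠ x}) (ι x))
  intro hd
  exact hy (by simp [ErrCode.restrict, hd, h x])

theorem ErrCode.InputsIn.modular {C : ErrCode X A Y} {B : Set A} (h : C.InputsIn B)
    (f : BRI S X K) : (modular f C).InputsIn B := by
  intro s m a ha
  change a ∈ ((f.randInv s m).bind C.enc).support at ha
  rw [PMF.support_bind, Set.mem_iUnion₂] at ha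
  obtain ⟨x, -, hx⟩ := ha
  exact h x hx

theorem seedReuse_inputsIn [Fintype S] [Nonempty S] {n : ℕ} {f : BRI S X K}
    {C : ErrCode X (Fin n → A) (Fin n → Y)} {B : Set (Fin n → A)} (h : C.InputsIn B)
    (σ : S → X) (τ : X → S) (N : ℕ) {B' : Set (Fin ((N + 1) * n) → A)}
    (hB : ∀ b : Fin (N + 1) → Fin n → A, (∀ j, b j ∈ B) → joinBlocks b ∈ B') :
    (seedReuse f C σ τ N).InputsIn B' := by
  intro u m a ha
  change a ∈ ((PMF.uniformOfFintype S).bind fun s =>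
    (prodPMF (Fin.cons (C.enc (σ s)) fun j => (Wiretap.modular f C).enc s (m j) :
      Fin (N + 1) → PMF (Fin n → A))).map joinBlocks).support at ha
  rw [PMF.support_bind, Set.mem_iUnion₂] at ha
  obtain ⟨s, -, hs⟩ := ha
  rw [PMF.support_map] at hs
  obtain ⟨b, hb, rfl⟩ := hs
  refine hB b fun j => ?_
  rw [PMF.mem_support_iff, prodPMF_apply] at hb
  have hj := Finset.prod_ne_zero_iff.mp hb j (Finset.mem_univ j)
  revert hj
  refine Fin.cases ?_ (fun j => ?_) j
  · intro hj
    exact h (σ s) ((PMF.mem_support_iff _ _).mpr hj)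
  · intro hj
    exact h.modular f s (m j) ((PMF.mem_support_iff _ _).mpr hj)

end ModularError

/-! ### The number of seed reuses -/

section Sequences

theorem exists_tendsto_atTop_mul_tendsto_zero {e : ℕ → ℝ≥0∞} (he : Tendsto e atTop (𝓝 0)) :
    ∃ N : ℕ → ℕ, Tendsto N atTop atTop ∧ Tendsto (fun n => (N n : ℝ≥0∞) * e n) atTop (𝓝 0) := by
  -- The summand 1/(n+1) makes d positive even where e vanishes, so that N = ⌊d^(-1/2)⌋ tends to
  -- infinity; then N e ≤ d^(1/2) eventually.
  set d : ℕ → ℝ := fun n => (e n).toReal + 1 / ((n : ℝ) + 1) with hd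
  have hd0 : ∀ n, 0 < d n := fun n => add_pos_of_nonneg_of_pos ENNReal.toReal_nonneg (by positivity)
  have hdt : Tendsto d atTop (𝓝 0) := by
    have h1 := (ENNReal.tendsto_toReal ENNReal.zero_ne_top).comp he
    simpa [hd, Function.comp_def] using h1.add tendsto_one_div_add_atTop_nhds_zero_nat
  have hst : Tendsto (fun n => √(d n)) atTop (𝓝 0) := by
    simpa [Function.comp_def] using (Real.continuous_sqrt.tendsto 0).comp hdt
  have hst' : Tendsto (fun n => √(d n)) atTop (𝓝[>] 0) :=
    tendsto_nhdsWithin_iff.mpr ⟨hst, Eventually.of_forall fun n => Real.sqrt_pos.mpr (hd0 n)⟩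
  refine ⟨fun n => ⌊(√(d n))⁻¹⌋₊, tendsto_nat_floor_atTop.comp hst'.inv_tendsto_nhdsGT_zero, ?_⟩
  have hlim : Tendsto (fun n => ENNReal.ofReal √(d n)) atTop (𝓝 0) := by
    simpa [Function.comp_def] using (ENNReal.continuous_ofReal.tendsto 0).comp hst
  refine tendsto_of_tendsto_of_tendsto_of_le_of_le' tendsto_const_nhds hlim
    (Eventually.of_forall fun _ => zero_le) ?_
  filter_upwards [he.eventually (gt_mem_nhds ENNReal.zero_lt_top)] with n hn
  have hs := Real.sqrt_pos.mpr (hd0 n)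
  rw [← ENNReal.ofReal_natCast, ← ENNReal.ofReal_toReal hn.ne, ← ENNReal.ofReal_mul (by positivity)]
  refine ENNReal.ofReal_le_ofReal ?_
  calc (⌊(√(d n))⁻¹⌋₊ : ℝ) * (e n).toReal ≤ (√(d n))⁻¹ * d n := by
        refine mul_le_mul (Nat.floor_le (inv_nonneg.mpr hs.le)) ?_ ENNReal.toReal_nonneg
          (inv_nonneg.mpr hs.le)
        simp only [hd]
        have : (0 : ℝ) ≤ 1 / ((n : ℝ) + 1) := by positivity
        linarith
    _ = √(d n) := by
        rw [inv_mul_eq_div, Real.div_sqrt]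

/-- The product tends to zero because x log x does. Eventual positivity is essential: `Real.logb`
vanishes at 0, and the floor would then be 0. -/
theorem tendsto_floor_neg_logb {e : ℕ → ℝ≥0∞} (he : Tendsto e atTop (𝓝 0))
    (hpos : ∀ᶠ n in atTop, 0 < e n) :
    Tendsto (fun n => ⌊-Real.logb 2 (e n).toReal⌋₊) atTop atTop ∧
      Tendsto (fun n => (⌊-Real.logb 2 (e n).toReal⌋₊ : ℝ≥0∞) * e n) atTop (𝓝 0) := by
  have hlog2 : 0 < Real.log 2 := Real.log_pos one_lt_two
  have h1 : Tendsto (fun n => (e n).toReal) atTop (𝓝 0) := by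
    simpa [Function.comp_def] using (ENNReal.tendsto_toReal ENNReal.zero_ne_top).comp he
  have hlt := he.eventually (gt_mem_nhds (show (0 : ℝ≥0∞) < 1 from zero_lt_one))
  have h2 : Tendsto (fun n => (e n).toReal) atTop (𝓝[>] 0) := by
    refine tendsto_nhdsWithin_iff.mpr ⟨h1, ?_⟩
    filter_upwards [hpos, hlt] with n hn hn' using
      ENNReal.toReal_pos hn.ne' (hn'.trans ENNReal.one_lt_top).ne
  constructor
  · refine tendsto_nat_floor_atTop.comp ?_
    refine tendsto_neg_atBot_atTop.comp ?_
    exact (Real.tendsto_log_nhdsGT_zero.comp h2).atBot_div_const hlog2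
  · have h3 : Tendsto (fun n => (e n).toReal * Real.log (e n).toReal) atTop (𝓝 0) := by
      simpa [Function.comp_def] using (Real.continuous_mul_log.tendsto 0).comp h1
    have h4 : Tendsto (fun n => ENNReal.ofReal (-((e n).toReal * Real.log (e n).toReal) /
        Real.log 2)) atTop (𝓝 0) := by
      simpa [Function.comp_def] using (ENNReal.continuous_ofReal.tendsto _).comp (h3.neg.div_const (Real.log 2))
    refine tendsto_of_tendsto_of_tendsto_of_le_of_le' tendsto_const_nhds h4
      (Eventually.of_forall fun _ => zero_le) ?_
    filter_upwards [hlt] with n hn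
    have hn1 : (e n).toReal ≤ 1 := by
      simpa using ENNReal.toReal_mono ENNReal.one_ne_top hn.le
    rw [← ENNReal.ofReal_natCast]
    conv_lhs => rw [← ENNReal.ofReal_toReal (hn.trans ENNReal.one_lt_top).ne]
    rw [ENNReal.toReal_ofReal ENNReal.toReal_nonneg, ← ENNReal.ofReal_mul (by positivity)]
    refine ENNReal.ofReal_le_ofReal ?_
    have h5 : 0 ≤ -Real.logb 2 (e n).toReal :=
      neg_nonneg.mpr (Real.logb_nonpos one_lt_two ENNReal.toReal_nonneg hn1)
    refine (mul_le_mul_of_nonneg_right (Nat.floor_le h5) ENNReal.toReal_nonneg).trans_eq ?_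
    rw [Real.logb]
    ring

/-- A logarithmic number of repetitions keeps an exponentially small quantity exponentially
small. -/
theorem floor_neg_logb_mul_le {e x : ℝ≥0∞} (he : e < 1) (hxe : x ≤ e) {y : ℝ} (hy : 0 ≤ y)
    (hx : x ≤ ENNReal.ofReal y) :
    (⌊-Real.logb 2 e.toReal⌋₊ : ℝ≥0∞) * x ≤ ENNReal.ofReal (4 * √y) := by
  have hlog2 : 1 / 2 < Real.log 2 := by
    have := Real.log_two_gt_d9
    linarith
  have hef := (he.trans ENNReal.one_lt_top).ne
  have hxf : x ≠ ∞ := (hxe.trans_lt (he.trans ENNReal.one_lt_top)).ne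
  rcases eq_or_ne x 0 with h0 | h0
  · simp [h0]
  have hx0 : 0 < x.toReal := ENNReal.toReal_pos h0 hxf
  have hxe' : x.toReal ≤ e.toReal := ENNReal.toReal_mono hef hxe
  have hxy : x.toReal ≤ y := ENNReal.toReal_le_of_le_ofReal hy hx
  have he1 : e.toReal ≤ 1 := by simpa using ENNReal.toReal_mono ENNReal.one_ne_top he.le
  rw [← ENNReal.ofReal_natCast]
  conv_lhs => rw [← ENNReal.ofReal_toReal hxf]
  rw [← ENNReal.ofReal_mul (by positivity)]
  refine ENNReal.ofReal_le_ofReal ?_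
  have h5 : 0 ≤ -Real.logb 2 e.toReal :=
    neg_nonneg.mpr (Real.logb_nonpos one_lt_two ENNReal.toReal_nonneg he1)
  have hs : 0 < √x.toReal := Real.sqrt_pos.mpr hx0
  -- Since x ≤ e, the logarithm of e may be replaced by that of x, so the decay of e itself is
  -- irrelevant. Then -log x = 2 log(x^(-1/2)) ≤ 2(x^(-1/2) - 1), and dividing by log 2 > 1/2 gives
  -- the factor 4.
  have h6 : -Real.logb 2 e.toReal ≤ 4 * (√x.toReal)⁻¹ := by
    have h7 := Real.log_le_sub_one_of_pos (inv_pos.mpr hs)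
    rw [Real.log_inv, Real.log_sqrt hx0.le] at h7
    have h8 : Real.log x.toReal ≤ Real.log e.toReal := Real.log_le_log hx0 hxe'
    rw [Real.logb, ← neg_div, div_le_iff₀ (by linarith)]
    have h9 : 0 < (√x.toReal)⁻¹ := inv_pos.mpr hs
    nlinarith
  calc (⌊-Real.logb 2 e.toReal⌋₊ : ℝ) * x.toReal ≤ 4 * (√x.toReal)⁻¹ * x.toReal :=
        mul_le_mul_of_nonneg_right ((Nat.floor_le h5).trans h6) hx0.le
    _ = 4 * √x.toReal := by rw [mul_assoc, inv_mul_eq_div, Real.div_sqrt]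
    _ ≤ 4 * √y := by gcongr

end Sequences

/-! ### From exponentially small leakage to achievability -/

section Achieves

/-- The two limits are multiplied and log|X| cancels; it is eventually nonzero because r > 0. -/
theorem IsGoodSequence.tendsto_rate {S X K : ℕ → Type*} [∀ n, Fintype (X n)]
    {f : ∀ n, BRI (S n) (X n) (K n)} {r t : ℝ}
    (hf : IsGoodSequence f r t) (hr : 0 < r) :
    Tendsto (fun n => rate (f n).Msg n) atTop (𝓝 ((1 - t) * r)) := by
  refine (hf.2.1.mul hf.1).congr' ?_
  filter_upwards [hf.1.eventually (lt_mem_nhds hr)] with n hn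
  have h0 : Real.logb 2 (Fintype.card (X n)) ≠ 0 := by
    intro h
    rw [h, zero_div] at hn
    exact hn.false
  rw [rate, Fintype.card_coe]
  field_simp

variable {A Y Z : Type*} [MeasurableSpace Y] [MeasurableSpace Z]
  {S : ℕ → Type*} {X : ℕ → Type*} {K : ℕ → Type*}
  [∀ n, Fintype (S n)] [∀ n, Nonempty (S n)] [∀ n, Fintype (X n)]

/-- The channel enters only through `hperm`, `herr` and `hleak`; the rest follows from the
single-code bounds. The rate loses the factor N/(N+1), which tends to 1. -/
theorem WiretapChannel.seedReuseAchieves_of_leak (ch : WiretapChannel A Y Z)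
    {f : ∀ n, BRI (S n) (X n) (K n)} {r t : ℝ} (hf : IsGoodSequence f r t) (hr : 0 < r)
    {σ : ∀ n, S n → X n} {τ : ∀ n, X n → S n} (hτ : ∀ n, Function.LeftInverse (τ n) (σ n))
    (C : ∀ n, ErrCode (X n) (Fin n → A) (Fin n → Y))
    (hin : ∀ n, (C n).InputsIn (ch.permissible n))
    (hperm : ∀ (k n : ℕ) (b : Fin k → Fin n → A), (∀ j, b j ∈ ch.permissible n) →
      joinBlocks b ∈ ch.permissible (k * n))
    (herr : Tendsto (fun n => (C n).err (ch.T.pow n)) atTop (𝓝 0))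
    (hleak : ∃ c : ℝ, 0 < c ∧ ∀ᶠ n : ℕ in atTop, (modular (f n) (C n)).leak (ch.U.pow n) ≤
      ENNReal.ofReal ((2 : ℝ) ^ (-(c * (n : ℝ))))) :
    ch.SeedReuseAchieves f C σ τ ((1 - t) * r) := by
  obtain ⟨c, hc, hleak⟩ := hleak
  have hexp : Tendsto (fun n : ℕ => ENNReal.ofReal ((2 : ℝ) ^ (-(c * (n : ℝ))))) atTop (𝓝 0) := by
    have h1 : Tendsto (fun n : ℕ => (2 : ℝ) ^ (-(c * (n : ℝ)))) atTop (𝓝 0) :=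
      (tendsto_rpow_atBot_of_base_gt_one 2 one_lt_two).comp
        (tendsto_neg_atTop_atBot.comp (tendsto_natCast_atTop_atTop.const_mul_atTop hc))
    simpa [Function.comp_def] using (ENNReal.continuous_ofReal.tendsto 0).comp h1
  have hmax : Tendsto (ch.schemeMax f C) atTop (𝓝 0) := by
    have h1 : Tendsto (fun n => (modular (f n) (C n)).err (ch.T.pow n)) atTop (𝓝 0) :=
      tendsto_of_tendsto_of_tendsto_of_le_of_le tendsto_const_nhds herr (fun _ => zero_le)
        fun n => modular_err_le (f n) (C n) (ch.T.pow n)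
    have h2 : Tendsto (fun n => (modular (f n) (C n)).leak (ch.U.pow n)) atTop (𝓝 0) :=
      tendsto_of_tendsto_of_tendsto_of_le_of_le' tendsto_const_nhds hexp
        (Eventually.of_forall fun _ => zero_le) hleak
    have h3 := h1.max h2
    rwa [max_self] at h3
  have hRleak : ∀ N : ℕ → ℕ, ∀ n,
      (seedReuse (f n) (C n) (σ n) (τ n) (N n)).leak (ch.U.pow ((N n + 1) * n)) ≤
        (N n : ℝ≥0∞) * (modular (f n) (C n)).leak (ch.U.pow n) := fun N n =>
    seedReuse_leak_le ch.U (N n) (f n) (C n) (σ n) (τ n)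
  refine ⟨exists_tendsto_atTop_mul_tendsto_zero hmax, ⟨c, hc, fun N hN => ⟨⟨?_, ?_, ?_, ?_⟩, ?_⟩⟩,
    fun hpos => ⟨tendsto_floor_neg_logb hmax hpos, c / 4, by positivity, ?_⟩⟩
  · exact fun n => seedReuse_inputsIn (hin n) (σ n) (τ n) (N n) (hperm (N n + 1) n)
  · have h1 : Tendsto (fun n => rate (Fin (N n) → (f n).Msg) ((N n + 1) * n)) atTop
        (𝓝 ((1 - t) * r)) := by
      have h2 := ((tendsto_natCast_div_add_atTop (1 : ℝ)).comp hN.1).mul (hf.tendsto_rate hr)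
      rw [one_mul] at h2
      exact h2.congr fun n => (rate_fun _ _).symm
    exact ((continuous_coe_real_ereal.tendsto _).comp h1).liminf_eq.ge
  · refine tendsto_of_tendsto_of_tendsto_of_le_of_le tendsto_const_nhds
      (by simpa using herr.add hN.2) (fun _ => zero_le) fun n => ?_
    refine (seedReuse_err_le ch.T (N n) (f n) (C n) (σ n) (τ n) (hτ n)).trans ?_
    gcongr
    exact le_max_left _ _
  · refine tendsto_of_tendsto_of_tendsto_of_le_of_le tendsto_const_nhds hN.2
      (fun _ => zero_le) fun n => (hRleak N n).trans ?_
    gcongr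
    exact le_max_right _ _
  · filter_upwards [hleak] with n hn
    refine (hRleak N n).trans ?_
    gcongr
  · have h4 : ∀ᶠ n : ℕ in atTop, (4 : ℝ) ≤ (2 : ℝ) ^ (c / 4 * (n : ℝ)) :=
      ((tendsto_rpow_atTop_of_base_gt_one 2 one_lt_two).comp
        (tendsto_natCast_atTop_atTop.const_mul_atTop (by positivity))).eventually_ge_atTop 4
    filter_upwards [hleak, hmax.eventually (gt_mem_nhds (show (0 : ℝ≥0∞) < 1 from zero_lt_one)), h4]
      with n hn hn1 hn4
    refine (hRleak (ch.logChoice f C) n).trans ((floor_neg_logb_mul_le hn1 (le_max_right _ _)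
      (Real.rpow_nonneg two_pos.le _) hn).trans (ENNReal.ofReal_le_ofReal ?_))
    have h5 : √((2 : ℝ) ^ (-(c * (n : ℝ)))) = (2 : ℝ) ^ (-(c / 2 * (n : ℝ))) := by
      rw [Real.sqrt_eq_rpow, ← Real.rpow_mul two_pos.le]
      congr 1
      ring
    rw [h5]
    calc 4 * (2 : ℝ) ^ (-(c / 2 * (n : ℝ))) ≤
          (2 : ℝ) ^ (c / 4 * (n : ℝ)) * (2 : ℝ) ^ (-(c / 2 * (n : ℝ))) := by gcongr
      _ = _ := by
          rw [← Real.rpow_add two_pos]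
          congr 1
          ring

end Achieves

end Wiretap

namespace Wiretap

open InformationTheory

/-! ### Discrete channels -/

section Mix

variable {A Z : Type*} [MeasurableSpace Z]

/-- The mixture `(1 - θ) P + θ P'`. -/
noncomputable def mixPMF (θ : ℝ≥0∞) (hθ : θ ≤ 1) (P P' : PMF A) : PMF A :=
  ⟨fun a => (1 - θ) * P a + θ * P' a, by
    rw [ENNReal.summable.hasSum_iff, ENNReal.tsum_add, ENNReal.tsum_mul_left, ENNReal.tsum_mul_left,
      P.tsum_coe, P'.tsum_coe, mul_one, mul_one, tsub_add_cancel_of_le hθ]⟩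

theorem mixPMF_apply (θ : ℝ≥0∞) (hθ : θ ≤ 1) (P P' : PMF A) (a : A) :
    mixPMF θ hθ P P' a = (1 - θ) * P a + θ * P' a := rfl

theorem tsum_mixPMF_mul (θ : ℝ≥0∞) (hθ : θ ≤ 1) (P P' : PMF A) (F : A → ℝ≥0∞) :
    ∑' a, mixPMF θ hθ P P' a * F a = (1 - θ) * ∑' a, P a * F a + θ * ∑' a, P' a * F a := by
  simp_rw [mixPMF_apply, add_mul, mul_assoc]
  rw [ENNReal.tsum_add, ENNReal.tsum_mul_left, ENNReal.tsum_mul_left]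

theorem output_mixPMF_apply (θ : ℝ≥0∞) (hθ : θ ≤ 1) (P P' : PMF A) (U : Channel A Z) {s : Set Z}
    (hs : MeasurableSet s) :
    (output (mixPMF θ hθ P P') U : Measure Z) s =
      (1 - θ) * (output P U : Measure Z) s + θ * (output P' U : Measure Z) s := by
  rw [output_apply _ _ hs, output_apply _ _ hs, output_apply _ _ hs, tsum_mixPMF_mul]

theorem le_output_uniform [Fintype A] [Nonempty A] (U : Channel A Z) (a : A) {s : Set Z}
    (hs : MeasurableSet s) :
    (Fintype.card A : ℝ≥0∞)⁻¹ * (U a : Measure Z) s ≤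
      (output (PMF.uniformOfFintype A) U : Measure Z) s := by
  rw [output_apply _ _ hs, ← PMF.uniformOfFintype_apply a]
  exact ENNReal.le_tsum a

theorem le_ofReal_smul_of_mul_le {μ ν : Measure Z} {c : ℝ} (hc : 0 < c)
    (h : ∀ s, MeasurableSet s → ENNReal.ofReal c * μ s ≤ ν s) :
    μ ≤ ENNReal.ofReal c⁻¹ • ν := by
  refine Measure.le_iff.mpr fun s hs => ?_
  rw [Measure.smul_apply, smul_eq_mul]
  calc μ s = ENNReal.ofReal c⁻¹ * (ENNReal.ofReal c * μ s) := by
        rw [← mul_assoc, ← ENNReal.ofReal_mul (inv_nonneg.mpr hc.le), inv_mul_cancel₀ hc.ne',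
          ENNReal.ofReal_one, one_mul]
    _ ≤ _ := mul_le_mul_right (h s hs) _

/-- A reference output distribution from which no channel output distribution diverges by more
than the capacity, up to `ε`. -/
theorem exists_klDiv_le_capacity [Fintype A] [Nonempty A] (U : Channel A Z)
    (hC : (⨆ P : PMF A, mutualInfo P U) ≠ ∞) {ε : ℝ} (hε : 0 < ε) :
    ∃ Q : ProbabilityMeasure Z, ∀ a, (U a : Measure Z) ≪ (Q : Measure Z) ∧
      klDiv (U a : Measure Z) (Q : Measure Z) ≤
        (⨆ P : PMF A, mutualInfo P U) * ENNReal.ofReal (Real.log 2) + ENNReal.ofReal ε := by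
  set c := (⨆ P : PMF A, mutualInfo P U) * ENNReal.ofReal (Real.log 2) with hc
  have hct : c ≠ ∞ := ENNReal.mul_ne_top hC ENNReal.ofReal_ne_top
  have hcle : ∀ P : PMF A, mutualInfo P U * ENNReal.ofReal (Real.log 2) ≤ c := fun P =>
    mul_le_mul_left (le_iSup (fun P : PMF A => mutualInfo P U) P) _
  -- θ is the weight of the uniform law in the common reference: θ ≤ 1/2 and θ ≤ ε/4 give log (1 -
  -- θ)⁻¹ ≤ 2θ ≤ ε/2. The weight η = θ/|A| of a single letter is what lets the perturbed law be
  -- dominated by that reference.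
  set θ : ℝ := min (1 / 2) (ε / 4) with hθ
  have hθ0 : 0 < θ := by positivity
  have hθ2 : θ ≤ 1 / 2 := min_le_left _ _
  have hθε : θ ≤ ε / 4 := min_le_right _ _
  have hcA : (0 : ℝ) < Fintype.card A := Nat.cast_pos.mpr Fintype.card_pos
  have hcA1 : (1 : ℝ) ≤ Fintype.card A := by exact_mod_cast hcA
  set η : ℝ := θ / Fintype.card A with hη
  have hη0 : 0 < η := by positivity
  have hηθ : η ≤ θ := div_le_self hθ0.le hcA1
  have hθe : ENNReal.ofReal θ ≤ 1 := ENNReal.ofReal_le_one.mpr (by linarith)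
  have hηe : ENNReal.ofReal η ≤ 1 := ENNReal.ofReal_le_one.mpr (by linarith)
  -- A near-maximizer suffices. Its deficit must be small compared with η because the estimate for a
  -- single letter is divided by η below.
  obtain ⟨P, hP⟩ : ∃ P : PMF A,
      c ≤ mutualInfo P U * ENNReal.ofReal (Real.log 2) + ENNReal.ofReal (η * (ε / 2)) := by
    by_contra! h
    have h1 : c ≤ c - ENNReal.ofReal (η * (ε / 2)) := by
      conv_lhs => rw [hc, ENNReal.iSup_mul]
      exact iSup_le fun P => ENNReal.le_sub_of_add_le_right ENNReal.ofReal_ne_top (h P).le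
    have h2 : c ≠ 0 := (zero_le.trans_lt (h (PMF.uniformOfFintype A))).ne'
    exact absurd h1 (not_le.mpr (ENNReal.sub_lt_self hct h2 (by simp; positivity)))
  refine ⟨output (mixPMF (ENNReal.ofReal θ) hθe P (PMF.uniformOfFintype A)) U, fun a => ?_⟩
  set Q := output (mixPMF (ENNReal.ofReal θ) hθe P (PMF.uniformOfFintype A)) U with hQ
  set Pa := mixPMF (ENNReal.ofReal η) hηe P (PMF.pure a) with hPa
  have hηa : ENNReal.ofReal η = ENNReal.ofReal θ * (Fintype.card A : ℝ≥0∞)⁻¹ := by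
    rw [hη, ENNReal.ofReal_div_of_pos hcA, ENNReal.ofReal_natCast, div_eq_mul_inv]
  have hUQ : ∀ s, MeasurableSet s → ENNReal.ofReal η * (U a : Measure Z) s ≤ (Q : Measure Z) s := by
    intro s hs
    rw [hQ, output_mixPMF_apply _ _ _ _ _ hs, hηa, mul_assoc]
    exact (mul_le_mul_right (le_output_uniform U a hs) _).trans le_add_self
  refine ⟨(Measure.absolutelyContinuous_of_le (le_ofReal_smul_of_mul_le hη0 hUQ)).trans
    Measure.smul_absolutelyContinuous, ?_⟩
  -- Both inputs contain P; the letter a has weight η in one and weight at least θ/|A| = η in the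
  -- other, so the outputs compare up to the factor (1 - θ)⁻¹.
  have hQa : (output Pa U : Measure Z) ≤ ENNReal.ofReal (1 - θ)⁻¹ • (Q : Measure Z) := by
    refine le_ofReal_smul_of_mul_le (by linarith) fun s hs => ?_
    have h1 : ENNReal.ofReal (1 - θ) = 1 - ENNReal.ofReal θ := by
      rw [ENNReal.ofReal_sub _ hθ0.le, ENNReal.ofReal_one]
    have h2 : (output (PMF.pure a) U : Measure Z) s = (U a : Measure Z) s := by
      rw [output_apply _ _ hs, tsum_pure_mul]
    rw [hPa, hQ, output_mixPMF_apply _ _ _ _ _ hs, output_mixPMF_apply _ _ _ _ _ hs, h2, h1,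
      mul_add]
    refine add_le_add ?_ ?_
    · rw [← mul_assoc]
      gcongr
      exact mul_le_of_le_one_right zero_le tsub_le_self
    · rw [hηa]
      calc (1 - ENNReal.ofReal θ) *
            (ENNReal.ofReal θ * (Fintype.card A : ℝ≥0∞)⁻¹ * (U a : Measure Z) s) ≤
            1 * (ENNReal.ofReal θ * (Fintype.card A : ℝ≥0∞)⁻¹ * (U a : Measure Z) s) := by
            gcongr
            exact tsub_le_self
        _ ≤ _ := by
            rw [one_mul, mul_assoc]
            gcongr
            exact le_output_uniform U a hs
  have hinv : 1 ≤ (1 - θ)⁻¹ := (one_le_inv₀ (by linarith)).mpr (by linarith)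
  have hlog : Real.log (1 - θ)⁻¹ ≤ ε / 2 := by
    have h1 : (1 - θ)⁻¹ ≤ 1 + 2 * θ := by
      rw [inv_le_iff_one_le_mul₀ (by linarith)]
      nlinarith
    have h2 := Real.log_le_sub_one_of_pos (zero_lt_one.trans_le hinv)
    linarith
  have hKL : klDiv (U a : Measure Z) (output Pa U : Measure Z) ≤ c + ENNReal.ofReal (ε / 2) := by
    have h1 := (mutualInfo_mul_log Pa U).symm.trans_le (hcle Pa)
    rw [hPa, tsum_mixPMF_mul, tsum_pure_mul, ← hPa] at h1
    have h2 := mutualInfo_mul_log_le P U (output Pa U)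
    set K := klDiv (U a : Measure Z) (output Pa U : Measure Z)
    set i := mutualInfo P U * ENNReal.ofReal (Real.log 2)
    have hit : i ≠ ∞ := ((hcle P).trans_lt hct.lt_top).ne
    -- Moving P slightly towards the letter a cannot raise the information above c. Its information
    -- is (1 - η) times a P-average of divergences, at least i by the choice of reference, plus η K.
    -- With i nearly c, comparison gives K ≤ c + ε/2.
    have h3 : (1 - ENNReal.ofReal η) * i + ENNReal.ofReal η * K ≤
        (1 - ENNReal.ofReal η) * i + ENNReal.ofReal η * (c + ENNReal.ofReal (ε / 2)) := by
      calc _ ≤ c := by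
            refine le_trans ?_ h1
            gcongr
        _ = (1 - ENNReal.ofReal η) * c + ENNReal.ofReal η * c := by
            rw [← add_mul, tsub_add_cancel_of_le hηe, one_mul]
        _ ≤ (1 - ENNReal.ofReal η) * (i + ENNReal.ofReal (η * (ε / 2))) + ENNReal.ofReal η * c := by
            gcongr
        _ ≤ (1 - ENNReal.ofReal η) * i + ENNReal.ofReal (η * (ε / 2)) + ENNReal.ofReal η * c := by
            rw [mul_add]
            gcongr
            exact mul_le_of_le_one_left zero_le tsub_le_self
        _ = _ := by
            rw [ENNReal.ofReal_mul hη0.le]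
            ring
    have h4 := (ENNReal.add_le_add_iff_left
      (ENNReal.mul_ne_top (ENNReal.sub_ne_top ENNReal.one_ne_top) hit)).mp h3
    exact (ENNReal.mul_le_mul_iff_right (by simpa using hη0) ENNReal.ofReal_ne_top).mp h4
  calc klDiv (U a : Measure Z) (Q : Measure Z) ≤
        klDiv (U a : Measure Z) (output Pa U : Measure Z) + ENNReal.ofReal (Real.log (1 - θ)⁻¹) :=
        klDiv_le_add_log _ _ _ hinv hQa
    _ ≤ c + ENNReal.ofReal (ε / 2) + ENNReal.ofReal (ε / 2) := by gcongr
    _ = c + ENNReal.ofReal ε := by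
        rw [add_assoc, ← ENNReal.ofReal_add (by positivity) (by positivity), add_halves]

end Mix

/-! ### Information densities on finite alphabets -/

section Discrete

variable {A Z : Type*} [Fintype A] [Fintype Z] [MeasurableSpace Z] [DiscreteMeasurableSpace Z]

/-- The exponential moments of the information density are governed by the divergence. -/
theorem exists_lintegral_rpow_le (U : Channel A Z) (Q : Measure Z) [IsProbabilityMeasure Q]
    (hU : ∀ a, (U a : Measure Z) ≪ Q) {δ : ℝ} (hδ : 0 < δ) :
    ∃ α > 0, ∀ a, ∫⁻ z, ENNReal.ofReal (((U a : Measure Z).rnDeriv Q z).toReal ^ α)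
        ∂(U a : Measure Z) ≤
      ENNReal.ofReal (Real.exp (α * ((klDiv (U a : Measure Z) Q).toReal + δ))) := by
  -- A common bound for all log-likelihood ratios, finite because both alphabets are; the summand 1
  -- keeps it positive.
  set M : ℝ := 1 + ∑ a, ∑ z, |llr (U a : Measure Z) Q z| with hM
  have hM1 : 1 ≤ M := by
    have : 0 ≤ ∑ a, ∑ z, |llr (U a : Measure Z) Q z| :=
      Finset.sum_nonneg fun a _ => Finset.sum_nonneg fun z _ => abs_nonneg _
    linarith
  have hMle : ∀ a z, |llr (U a : Measure Z) Q z| ≤ M := by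
    intro a z
    have h1 := Finset.single_le_sum (f := fun a => ∑ z, |llr (U a : Measure Z) Q z|)
      (fun a _ => Finset.sum_nonneg fun z _ => abs_nonneg _) (Finset.mem_univ a)
    have h2 := Finset.single_le_sum (f := fun z => |llr (U a : Measure Z) Q z|)
      (fun z _ => abs_nonneg _) (Finset.mem_univ z)
    exact (h2.trans h1).trans (by linarith)
  refine ⟨min M⁻¹ (δ / M ^ 2), by positivity, fun a => ?_⟩
  set α := min M⁻¹ (δ / M ^ 2) with hα
  have hα0 : 0 < α := by positivity
  have hαM : α * M ≤ 1 := by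
    rw [← le_div_iff₀ (by linarith), one_div]
    exact min_le_left _ _
  have hαδ : α * M ^ 2 ≤ δ := by
    rw [← le_div_iff₀ (by positivity)]
    exact min_le_right _ _
  set D := (klDiv (U a : Measure Z) Q).toReal with hD
  have hDi : D = ∫ z, llr (U a : Measure Z) Q z ∂(U a : Measure Z) :=
    toReal_klDiv_of_measure_eq (hU a) (by simp)
  -- For |y| ≤ 1 one has e^y ≤ 1 + y + y². Here αM ≤ 1 and (αM)² ≤ αδ, by the two terms in the
  -- minimum defining α.
  have hpt : ∀ z, Real.exp (α * llr (U a : Measure Z) Q z) ≤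
      1 + α * llr (U a : Measure Z) Q z + α * δ := by
    intro z
    have h1 : |α * llr (U a : Measure Z) Q z| ≤ α * M := by
      rw [abs_mul, abs_of_pos hα0]
      exact mul_le_mul_of_nonneg_left (hMle a z) hα0.le
    have h2 := Real.abs_exp_sub_one_sub_id_le (h1.trans hαM)
    have h3 : (α * llr (U a : Measure Z) Q z) ^ 2 ≤ (α * M) ^ 2 := sq_le_sq' (abs_le.mp h1).1
      (abs_le.mp h1).2
    have h4 := (abs_le.mp h2).2
    have h5 : (α * M) ^ 2 ≤ α * δ := by
      calc (α * M) ^ 2 = α * (α * M ^ 2) := by ring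
        _ ≤ α * δ := mul_le_mul_of_nonneg_left hαδ hα0.le
    linarith
  calc _ = ∫⁻ z, ENNReal.ofReal (Real.exp (α * llr (U a : Measure Z) Q z)) ∂(U a : Measure Z) := by
        refine lintegral_congr_ae ?_
        filter_upwards [Measure.rnDeriv_pos (hU a),
          (hU a).ae_le (Measure.rnDeriv_lt_top (U a : Measure Z) Q)] with z hz hz'
        rw [Real.rpow_def_of_pos (ENNReal.toReal_pos hz.ne' hz'.ne), mul_comm]
        rfl
    _ ≤ ∫⁻ z, ENNReal.ofReal (1 + α * llr (U a : Measure Z) Q z + α * δ) ∂(U a : Measure Z) :=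
        lintegral_mono fun z => ENNReal.ofReal_le_ofReal (hpt z)
    _ = ENNReal.ofReal (1 + α * D + α * δ) := by
        rw [← ofReal_integral_eq_lintegral_ofReal Integrable.of_finite
          (ae_of_all _ fun z => (Real.exp_pos _).le.trans (hpt z)),
          integral_add Integrable.of_finite Integrable.of_finite,
          integral_add Integrable.of_finite Integrable.of_finite, integral_const_mul, ← hDi]
        simp
    _ ≤ _ := by
        refine ENNReal.ofReal_le_ofReal ?_
        have := Real.add_one_le_exp (α * (D + δ))
        linarith

variable {S X K : ℕ → Type*} [∀ n, Fintype (X n)] [∀ n, Fintype (S n)] [∀ n, Nonempty (S n)]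
  [∀ n, Nonempty (X n)] {Y : Type*} [MeasurableSpace Y]

/-- Moments of product densities factor over the letters, so the rate of an input sequence is the
average divergence of its letters from the reference. Both discrete cases only have to bound this
average. -/
theorem exists_modular_leak_le_of_discrete {f : ∀ n, BRI (S n) (X n) (K n)} {r t : ℝ}
    (hf : IsGoodSequence f r t) (hr : 0 < r) (ht : 0 < t)
    (C : ∀ n, ErrCode (X n) (Fin n → A) (Fin n → Y)) (U : Channel A Z)
    (Q : ProbabilityMeasure Z) (hU : ∀ a, (U a : Measure Z) ≪ (Q : Measure Z)) {R : ℝ}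
    (hR : R < t * r * Real.log 2)
    (hB : ∀ᶠ n : ℕ in atTop, (C n).InputsIn
      {a | ∑ i, (klDiv (U (a i) : Measure Z) (Q : Measure Z)).toReal ≤ n * R}) :
    ∃ c : ℝ, 0 < c ∧ ∀ᶠ n : ℕ in atTop, (modular (f n) (C n)).leak (U.pow n) ≤
      ENNReal.ofReal ((2 : ℝ) ^ (-(c * (n : ℝ)))) := by
  refine exists_modular_leak_le hf hr ht C U (Q : Measure Z)
    (L := fun a z => ((U a : Measure Z).rnDeriv (Q : Measure Z) z).toReal)
    (fun a z => ENNReal.toReal_nonneg) (fun a => (Measure.measurable_rnDeriv _ _).ennreal_toReal)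
    (fun a => ?_) _ hB hR fun δ hδ => ?_
  · conv_lhs => rw [← Measure.withDensity_rnDeriv_eq _ _ (hU a)]
    refine withDensity_congr_ae ?_
    filter_upwards [Measure.rnDeriv_lt_top (U a : Measure Z) (Q : Measure Z)] with z hz
    rw [ENNReal.ofReal_toReal hz.ne]
  · obtain ⟨α, hα, h⟩ := exists_lintegral_rpow_le U (Q : Measure Z) hU hδ
    refine ⟨α, hα, fun n a ha => ?_⟩
    refine (Finset.prod_le_prod' fun i _ => h (a i)).trans ?_
    rw [← ENNReal.ofReal_prod_of_nonneg fun i _ => (Real.exp_pos _).le, ← Real.exp_sum]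
    refine ENNReal.ofReal_le_ofReal (Real.exp_le_exp.mpr ?_)
    rw [← Finset.mul_sum, Finset.sum_add_distrib, Finset.sum_const, Finset.card_univ,
      Fintype.card_fin, nsmul_eq_mul]
    have h1 := mul_le_mul_of_nonneg_left (show _ ≤ _ from ha) hα.le
    linarith

/-- With the near-capacity reference every letter satisfies the divergence bound, hence so does
every input sequence. -/
theorem exists_modular_leak_le_of_capacity_lt [Nonempty A] {f : ∀ n, BRI (S n) (X n) (K n)}
    {r t : ℝ} (hf : IsGoodSequence f r t) (hr : 0 < r) (ht : 0 < t)
    (C : ∀ n, ErrCode (X n) (Fin n → A) (Fin n → Y)) (U : Channel A Z)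
    (hcap : (⨆ P : PMF A, mutualInfo P U) < ENNReal.ofReal (t * r)) :
    ∃ c : ℝ, 0 < c ∧ ∀ᶠ n : ℕ in atTop, (modular (f n) (C n)).leak (U.pow n) ≤
      ENNReal.ofReal ((2 : ℝ) ^ (-(c * (n : ℝ)))) := by
  have hlog2 : 0 < Real.log 2 := Real.log_pos one_lt_two
  have hfin : (⨆ P : PMF A, mutualInfo P U) ≠ ∞ := (hcap.trans ENNReal.ofReal_lt_top).ne
  set I := (⨆ P : PMF A, mutualInfo P U).toReal with hI
  have hI0 : 0 ≤ I := ENNReal.toReal_nonneg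
  have hIlt : I < t * r := (ENNReal.lt_ofReal_iff_toReal_lt hfin).mp hcap
  set ε : ℝ := (t * r - I) * Real.log 2 / 2 with hε
  have hε0 : 0 < ε := by
    have : 0 < t * r - I := by linarith
    positivity
  obtain ⟨Q, hQ⟩ := exists_klDiv_le_capacity U hfin hε0
  refine exists_modular_leak_le_of_discrete hf hr ht C U Q (fun a => (hQ a).1)
    (R := I * Real.log 2 + ε) (by linarith) (Eventually.of_forall fun n x a _ => ?_)
  have hle : ∀ b, (klDiv (U b : Measure Z) (Q : Measure Z)).toReal ≤ I * Real.log 2 + ε := by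
    intro b
    refine ENNReal.toReal_le_of_le_ofReal (by positivity) ((hQ b).2.trans_eq ?_)
    rw [ENNReal.ofReal_add (by positivity) hε0.le, ENNReal.ofReal_mul hI0, hI,
      ENNReal.ofReal_toReal hfin]
  refine (Finset.sum_le_card_nsmul _ _ _ fun i _ => hle (a i)).trans_eq ?_
  rw [Finset.card_univ, Fintype.card_fin, nsmul_eq_mul]

/-- The rate loss `γ_d(δ, a, z)` for codewords of approximately constant composition. -/
noncomputable def typicalLoss (δ : ℝ) (a : ℕ) : ℝ :=
  (Real.log (1 + δ) + δ * (a * Real.log (a * (1 + δ) / δ))) / Real.log 2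

theorem tendsto_typicalLoss (a : ℕ) : Tendsto (fun δ => typicalLoss δ a) (𝓝[>] 0) (𝓝 0) := by
  rcases eq_or_ne a 0 with rfl | ha
  · have h : Tendsto (fun δ : ℝ => Real.log (1 + δ) / Real.log 2) (𝓝 0) (𝓝 0) := by
      have : ContinuousAt (fun δ : ℝ => Real.log (1 + δ) / Real.log 2) 0 := by
        refine ContinuousAt.div_const (ContinuousAt.log (by fun_prop) (by norm_num)) _
      simpa using this.tendsto
    refine (h.mono_left nhdsWithin_le_nhds).congr fun δ => ?_
    simp [typicalLoss]
  have ha0 : (0 : ℝ) < a := Nat.cast_pos.mpr (Nat.pos_of_ne_zero ha)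
  -- The only singular contribution, from log(1/δ), appears as δ log δ, which is continuous at 0.
  have h1 : ContinuousAt (fun δ : ℝ => (Real.log (1 + δ) + a * (δ * Real.log a +
      δ * Real.log (1 + δ) - δ * Real.log δ)) / Real.log 2) 0 := by
    have hlog : ContinuousAt (fun δ : ℝ => Real.log (1 + δ)) 0 :=
      ContinuousAt.log (by fun_prop) (by norm_num)
    have hm : ContinuousAt (fun δ : ℝ => δ * Real.log δ) 0 := Real.continuous_mul_log.continuousAt
    exact (hlog.add (continuousAt_const.mul (((continuousAt_id.mul continuousAt_const).add
      (continuousAt_id.mul hlog)).sub hm))).div_const _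
  have h2 := h1.tendsto.mono_left (nhdsWithin_le_nhds (s := Set.Ioi (0 : ℝ)))
  simp only [add_zero, Real.log_one, zero_mul, mul_zero, sub_zero, zero_div] at h2
  refine h2.congr' ?_
  filter_upwards [self_mem_nhdsWithin] with δ hδ
  have hδ0 : (0 : ℝ) < δ := hδ
  rw [typicalLoss, Real.log_div (by positivity) hδ0.ne', Real.log_mul ha0.ne' (by positivity)]
  ring

/-- A typical sequence has average letter divergence close to its mean under P. With the output of P
alone as reference, letters outside the support of P could have infinite divergence; mixing in the
uniform input bounds all of them, at the price of log(1 + δ). -/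
theorem exists_modular_leak_le_of_typical {f : ∀ n, BRI (S n) (X n) (K n)} {r t : ℝ}
    (hf : IsGoodSequence f r t) (hr : 0 < r) (ht : 0 < t)
    (C : ∀ n, ErrCode (X n) (Fin n → A) (Fin n → Y)) (U : Channel A Z) (P : PMF A) {δ : ℝ}
    (hδ : 0 < δ) (hin : ∀ᶠ n in atTop, (C n).InputsIn (typicalSet P δ n))
    (hI : mutualInfo P U + ((typicalLoss δ (Fintype.card A)).toNNReal : ℝ≥0∞) <
      ENNReal.ofReal (t * r)) :
    ∃ c : ℝ, 0 < c ∧ ∀ᶠ n : ℕ in atTop, (modular (f n) (C n)).leak (U.pow n) ≤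
      ENNReal.ofReal ((2 : ℝ) ^ (-(c * (n : ℝ)))) := by
  classical
  have hlog2 : 0 < Real.log 2 := Real.log_pos one_lt_two
  have : Nonempty A := P.support_nonempty.to_subtype.map Subtype.val
  have hcA : (0 : ℝ) < Fintype.card A := Nat.cast_pos.mpr Fintype.card_pos
  have hcA1 : (1 : ℝ) ≤ Fintype.card A := by exact_mod_cast hcA
  -- Chosen so that (1 - θ)⁻¹ = 1 + δ.
  set θ : ℝ := δ / (1 + δ) with hθ
  have hθ0 : 0 < θ := by positivity
  have hθ1 : θ < 1 := by
    rw [hθ, div_lt_one (by positivity)]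
    linarith
  have h1θ : (1 - θ)⁻¹ = 1 + δ := by
    rw [hθ]
    field_simp
    ring
  have hθe : ENNReal.ofReal θ ≤ 1 := ENNReal.ofReal_le_one.mpr hθ1.le
  set Q := output (mixPMF (ENNReal.ofReal θ) hθe P (PMF.uniformOfFintype A)) U with hQ
  have hPQ : (output P U : Measure Z) ≤ ENNReal.ofReal (1 + δ) • (Q : Measure Z) := by
    rw [← h1θ]
    refine le_ofReal_smul_of_mul_le (by linarith) fun s hs => ?_
    rw [hQ, output_mixPMF_apply _ _ _ _ _ hs, ENNReal.ofReal_sub _ hθ0.le, ENNReal.ofReal_one]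
    exact le_self_add
  -- The inverse of the weight θ/|A| of a letter in the uniform part of the mixture; log G bounds
  -- every letter divergence.
  set G : ℝ := Fintype.card A * (1 + δ) / δ with hG
  have hG1 : 1 ≤ G := by
    rw [hG, one_le_div hδ]
    nlinarith
  have hUQ : ∀ a, (U a : Measure Z) ≤ ENNReal.ofReal G • (Q : Measure Z) := by
    intro a
    have hGe : G = (θ / Fintype.card A)⁻¹ := by
      rw [hG, hθ]
      field_simp
    rw [hGe]
    refine le_ofReal_smul_of_mul_le (by positivity) fun s hs => ?_
    rw [hQ, output_mixPMF_apply _ _ _ _ _ hs, ENNReal.ofReal_div_of_pos hcA, ENNReal.ofReal_natCast,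
      div_eq_mul_inv, mul_assoc]
    exact (mul_le_mul_right (le_output_uniform U a hs) _).trans le_add_self
  have hac : ∀ a, (U a : Measure Z) ≪ (Q : Measure Z) := fun a =>
    (Measure.absolutelyContinuous_of_le (hUQ a)).trans Measure.smul_absolutelyContinuous
  set D : A → ℝ := fun a => (klDiv (U a : Measure Z) (Q : Measure Z)).toReal with hD
  have hDG : ∀ a, klDiv (U a : Measure Z) (Q : Measure Z) ≤ ENNReal.ofReal (Real.log G) := by
    intro a
    have h := klDiv_le_add_log (U a : Measure Z) (Q : Measure Z) (U a : Measure Z) hG1 (hUQ a)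
    rwa [klDiv_self, zero_add] at h
  have hDG' : ∀ a, D a ≤ Real.log G := fun a =>
    ENNReal.toReal_le_of_le_ofReal (Real.log_nonneg hG1) (hDG a)
  have hDfin : ∀ a, klDiv (U a : Measure Z) (Q : Measure Z) ≠ ∞ := fun a =>
    ((hDG a).trans_lt ENNReal.ofReal_lt_top).ne
  have hIfin : mutualInfo P U ≠ ∞ :=
    ((le_self_add.trans_lt hI).trans ENNReal.ofReal_lt_top).ne
  set I := (mutualInfo P U).toReal with hIdef
  have hPD : ∑ a, (P a).toReal * D a ≤ I * Real.log 2 + Real.log (1 + δ) := by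
    have h1 : ∑' a, P a * klDiv (U a : Measure Z) (Q : Measure Z) ≤
        mutualInfo P U * ENNReal.ofReal (Real.log 2) + ENNReal.ofReal (Real.log (1 + δ)) := by
      calc _ ≤ ∑' a, P a * (klDiv (U a : Measure Z) (output P U : Measure Z) +
            ENNReal.ofReal (Real.log (1 + δ))) :=
            ENNReal.tsum_le_tsum fun a => mul_le_mul_right
              (klDiv_le_add_log _ _ _ (by linarith) hPQ) _
        _ = _ := by
            simp_rw [mul_add]
            rw [ENNReal.tsum_add, ENNReal.tsum_mul_right, P.tsum_coe, one_mul, mutualInfo_mul_log]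
    have h2 := ENNReal.toReal_mono (ENNReal.add_ne_top.mpr
      ⟨ENNReal.mul_ne_top hIfin ENNReal.ofReal_ne_top, ENNReal.ofReal_ne_top⟩) h1
    rw [tsum_fintype, ENNReal.toReal_sum fun a _ => ENNReal.mul_ne_top (P.apply_ne_top a) (hDfin a),
      ENNReal.toReal_add (ENNReal.mul_ne_top hIfin ENNReal.ofReal_ne_top) ENNReal.ofReal_ne_top,
      ENNReal.toReal_mul, ENNReal.toReal_ofReal hlog2.le,
      ENNReal.toReal_ofReal (Real.log_nonneg (by linarith))] at h2
    simpa [ENNReal.toReal_mul] using h2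
  have hloss : 0 ≤ typicalLoss δ (Fintype.card A) := by
    have h1 : 0 ≤ Real.log (1 + δ) := Real.log_nonneg (by linarith)
    have h2 : 0 ≤ Real.log (Fintype.card A * (1 + δ) / δ) := Real.log_nonneg hG1
    rw [typicalLoss]
    positivity
  have hlt : I + typicalLoss δ (Fintype.card A) < t * r := by
    have h := (ENNReal.lt_ofReal_iff_toReal_lt
      (ENNReal.add_ne_top.mpr ⟨hIfin, ENNReal.coe_ne_top⟩)).mp hI
    rwa [ENNReal.toReal_add hIfin ENNReal.coe_ne_top, ENNReal.coe_toReal,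
      Real.coe_toNNReal _ hloss] at h
  refine exists_modular_leak_le_of_discrete hf hr ht C U Q hac
    (R := (I + typicalLoss δ (Fintype.card A)) * Real.log 2)
    (mul_lt_mul_of_pos_right hlt hlog2) ?_
  filter_upwards [hin, eventually_gt_atTop 0] with n hn hn0 x a ha
  have hn0' : (0 : ℝ) < n := Nat.cast_pos.mpr hn0
  -- Each letter occurs at most n(P(b) + δ) times. The P part contributes the mutual information up
  -- to log(1 + δ), the excess at most δ|A| log G; this is the origin of `typicalLoss`.
  have hcount : ∀ b, (Set.ncard {i | a i = b} : ℝ) ≤ n * ((P b).toReal + δ) := by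
    intro b
    have h := (abs_le.mp ((hn x ha) b).1).2
    rw [sub_le_iff_le_add, div_le_iff₀ hn0'] at h
    linarith
  have hD0 : ∀ b, 0 ≤ D b := fun b => ENNReal.toReal_nonneg
  calc ∑ i, D (a i) = ∑ b, (Set.ncard {i | a i = b} : ℝ) * D b := by
        simp_rw [ncard_setOf_eq_sum, Finset.sum_mul]
        rw [Finset.sum_comm]
        refine Finset.sum_congr rfl fun i _ => ?_
        simp
    _ ≤ ∑ b, n * ((P b).toReal + δ) * D b :=
        Finset.sum_le_sum fun b _ => mul_le_mul_of_nonneg_right (hcount b) (hD0 b)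
    _ = n * (∑ b, (P b).toReal * D b + δ * ∑ b, D b) := by
        rw [Finset.mul_sum, ← Finset.sum_add_distrib, Finset.mul_sum]
        exact Finset.sum_congr rfl fun b _ => by ring
    _ ≤ n * (I * Real.log 2 + Real.log (1 + δ) + δ * (Fintype.card A * Real.log G)) := by
        gcongr
        refine (Finset.sum_le_card_nsmul _ _ _ fun b _ => hDG' b).trans_eq ?_
        simp
    _ = _ := by
        rw [typicalLoss, ← hG, add_assoc, add_mul, div_mul_cancel₀ _ hlog2.ne']

end Discrete

/-! ### Gaussian channels -/

section Gaussian

/-- All scaled variances share the prefactor for `v`, with the scaling moved into the exponent, so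
products and quotients of Gaussian densities reduce to identities between exponents. -/
theorem gaussianPDFReal_div (m : ℝ) {v κ : ℝ≥0} (hκ : κ ≠ 0) (x : ℝ) :
    gaussianPDFReal m (v / κ) x = (√(2 * Real.pi * v))⁻¹ *
      Real.exp (Real.log κ / 2 - κ * (x - m) ^ 2 / (2 * v)) := by
  have hκ0 : (0 : ℝ) < κ := NNReal.coe_pos.mpr (pos_iff_ne_zero.mpr hκ)
  rw [gaussianPDFReal_def, NNReal.coe_div]
  beta_reduce
  have h1 : Real.exp (Real.log κ / 2) = √(κ : ℝ) := by
    rw [Real.sqrt_eq_rpow, Real.rpow_def_of_pos hκ0]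
    congr 1
    ring
  have h2 : √(2 * Real.pi * ((v : ℝ) / κ)) = √(2 * Real.pi * v) / √(κ : ℝ) := by
    rw [← Real.sqrt_div (by positivity), mul_div_assoc]
  have h3 : -(x - m) ^ 2 / (2 * ((v : ℝ) / κ)) = -(κ * (x - m) ^ 2 / (2 * v)) := by
    rw [← mul_div_assoc, div_div_eq_mul_div]
    ring
  rw [sub_eq_add_neg (Real.log κ / 2), Real.exp_add, h1, h2, h3, inv_div]
  ring

theorem gaussianPDFReal_eq (m : ℝ) (v : ℝ≥0) (x : ℝ) :
    gaussianPDFReal m v x = (√(2 * Real.pi * v))⁻¹ * Real.exp (-((x - m) ^ 2 / (2 * v))) := by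
  have := gaussianPDFReal_div m (v := v) one_ne_zero x
  simpa using this

/-- The density of the Gaussian distribution with mean `a` and variance `v` with respect to the
centered Gaussian distribution with variance `V`. -/
noncomputable def gaussianRatio (v V : ℝ≥0) (a z : ℝ) : ℝ :=
  Real.exp (Real.log (V / v) / 2 - (z - a) ^ 2 / (2 * v) + z ^ 2 / (2 * V))

theorem measurable_gaussianRatio (v V : ℝ≥0) (a : ℝ) : Measurable (gaussianRatio v V a) := by
  unfold gaussianRatio
  fun_prop

theorem gaussianReal_eq_withDensity_gaussianRatio {v V : ℝ≥0} (hv : v ≠ 0) (hV : V ≠ 0) (a : ℝ) :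
    gaussianReal a v = (gaussianReal 0 V).withDensity
      fun z => ENNReal.ofReal (gaussianRatio v V a z) := by
  rw [gaussianReal_of_var_ne_zero _ hv, gaussianReal_of_var_ne_zero _ hV,
    ← withDensity_mul _ (measurable_gaussianPDF 0 V) (measurable_gaussianRatio v V a).ennreal_ofReal]
  congr 1
  funext z
  rw [Pi.mul_apply, gaussianPDF, gaussianPDF, ← ENNReal.ofReal_mul (gaussianPDFReal_nonneg _ _ _)]
  congr 1
  have hv0 : (0 : ℝ) < v := NNReal.coe_pos.mpr (pos_iff_ne_zero.mpr hv)
  have hV0 : (0 : ℝ) < V := NNReal.coe_pos.mpr (pos_iff_ne_zero.mpr hV)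
  have h := gaussianPDFReal_div 0 (v := v) (κ := v / V) (div_ne_zero hv hV) z
  rw [div_div_cancel₀ hv] at h
  rw [h, gaussianPDFReal_eq, gaussianRatio, mul_assoc (√(2 * Real.pi * (v : ℝ)))⁻¹,
    ← Real.exp_add]
  congr 2
  rw [NNReal.coe_div, Real.log_div hv0.ne' hV0.ne', Real.log_div hV0.ne' hv0.ne']
  field_simp
  ring

/-- Completing the square: the density of the Gaussian law with mean a and variance v, tilted by a
power of the ratio, is a constant multiple of a Gaussian density with mean (1 + α)a/κ and variance
v/κ. -/
theorem lintegral_gaussianRatio_rpow {v V κ : ℝ≥0} (hv : v ≠ 0) (hV : V ≠ 0) (hκ : κ ≠ 0) {α : ℝ}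
    (hκα : (κ : ℝ) = 1 + α * (1 - v / V)) (a : ℝ) :
    ∫⁻ z, ENNReal.ofReal (gaussianRatio v V a z ^ α) ∂(gaussianReal a v) =
      ENNReal.ofReal (Real.exp (α * (Real.log (V / v) / 2) - Real.log κ / 2 +
        a ^ 2 * (α * (1 + α) / (2 * V * κ)))) := by
  have hv0 : (0 : ℝ) < v := NNReal.coe_pos.mpr (pos_iff_ne_zero.mpr hv)
  have hV0 : (0 : ℝ) < V := NNReal.coe_pos.mpr (pos_iff_ne_zero.mpr hV)
  have hκ0 : (0 : ℝ) < κ := NNReal.coe_pos.mpr (pos_iff_ne_zero.mpr hκ)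
  rw [gaussianReal_of_var_ne_zero _ hv, lintegral_withDensity_eq_lintegral_mul _
    (measurable_gaussianPDF a v) ((measurable_gaussianRatio v V a).pow_const α).ennreal_ofReal]
  have hpt : ∀ z, (gaussianPDF a v * fun z => ENNReal.ofReal (gaussianRatio v V a z ^ α)) z =
      ENNReal.ofReal (Real.exp (α * (Real.log (V / v) / 2) - Real.log κ / 2 +
        a ^ 2 * (α * (1 + α) / (2 * V * κ)))) * gaussianPDF ((1 + α) * a / κ) (v / κ) z := by
    intro z
    rw [Pi.mul_apply, gaussianPDF, gaussianPDF, ← ENNReal.ofReal_mul (gaussianPDFReal_nonneg _ _ _),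
      ← ENNReal.ofReal_mul (Real.exp_pos _).le]
    congr 1
    rw [gaussianPDFReal_div _ hκ, gaussianPDFReal_eq, gaussianRatio, ← Real.exp_mul,
      mul_assoc (√(2 * Real.pi * (v : ℝ)))⁻¹, ← Real.exp_add, mul_left_comm (Real.exp _),
      ← Real.exp_add]
    congr 2
    have h1 : (κ : ℝ) * V = V + α * (V - v) := by
      rw [hκα]
      field_simp
    have h2 : (κ : ℝ) * (z - (1 + α) * a / κ) ^ 2 / (2 * v) =
        κ * z ^ 2 / (2 * v) - (1 + α) * a * z / v + (1 + α) ^ 2 * a ^ 2 / (2 * v * κ) := by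
      field_simp
      ring
    have h3 : (κ : ℝ) * z ^ 2 / (2 * v) = (1 + α) * z ^ 2 / (2 * v) - α * z ^ 2 / (2 * V) := by
      rw [hκα]
      field_simp
      ring
    have h4 : (1 + α) ^ 2 * a ^ 2 / (2 * v * κ) =
        (1 + α) * a ^ 2 / (2 * v) + a ^ 2 * (α * (1 + α) / (2 * V * κ)) := by
      field_simp
      linear_combination (-(a ^ 2 * (1 + α))) * h1
    rw [h2, h3, h4]
    field_simp
    ring
  simp_rw [hpt]
  rw [lintegral_const_mul _ (measurable_gaussianPDF _ _),
    lintegral_gaussianPDF_eq_one _ (div_ne_zero hv hκ), mul_one]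

variable {S X K : ℕ → Type*} [∀ n, Fintype (X n)] [∀ n, Fintype (S n)] [∀ n, Nonempty (S n)]
  [∀ n, Nonempty (X n)] {Y : Type*} [MeasurableSpace Y]

/-- The logarithm of each moment is affine in the square of the input letter, so the power
constraint alone bounds the product of the moments. -/
theorem exists_modular_leak_le_of_gaussian {f : ∀ n, BRI (S n) (X n) (K n)} {r t : ℝ}
    (hf : IsGoodSequence f r t) (hr : 0 < r) (ht : 0 < t)
    (C : ∀ n, ErrCode (X n) (Fin n → ℝ) (Fin n → Y)) {v : ℝ≥0} {Γ : ℝ} (hv : 0 < v) (hΓ : 0 ≤ Γ)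
    (hin : ∀ n : ℕ, (C n).InputsIn {a | ∑ i, (a i) ^ 2 ≤ (n : ℝ) * Γ})
    (hR : 1 / 2 * Real.logb 2 (1 + Γ / (v : ℝ)) < t * r) :
    ∃ c : ℝ, 0 < c ∧ ∀ᶠ n : ℕ in atTop, (modular (f n) (C n)).leak ((gaussianChannel v).pow n) ≤
      ENNReal.ofReal ((2 : ℝ) ^ (-(c * (n : ℝ)))) := by
  have hlog2 : 0 < Real.log 2 := Real.log_pos one_lt_two
  have hv0 : (0 : ℝ) < v := NNReal.coe_pos.mpr hv
  -- The variance of the output when the input is centered Gaussian of variance Γ.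
  set V : ℝ≥0 := v + Γ.toNNReal with hVdef
  have hVr : (V : ℝ) = v + Γ := by rw [hVdef, NNReal.coe_add, Real.coe_toNNReal _ hΓ]
  have hV0 : (0 : ℝ) < V := by
    rw [hVr]
    linarith
  have hV : V ≠ 0 := (NNReal.coe_pos.mp hV0).ne'
  have hVv : (V : ℝ) / v = 1 + Γ / v := by
    rw [hVr]
    field_simp
  refine exists_modular_leak_le hf hr ht C (gaussianChannel v) (gaussianReal 0 V)
    (L := gaussianRatio v V) (fun a z => (Real.exp_pos _).le)
    (fun a => measurable_gaussianRatio v V a)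
    (fun a => gaussianReal_eq_withDensity_gaussianRatio hv.ne' hV a)
    _ (Eventually.of_forall hin) (R := Real.log (V / v) / 2) ?_ fun δ hδ => ?_
  · rw [hVv]
    have h1 : 1 / 2 * Real.logb 2 (1 + Γ / v) * Real.log 2 = Real.log (1 + Γ / v) / 2 := by
      rw [Real.logb]
      field_simp
    rw [← h1]
    exact mul_lt_mul_of_pos_right hR hlog2
  -- The excess exponent per letter over α log(V/v)/2 will be at most α²/2, which equals αδ for α =
  -- 2δ.
  · refine ⟨2 * δ, by positivity, fun n a ha => ?_⟩
    set α := 2 * δ with hα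
    have hα0 : 0 < α := by positivity
    set ρ : ℝ := 1 - v / V with hρ
    have hρΓ : ρ = Γ / V := by
      rw [hρ, eq_div_iff hV0.ne', sub_mul, div_mul_cancel₀ _ hV0.ne', hVr]
      ring
    have hρ0 : 0 ≤ ρ := by
      rw [hρΓ]
      positivity
    have hρ1 : ρ ≤ 1 := by
      have : 0 ≤ (v : ℝ) / V := by positivity
      linarith
    have hκ1 : 1 ≤ 1 + α * ρ := by
      have : 0 ≤ α * ρ := by positivity
      linarith
    set κ : ℝ≥0 := ⟨1 + α * ρ, by linarith⟩ with hκ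
    have hκr : (κ : ℝ) = 1 + α * ρ := rfl
    have hκ0 : (0 : ℝ) < κ := by
      rw [hκr]
      linarith
    have hκne : κ ≠ 0 := (NNReal.coe_pos.mp hκ0).ne'
    have hmom : ∀ i, ∫⁻ z, ENNReal.ofReal (gaussianRatio v V (a i) z ^ α)
        ∂(gaussianChannel v (a i) : Measure ℝ) =
        ENNReal.ofReal (Real.exp (α * (Real.log (V / v) / 2) - Real.log κ / 2 +
          a i ^ 2 * (α * (1 + α) / (2 * V * κ)))) := fun i =>
      lintegral_gaussianRatio_rpow hv.ne' hV hκne hκr (a i)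
    simp_rw [hmom]
    rw [← ENNReal.ofReal_prod_of_nonneg fun i _ => (Real.exp_pos _).le, ← Real.exp_sum]
    refine ENNReal.ofReal_le_ofReal (Real.exp_le_exp.mpr ?_)
    rw [Finset.sum_add_distrib, ← Finset.sum_mul, Finset.sum_const, Finset.card_univ,
      Fintype.card_fin, nsmul_eq_mul]
    have h1 : (∑ i, a i ^ 2) * (α * (1 + α) / (2 * V * κ)) ≤
        n * Γ * (α * (1 + α) / (2 * V * κ)) :=
      mul_le_mul_of_nonneg_right ha (by positivity)
    have h2 : Γ * (α * (1 + α) / (2 * V * κ)) = α * ρ * (1 + α) / κ / 2 := by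
      rw [hρΓ]
      field_simp
    -- From log κ ≥ 1 - 1/κ. This cancels the first-order part of the power term and leaves half of
    -- α²ρ/κ.
    have h3 : α * ρ / κ ≤ Real.log κ := by
      have h := Real.one_sub_inv_le_log_of_pos hκ0
      have : 1 - (κ : ℝ)⁻¹ = α * ρ / κ := by
        field_simp
        rw [hκr]
        ring
      linarith
    have h4 : α * ρ * (1 + α) / κ = α * ρ / κ + α ^ 2 * ρ / κ := by
      field_simp
    have h5 : α ^ 2 * ρ / κ ≤ α ^ 2 := by
      rw [div_le_iff₀ hκ0, hκr]
      have : α ^ 2 * ρ ≤ α ^ 2 * 1 := mul_le_mul_of_nonneg_left hρ1 (by positivity)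
      have : α ^ 2 * 1 ≤ α ^ 2 * (1 + α * ρ) := mul_le_mul_of_nonneg_left hκ1 (by positivity)
      linarith
    have h6 : Γ * (α * (1 + α) / (2 * V * κ)) - Real.log κ / 2 ≤ α * δ := by
      have : α ^ 2 = 2 * (α * δ) := by
        rw [hα]
        ring
      rw [h2, h4]
      linarith
    have h7 : (n : ℝ) * (Γ * (α * (1 + α) / (2 * V * κ)) - Real.log κ / 2) ≤ n * (α * δ) :=
      mul_le_mul_of_nonneg_left h6 (Nat.cast_nonneg _)
    linarith

end Gaussian

end Wiretap

/-! ### Concatenated inputs, restricted codes and the main theorem -/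

namespace Wiretap

theorem sum_joinBlocks {A : Type*} {k n : ℕ} (b : Fin k → Fin n → A) (F : A → ℝ) :
    ∑ i, F (joinBlocks b i) = ∑ j, ∑ i, F (b j i) := by
  rw [← finProdFinEquiv.sum_comp, Fintype.sum_prod_type]
  simp [joinBlocks]

theorem joinBlocks_mem_permissible_gaussianWiretap (vT vU : ℝ≥0) (Γ : ℝ) (k n : ℕ)
    (b : Fin k → Fin n → ℝ) (hb : ∀ j, b j ∈ (gaussianWiretap vT vU Γ).permissible n) :
    joinBlocks b ∈ (gaussianWiretap vT vU Γ).permissible (k * n) := by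
  change ∑ i, joinBlocks b i ^ 2 ≤ ((k * n : ℕ) : ℝ) * Γ
  rw [sum_joinBlocks b fun x => x ^ 2]
  refine (Finset.sum_le_card_nsmul _ _ ((n : ℝ) * Γ) fun j _ => hb j).trans_eq ?_
  rw [Finset.card_univ, Fintype.card_fin, nsmul_eq_mul, Nat.cast_mul, mul_assoc]

theorem tendsto_restrict_err {A Y : Type*} [MeasurableSpace Y] {T : Channel A Y}
    {X X' : ℕ → Type*} [∀ n, Finite (X' n)]
    {C : ∀ n, ErrCode (X' n) (Fin n → A) (Fin n → Y)} {ι : ∀ n, X n → X' n} {ρ : ∀ n, X' n → X n}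
    (hι : ∀ᶠ n in atTop, Function.LeftInverse (ρ n) (ι n))
    (hC : Tendsto (fun n => (C n).err (T.pow n)) atTop (𝓝 0)) :
    Tendsto (fun n => ((C n).restrict (ι n) (ρ n)).err (T.pow n)) atTop (𝓝 0) :=
  tendsto_of_tendsto_of_tendsto_of_le_of_le' tendsto_const_nhds hC
    (Eventually.of_forall fun _ => zero_le)
    (hι.mono fun n hn => (C n).restrict_err_le hn (T.pow n))

end Wiretap

theorem mainTheorem9 :
    -- Rate, error probability and leakage of a single ordinary BRI wiretap code.
    (∀ {A Y Z : Type*} [MeasurableSpace Y] [MeasurableSpace Z] (T : Channel A Y) (U : Channel A Z)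
        {S X K : Type*} [Fintype S] [Nonempty S] [Fintype X]
        (n N : ℕ) (f : BRI S X K) (C : ErrCode X (Fin n → A) (Fin n → Y))
        (σ : S → X) (τ : X → S), Function.LeftInverse τ σ →
        rate (Fin N → f.Msg) ((N + 1) * n) = (N : ℝ) / ((N : ℝ) + 1) * rate f.Msg n ∧
        (seedReuse f C σ τ N).err (T.pow ((N + 1) * n)) ≤
          C.err (T.pow n) + (N : ℝ≥0∞) * (modular f C).err (T.pow n) ∧
        (seedReuse f C σ τ N).leak (U.pow ((N + 1) * n)) ≤
          (N : ℝ≥0∞) * (modular f C).leak (U.pow n)) ∧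
    -- Asymptotics. The codes `C n` have message sets `X' n`; `ι n` embeds `X n` in `X' n`
    -- for large `n`, and `σ n` embeds `S n` in `X n`.
    ∃ γ : ℝ → ℕ → ℕ → ℝ≥0,
      (∀ a z : ℕ, Tendsto (fun δ => γ δ a z) (𝓝[>] 0) (𝓝 0)) ∧
      ∀ {S X K X' : ℕ → Type*} [∀ n, Fintype (S n)] [∀ n, Nonempty (S n)] [∀ n, Fintype (X n)]
        [∀ n, Fintype (X' n)]
        (r t : ℝ), 0 ≤ r → 0 ≤ t → t < 1 →
        ∀ f : ∀ n, BRI (S n) (X n) (K n), IsGoodSequence f r t →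
        ∀ (σ : ∀ n, S n → X n) (τ : ∀ n, X n → S n),
          (∀ n, Function.LeftInverse (τ n) (σ n)) →
        ∀ (ι : ∀ n, X n → X' n) (ρ : ∀ n, X' n → X n),
          (∀ᶠ n in atTop, Function.LeftInverse (ρ n) (ι n)) →
        -- Discrete wiretap channels.
        (∀ {A Y Z : Type*} [Fintype A] [Fintype Y] [Fintype Z]
            [MeasurableSpace Y] [DiscreteMeasurableSpace Y]
            [MeasurableSpace Z] [DiscreteMeasurableSpace Z]
            (T : Channel A Y) (U : Channel A Z)
            (C : ∀ n, ErrCode (X' n) (Fin n → A) (Fin n → Y)),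
            (∃ r' > r, (unconstrained T U).CodesAchieve C r') →
            ((⨆ P : PMF A, mutualInfo P U) < ENNReal.ofReal (t * r) →
              (unconstrained T U).SeedReuseAchieves f (fun n => (C n).restrict (ι n) (ρ n)) σ τ
                ((1 - t) * r)) ∧
            (∀ (P : PMF A) (δ : ℝ), 0 < δ →
              (∀ᶠ n in atTop, (C n).InputsIn (typicalSet P δ n)) →
              mutualInfo P U + (γ δ (Fintype.card A) (Fintype.card Z) : ℝ≥0∞) <
                ENNReal.ofReal (t * r) →
              (unconstrained T U).SeedReuseAchieves f (fun n => (C n).restrict (ι n) (ρ n)) σ τ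
                ((1 - t) * r))) ∧
        -- Gaussian wiretap channels.
        (∀ (vT vU : ℝ≥0) (Γ : ℝ), 0 < vT → 0 < vU → 0 ≤ Γ →
            ∀ C : ∀ n, ErrCode (X' n) (Fin n → ℝ) (Fin n → ℝ),
            (∃ r' > r, (gaussianWiretap vT vU Γ).CodesAchieve C r') →
            1 / 2 * Real.logb 2 (1 + Γ / (vU : ℝ)) < t * r →
            (gaussianWiretap vT vU Γ).SeedReuseAchieves f (fun n => (C n).restrict (ι n) (ρ n)) σ τ
              ((1 - t) * r)) := by
  -- The loss does not depend on the size of the output alphabet. Truncation to nonnegative reals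
  -- changes nothing for δ > 0 and a nonempty alphabet, where the loss is already nonnegative.
  refine ⟨?_, fun δ a _ => (typicalLoss δ a).toNNReal, fun a _ => ?_, ?_⟩
  · intro A Y Z _ _ T U S X K _ _ _ n N f C σ τ hτ
    exact ⟨rate_fun f.Msg N, seedReuse_err_le T N f C σ τ hτ, seedReuse_leak_le U N f C σ τ⟩
  · have h := (continuous_real_toNNReal.tendsto 0).comp (tendsto_typicalLoss a)
    rwa [Real.toNNReal_zero] at h
  intro S X K X' _ _ _ _ r t hr ht _ f hf σ τ hτ ι ρ hι
  have hX : ∀ n, Nonempty (X n) := fun n => ⟨σ n (Classical.arbitrary _)⟩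
  -- Each of the three rate conditions puts tr strictly above a nonnegative quantity, which excludes
  -- the degenerate values r = 0 and t = 0.
  have hpos : 0 < t * r → 0 < r ∧ 0 < t := fun h =>
    ⟨pos_of_mul_pos_right h ht, pos_of_mul_pos_left h hr⟩
  refine ⟨?_, ?_⟩
  · intro A Y Z _ _ _ _ _ _ _ T U C hC
    obtain ⟨r', _, hC⟩ := hC
    have key := fun (hr0 : 0 < r) => (unconstrained T U).seedReuseAchieves_of_leak hf hr0 hτ
      (fun n => (C n).restrict (ι n) (ρ n)) (fun n x => hC.1 n (ι n x))
      (fun _ _ _ _ => Set.mem_univ _) (tendsto_restrict_err hι hC.2.2)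
    refine ⟨fun hcap => ?_, fun P δ hδ hin hI => ?_⟩
    · obtain ⟨hr0, ht0⟩ := hpos (ENNReal.ofReal_pos.mp (zero_le.trans_lt hcap))
      -- A codeword of blocklength one supplies a letter.
      have : Nonempty A :=
        ((C 1).enc (ι 1 (Classical.arbitrary _))).support_nonempty.to_type.map fun a => a 0
      exact key hr0 (exists_modular_leak_le_of_capacity_lt hf hr0 ht0 _ U hcap)
    · obtain ⟨hr0, ht0⟩ := hpos (ENNReal.ofReal_pos.mp (zero_le.trans_lt hI))
      exact key hr0 (exists_modular_leak_le_of_typical hf hr0 ht0 _ U P hδ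
        (hin.mono fun n hn x => hn (ι n x)) hI)
  · intro vT vU Γ _ hvU hΓ C hC hlt
    obtain ⟨r', _, hC⟩ := hC
    have h0 : 0 ≤ 1 / 2 * Real.logb 2 (1 + Γ / (vU : ℝ)) := by
      have h1 : 0 ≤ Γ / (vU : ℝ) := by positivity
      have h2 := Real.logb_nonneg one_lt_two (le_add_of_nonneg_right h1)
      positivity
    obtain ⟨hr0, ht0⟩ := hpos (h0.trans_lt hlt)
    exact (gaussianWiretap vT vU Γ).seedReuseAchieves_of_leak hf hr0 hτ
      (fun n => (C n).restrict (ι n) (ρ n)) (fun n x => hC.1 n (ι n x))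
      (joinBlocks_mem_permissible_gaussianWiretap vT vU Γ) (tendsto_restrict_err hι hC.2.2)
      (exists_modular_leak_le_of_gaussian hf hr0 ht0 _ hvU hΓ (fun n x => hC.1 n (ι n x)) hlt)
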